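/- Let $(W,S)$ be a Coxeter system with Coxeter matrix $(m_{s,t})_{s,t\in S}$, $m_{s,t}\in\{1,2,3,\dots\}\cup\{\infty\}$; neither irreducibility nor finiteness of $S$ is assumed. Let $H_W$ be its equal parameter Hecke algebra over $\mathbb{Z}[v^{\pm1}]$, with generators $\delta_w$ ($w\in W$), $\delta_1=1$, subject to $\delta_x\delta_y=\delta_{xy}$ whenever $\ell(xy)=\ell(x)+\ell(y)$ and $(\delta_s-v^{-1})(\delta_s+v)=0$ for $s\in S$. Let $(b_w)_{w\in W}$ be its Kazhdan–Lusztig basis: $b_x$ is the unique element that is invariant under the bar involution ($v\mapsto v^{-1}$, $\delta_w\mapsto(\delta_{w^{-1}})^{-1}$) and has the form $\delta_x+\sum_{y<x}h_{y,x}\delta_y$ with $h_{y,x}\in v\mathbb{Z}[v]$, where $<$ is the Bruhat order. Write $b_xb_y=\sum_{z}h_{x,y,z}b_z$. For $z\in W$ let $a(z)\in\mathbb{N}\cup\{\infty\}$ be the smallest natural number $n$ with $v^{n}h_{x,y,z}\in\mathbb{Z}[v]$ for all $x,y\in W$, or $\infty$ if there is none, and put $W_1=\{z\in W\mid a(z)=1\}$.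 The Dynkin diagram (Coxeter graph) of $W$ is the graph on $S$ in which distinct $s,t$ are joined iff $m_{s,t}\ge 3$ (including $m_{s,t}=\infty$). Then $W_1$ is finite if and only if $S$ is finite and every connected component of the Dynkin diagram is a tree, has no pair $s,t$ of vertices with $m_{s,t}=\infty$, and has at most one unordered pair $\{s,t\}$ of vertices with $m_{s,t}>3$. -/

import Mathlib

open scoped LaurentPolynomial Polynomial

noncomputable section

namespace CoxeterMatrix

/-- The Dynkin diagram (Coxeter graph) of a Coxeter matrix, as a graph on the index set of the
simple reflections: distinct `s`, `t` are joined iff `m_{s,t} ≠ 2`.  As `m_{s,t} = 1` only on the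
diagonal, these are the pairs with `m_{s,t} ≥ 3` or `m_{s,t} = ∞` (the latter is encoded as `0`). -/
def dynkinDiagram {B : Type*} (M : CoxeterMatrix B) : SimpleGraph B where
  Adj s t := s ≠ t ∧ M s t ≠ 2
  symm := ⟨fun s t h => ⟨h.1.symm, by rw [M.symmetric t s]; exact h.2⟩⟩
  loopless := ⟨fun _ h => h.1 rfl⟩

end CoxeterMatrix

namespace CoxeterSystem

/-- The defining relations of the Hecke algebra over `ℤ[v, v⁻¹]` on generators `δ_w`, `w ∈ W`:
`δ_1 = 1`, the braid relations in the form `δ_x δ_y = δ_{xy}` whenever `ℓ(xy) = ℓ(x) + ℓ(y)`, and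
the quadratic relations `(δ_s - v⁻¹)(δ_s + v) = 0`.  Here `v` is `LaurentPolynomial.T 1`. -/
inductive HeckeRel {B W : Type*} [Group W] {M : CoxeterMatrix B} (cs : CoxeterSystem M W) :
    FreeAlgebra ℤ[T;T⁻¹] W → FreeAlgebra ℤ[T;T⁻¹] W → Prop
  | one : HeckeRel cs (FreeAlgebra.ι ℤ[T;T⁻¹] (1 : W)) 1
  | mul (x y : W) (h : cs.length (x * y) = cs.length x + cs.length y) :
      HeckeRel cs (FreeAlgebra.ι ℤ[T;T⁻¹] x * FreeAlgebra.ι ℤ[T;T⁻¹] y)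
        (FreeAlgebra.ι ℤ[T;T⁻¹] (x * y))
  | quadratic (s : B) :
      HeckeRel cs
        ((FreeAlgebra.ι ℤ[T;T⁻¹] (cs.simple s) -
            algebraMap ℤ[T;T⁻¹] _ (LaurentPolynomial.T (-1))) *
          (FreeAlgebra.ι ℤ[T;T⁻¹] (cs.simple s) +
            algebraMap ℤ[T;T⁻¹] _ (LaurentPolynomial.T 1))) 0

/-- The (equal parameter) Hecke algebra `H_W` of a Coxeter system. -/
def Hecke {B W : Type*} [Group W] {M : CoxeterMatrix B} (cs : CoxeterSystem M W) : Type _ :=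
  RingQuot (HeckeRel cs)

instance {B W : Type*} [Group W] {M : CoxeterMatrix B} (cs : CoxeterSystem M W) : Ring cs.Hecke :=
  inferInstanceAs (Ring (RingQuot (HeckeRel cs)))

instance {B W : Type*} [Group W] {M : CoxeterMatrix B} (cs : CoxeterSystem M W) :
    Algebra ℤ[T;T⁻¹] cs.Hecke :=
  inferInstanceAs (Algebra ℤ[T;T⁻¹] (RingQuot (HeckeRel cs)))

/-- The quotient map from the free algebra to the Hecke algebra. -/
def heckeMk {B W : Type*} [Group W] {M : CoxeterMatrix B} (cs : CoxeterSystem M W) :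
    FreeAlgebra ℤ[T;T⁻¹] W →ₐ[ℤ[T;T⁻¹]] cs.Hecke :=
  RingQuot.mkAlgHom ℤ[T;T⁻¹] (HeckeRel cs)

theorem heckeMk_rel {B W : Type*} [Group W] {M : CoxeterMatrix B} (cs : CoxeterSystem M W)
    {a b : FreeAlgebra ℤ[T;T⁻¹] W} (h : HeckeRel cs a b) : cs.heckeMk a = cs.heckeMk b :=
  RingQuot.mkAlgHom_rel ℤ[T;T⁻¹] h

/-- The standard generator `δ_w` of the Hecke algebra. -/
def heckeStd {B W : Type*} [Group W] {M : CoxeterMatrix B} (cs : CoxeterSystem M W) (w : W) :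
    cs.Hecke :=
  cs.heckeMk (FreeAlgebra.ι ℤ[T;T⁻¹] w)

theorem heckeStd_one {B W : Type*} [Group W] {M : CoxeterMatrix B} (cs : CoxeterSystem M W) :
    cs.heckeStd 1 = 1 := by
  rw [heckeStd, cs.heckeMk_rel (HeckeRel.one (cs := cs)), map_one]

theorem heckeStd_mul {B W : Type*} [Group W] {M : CoxeterMatrix B} (cs : CoxeterSystem M W)
    (x y : W) (h : cs.length (x * y) = cs.length x + cs.length y) :
    cs.heckeStd x * cs.heckeStd y = cs.heckeStd (x * y) := by
  rw [heckeStd, heckeStd, ← map_mul, cs.heckeMk_rel (HeckeRel.mul x y h), heckeStd]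

theorem heckeStd_quadratic {B W : Type*} [Group W] {M : CoxeterMatrix B}
    (cs : CoxeterSystem M W) (s : B) :
    (cs.heckeStd (cs.simple s) - algebraMap ℤ[T;T⁻¹] cs.Hecke (LaurentPolynomial.T (-1))) *
      (cs.heckeStd (cs.simple s) + algebraMap ℤ[T;T⁻¹] cs.Hecke (LaurentPolynomial.T 1)) = 0 := by
  have h := cs.heckeMk_rel (HeckeRel.quadratic (cs := cs) s)
  rw [map_mul, map_sub, map_add, AlgHom.commutes, AlgHom.commutes, map_zero] at h
  exact h

theorem algebraMap_T_mul {B W : Type*} [Group W] {M : CoxeterMatrix B} (cs : CoxeterSystem M W) :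
    algebraMap ℤ[T;T⁻¹] cs.Hecke (LaurentPolynomial.T (-1)) *
      algebraMap ℤ[T;T⁻¹] cs.Hecke (LaurentPolynomial.T 1) = 1 := by
  rw [← map_mul, ← LaurentPolynomial.T_add]
  simp

/-- `δ_s` is invertible with inverse `δ_s + v - v⁻¹`. -/
theorem heckeStd_simple_mul {B W : Type*} [Group W] {M : CoxeterMatrix B}
    (cs : CoxeterSystem M W) (s : B) :
    cs.heckeStd (cs.simple s) * (cs.heckeStd (cs.simple s) +
      algebraMap ℤ[T;T⁻¹] cs.Hecke (LaurentPolynomial.T 1) -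
      algebraMap ℤ[T;T⁻¹] cs.Hecke (LaurentPolynomial.T (-1))) = 1 ∧
    (cs.heckeStd (cs.simple s) +
      algebraMap ℤ[T;T⁻¹] cs.Hecke (LaurentPolynomial.T 1) -
      algebraMap ℤ[T;T⁻¹] cs.Hecke (LaurentPolynomial.T (-1))) * cs.heckeStd (cs.simple s) = 1 := by
  have h := cs.heckeStd_quadratic s
  have h1 := cs.algebraMap_T_mul
  have c1 := Algebra.commutes (LaurentPolynomial.T (-1) : ℤ[T;T⁻¹]) (cs.heckeStd (cs.simple s))
  have c2 := Algebra.commutes (LaurentPolynomial.T 1 : ℤ[T;T⁻¹]) (cs.heckeStd (cs.simple s))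
  simp only [sub_mul, mul_add, mul_sub, add_mul, h1] at h ⊢
  rw [c1] at h ⊢
  rw [c2]
  clear h1 c1 c2
  generalize algebraMap ℤ[T;T⁻¹] cs.Hecke (LaurentPolynomial.T (-1)) = p at *
  generalize algebraMap ℤ[T;T⁻¹] cs.Hecke (LaurentPolynomial.T 1) = q at *
  constructor <;> · rw [← sub_eq_zero, ← h]; abel

theorem isUnit_heckeStd {B W : Type*} [Group W] {M : CoxeterMatrix B}
    (cs : CoxeterSystem M W) (w : W) : IsUnit (cs.heckeStd w) := by
  induction hn : cs.length w generalizing w with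
  | zero =>
    rw [cs.length_eq_zero_iff.1 hn, heckeStd_one]
    exact isUnit_one
  | succ n ih =>
    have hw : w ≠ 1 := by
      rintro rfl
      simp at hn
    obtain ⟨s, hs⟩ := cs.exists_leftDescent_of_ne_one hw
    rw [cs.isLeftDescent_iff] at hs
    have hm := cs.heckeStd_mul (cs.simple s) (cs.simple s * w) (by
      rw [cs.simple_mul_simple_cancel_left, cs.length_simple]; omega)
    rw [cs.simple_mul_simple_cancel_left] at hm
    rw [← hm]
    have hu := cs.heckeStd_simple_mul s
    have h' : IsUnit (cs.heckeStd (cs.simple s)) := ⟨⟨_, _, hu.1, hu.2⟩, rfl⟩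
    exact h'.mul (ih _ (by omega))

/-- The `ℤ[v, v⁻¹]`-algebra structure on the Hecke algebra twisted by `v ↦ v⁻¹`. -/
@[reducible] def twistedAlgebra {B W : Type*} [Group W] {M : CoxeterMatrix B}
    (cs : CoxeterSystem M W) : Algebra ℤ[T;T⁻¹] cs.Hecke :=
  ((algebraMap ℤ[T;T⁻¹] cs.Hecke).comp
    (LaurentPolynomial.invert (R := ℤ)).toRingEquiv.toRingHom).toAlgebra'
    (fun c x => Algebra.commutes (LaurentPolynomial.invert c) x)

/-- The ring homomorphism from the free algebra to the Hecke algebra with `v ↦ v⁻¹` and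
`δ_w ↦ (δ_{w⁻¹})⁻¹`. -/
def preBar {B W : Type*} [Group W] {M : CoxeterMatrix B} (cs : CoxeterSystem M W) :
    FreeAlgebra ℤ[T;T⁻¹] W →+* cs.Hecke :=
  letI := cs.twistedAlgebra
  (FreeAlgebra.lift ℤ[T;T⁻¹] (A := cs.Hecke)
    fun w : W => Ring.inverse (cs.heckeStd w⁻¹)).toRingHom

theorem preBar_ι {B W : Type*} [Group W] {M : CoxeterMatrix B} (cs : CoxeterSystem M W) (w : W) :
    cs.preBar (FreeAlgebra.ι ℤ[T;T⁻¹] w) = Ring.inverse (cs.heckeStd w⁻¹) := by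
  let := cs.twistedAlgebra
  exact FreeAlgebra.lift_ι_apply (R := ℤ[T;T⁻¹]) (A := cs.Hecke) _ w

theorem preBar_algebraMap {B W : Type*} [Group W] {M : CoxeterMatrix B} (cs : CoxeterSystem M W)
    (a : ℤ[T;T⁻¹]) :
    cs.preBar (algebraMap ℤ[T;T⁻¹] _ a) =
      algebraMap ℤ[T;T⁻¹] cs.Hecke (LaurentPolynomial.invert a) := by
  let := cs.twistedAlgebra
  exact AlgHom.commutes (FreeAlgebra.lift ℤ[T;T⁻¹] (A := cs.Hecke)
    fun w : W => Ring.inverse (cs.heckeStd w⁻¹)) a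

theorem preBar_rel {B W : Type*} [Group W] {M : CoxeterMatrix B} (cs : CoxeterSystem M W)
    ⦃a b : FreeAlgebra ℤ[T;T⁻¹] W⦄ (h : HeckeRel cs a b) : cs.preBar a = cs.preBar b := by
  cases h with
  | one => rw [preBar_ι, inv_one, heckeStd_one, Ring.inverse_one, map_one]
  | mul x y h =>
    have h' := cs.heckeStd_mul y⁻¹ x⁻¹ (by
      rw [← mul_inv_rev, cs.length_inv, cs.length_inv, cs.length_inv, h, add_comm])
    rw [map_mul, preBar_ι, preBar_ι, preBar_ι, mul_inv_rev, ← h']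
    obtain ⟨p, hp⟩ := cs.isUnit_heckeStd x⁻¹
    obtain ⟨q, hq⟩ := cs.isUnit_heckeStd y⁻¹
    rw [← hp, ← hq, ← Units.val_mul, Ring.inverse_unit, Ring.inverse_unit, Ring.inverse_unit,
      mul_inv_rev, Units.val_mul]
  | quadratic s =>
    have hu := cs.heckeStd_simple_mul s
    have hi : Ring.inverse (cs.heckeStd (cs.simple s)⁻¹) = cs.heckeStd (cs.simple s) +
        algebraMap ℤ[T;T⁻¹] cs.Hecke (LaurentPolynomial.T 1) -
        algebraMap ℤ[T;T⁻¹] cs.Hecke (LaurentPolynomial.T (-1)) := by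
      rw [cs.inv_simple]
      exact Ring.inverse_unit (⟨_, _, hu.1, hu.2⟩ : cs.Heckeˣ)
    rw [map_mul, map_sub, map_add, map_zero, preBar_ι, preBar_algebraMap, preBar_algebraMap, hi,
      LaurentPolynomial.invert_T, LaurentPolynomial.invert_T, neg_neg]
    have h := cs.heckeStd_quadratic s
    convert h using 2 <;> abel

/-- The bar involution of the Hecke algebra, i.e. the ring homomorphism with `v ↦ v⁻¹` and
`δ_w ↦ (δ_{w⁻¹})⁻¹`. -/
def heckeBar {B W : Type*} [Group W] {M : CoxeterMatrix B} (cs : CoxeterSystem M W) :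
    cs.Hecke →+* cs.Hecke :=
  RingQuot.lift ⟨cs.preBar, cs.preBar_rel⟩

theorem heckeBar_heckeMk {B W : Type*} [Group W] {M : CoxeterMatrix B} (cs : CoxeterSystem M W)
    (a : FreeAlgebra ℤ[T;T⁻¹] W) : cs.heckeBar (cs.heckeMk a) = cs.preBar a := by
  have h := RingQuot.lift_mkRingHom_apply cs.preBar cs.preBar_rel a
  rw [← RingQuot.mkAlgHom_coe ℤ[T;T⁻¹]] at h
  exact h

theorem heckeBar_heckeStd {B W : Type*} [Group W] {M : CoxeterMatrix B} (cs : CoxeterSystem M W)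
    (w : W) : cs.heckeBar (cs.heckeStd w) = Ring.inverse (cs.heckeStd w⁻¹) := by
  rw [heckeStd, heckeBar_heckeMk, preBar_ι]

theorem heckeBar_algebraMap {B W : Type*} [Group W] {M : CoxeterMatrix B} (cs : CoxeterSystem M W)
    (a : ℤ[T;T⁻¹]) :
    cs.heckeBar (algebraMap ℤ[T;T⁻¹] cs.Hecke a) =
      algebraMap ℤ[T;T⁻¹] cs.Hecke (LaurentPolynomial.invert a) := by
  rw [← AlgHom.commutes cs.heckeMk a, heckeBar_heckeMk, preBar_algebraMap]

/-- The strict Bruhat order: `u < w` iff there is a chain from `u` to `w` whose steps are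
right multiplications by a reflection that increase the length. -/
def bruhatLT {B W : Type*} [Group W] {M : CoxeterMatrix B} (cs : CoxeterSystem M W) :
    W → W → Prop :=
  Relation.TransGen fun a b => ∃ t, cs.IsReflection t ∧ b = a * t ∧ cs.length a < cs.length b

/-- `c` is bar-invariant and of the form `δ_x + ∑_{y < x} h_{y,x} δ_y` with `h_{y,x} ∈ v ℤ[v]`. -/
def IsKLElement {B W : Type*} [Group W] {M : CoxeterMatrix B} (cs : CoxeterSystem M W)
    (x : W) (c : cs.Hecke) : Prop :=
  cs.heckeBar c = c ∧
    ∃ p : W →₀ ℤ[X], (∀ y, p y ≠ 0 → cs.bruhatLT y x) ∧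
      c = cs.heckeStd x +
        p.sum fun y q => (Polynomial.toLaurent (Polynomial.X * q)) • cs.heckeStd y

/-- The Kazhdan–Lusztig basis element `b_x`: the (unique) element of the Hecke algebra that
satisfies `IsKLElement`. -/
def klBasis {B W : Type*} [Group W] {M : CoxeterMatrix B} (cs : CoxeterSystem M W) (x : W) :
    cs.Hecke :=
  Classical.epsilon fun c => cs.IsKLElement x c

/-- The family of structure constants `(h_{x,y,z})_z` of the Kazhdan–Lusztig basis, i.e. the
(unique) coefficients in `b_x b_y = ∑_z h_{x,y,z} b_z`. -/
def klCoeff {B W : Type*} [Group W] {M : CoxeterMatrix B} (cs : CoxeterSystem M W) (x y : W) :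
    W →₀ ℤ[T;T⁻¹] :=
  Classical.epsilon fun h : W →₀ ℤ[T;T⁻¹] =>
    cs.klBasis x * cs.klBasis y = h.sum fun z a => a • cs.klBasis z

/-- Lusztig's `a`-function: `a(z)` is the smallest natural number `n` such that
`v ^ n * h_{x,y,z} ∈ ℤ[v]` for all `x`, `y`, and `∞` if there is no such `n`. -/
def aFunction {B W : Type*} [Group W] {M : CoxeterMatrix B} (cs : CoxeterSystem M W) (z : W) :
    ℕ∞ :=
  sInf {k : ℕ∞ | ∃ n : ℕ, k = n ∧ ∀ x y : W,
    LaurentPolynomial.T (n : ℤ) * cs.klCoeff x y z ∈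
      Set.range (Polynomial.toLaurent : ℤ[X] → ℤ[T;T⁻¹])}

end CoxeterSystem

end

/-! Up to the identity, the elements with `a(z) = 1` are those with a unique reduced expression
(Lusztig). Their reduced words are the words without repeated neighbours and without braid factors,
so the theorem becomes a statement about walks in the Dynkin diagram.

Let `z ≠ 1` have a unique reduced expression; then `z` has a single left descent. The span `J` of
all `b_u` for which `u` has several reduced expressions is a two-sided ideal
(`klGen_mul_klBasis_mem_nonUniqueIdeal` and the anti-involution). Build `b_x` letter by letter
modulo `J`: a factor `v + v⁻¹` would require multiplying by `b_t` an element with left descent `t`.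
This can happen only when the last letter of `x` meets `y`. Hence `h_{x,y,z}` is an integer multiple
of `1` or of `v + v⁻¹` (`klBasis_mul_klBasis_mem_intLattice`), and `b_s b_z = (v + v⁻¹) b_z` shows
that the pole does occur.

If `z` has several reduced expressions, then `z = x w y` with lengths adding, where `w` is the
longest element of a finite dihedral parabolic subgroup with parameter `m ≥ 2`. Put `d = ∑ v ^ (m -
ℓ(u)) δ_u` over this subgroup. Then `b_{wy} = d h` and `b_{xw} d = p b_{xw}`, where `p` has
coefficient `1` at `v ^ (-m)`. Since `b_{xw} h` has leading term `b_z`, it follows that `h_{xw,wy,z}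
= p` and `a(z) ≠ 1` (`exists_klCoeff_coeff_ne_zero`).

Both halves rest on the exchange condition, on the exact order of `st` (from the geometric
representation), on freeness of the Hecke algebra over the `δ_w`, and on the Kazhdan–Lusztig basis
with its multiplication formula.

Combinatorially (`finite_isBraidFree_iff`), a braid-free word is a walk in the Dynkin diagram that
may backtrack only over edges with `m > 3` and may not alternate on an edge for `m` letters. Running
round a cycle, alternating on an edge with `m = ∞`, or zigzagging between two edges with `m > 3`
gives infinitely many such words. Conversely, in a finite forest with at most one heavy edge per
component, a long walk repeats some edge often. Repetition needs backtracking, so that edge is the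
heavy one, and the walk alternates on it until a braid word appears. -/

namespace CoxeterSystem

/-! ### Inversion parity and the strong exchange condition -/

section Exchange

variable {B W : Type*} [Group W] {M : CoxeterMatrix B} (cs : CoxeterSystem M W)

open Classical in
/-- The action of a simple reflection on pairs of a group element and a sign. -/
noncomputable def signAct (i : B) : Function.End (W × ZMod 2) := fun p =>
  (cs.simple i * p.1 * cs.simple i, p.2 + if cs.simple i = p.1 then 1 else 0)

-- The `2 n` reflections `s_j (s_i s_j) ^ k` met along the word `(i j) ^ n` are listed explicitly,
-- so that for `n = m_{ij}` the second half of the list visibly repeats the first.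
open Classical in
theorem signAct_mul_pow_apply (i j : B) (n : ℕ) (t : W) (e : ZMod 2) :
    ((cs.signAct i * cs.signAct j) ^ n) (t, e) =
      ((cs.simple i * cs.simple j) ^ n * t * ((cs.simple i * cs.simple j) ^ n)⁻¹,
        e + ∑ k ∈ Finset.range (2 * n),
          if cs.simple j * (cs.simple i * cs.simple j) ^ k = t then 1 else 0) := by
  have key : ∀ k : ℕ, ((cs.simple i * cs.simple j) ^ k)⁻¹ * cs.simple j =
      cs.simple j * (cs.simple i * cs.simple j) ^ k := by
    intro k
    induction k with
    | zero => simp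
    | succ k ih =>
      rw [pow_succ, mul_inv_rev, mul_assoc, ih, ← pow_succ, pow_succ']
      simp [mul_assoc]
  induction n with
  | zero => simp [Function.End.one_def]
  | succ n ih =>
    set r := cs.simple i * cs.simple j with hr
    rw [pow_succ']
    change (cs.signAct i * cs.signAct j) (((cs.signAct i * cs.signAct j) ^ n) (t, e)) = _
    rw [ih]
    change cs.signAct i (cs.signAct j _) = _
    have e1 : (cs.simple j = r ^ n * t * (r ^ n)⁻¹) ↔ cs.simple j * r ^ (2 * n) = t := by
      rw [two_mul, pow_add, ← mul_assoc, ← key n]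
      constructor
      · intro h; rw [h]; group
      · intro h; rw [← h]; group
    have e2 : (cs.simple i = cs.simple j * (r ^ n * t * (r ^ n)⁻¹) * cs.simple j) ↔
        cs.simple j * r ^ (2 * n + 1) = t := by
      have : cs.simple j * r ^ (2 * n + 1) = (r ^ n)⁻¹ * (cs.simple j * cs.simple i * cs.simple j) *
          r ^ n := by
        rw [pow_succ', two_mul, pow_add]
        have h1 := key n
        have h2 : r⁻¹ * cs.simple j = cs.simple j * r := by simpa [hr] using key 1
        calc cs.simple j * (r * (r ^ n * r ^ n)) = (cs.simple j * r ^ n) * r * r ^ n := by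
                rw [← mul_assoc r, ← pow_succ', pow_succ]; group
          _ = _ := by rw [← h1]; simp only [hr, mul_assoc]
      rw [this]
      constructor
      · intro h; rw [h]; simp only [mul_assoc, simple_mul_simple_cancel_left,
          simple_mul_simple_self]; group
      · intro h; rw [← h]; simp only [mul_assoc]; simp
    simp only [signAct, e1, e2]
    rw [show 2 * (n + 1) = 2 * n + 1 + 1 by ring, Finset.sum_range_succ, Finset.sum_range_succ,
      add_assoc, add_assoc]
    congr 1
    rw [pow_succ']
    · simp [hr, mul_assoc]
    · simp only [add_assoc]

/-- The terms with indices `k` and `k + m` in the sum agree because `(s_i s_j) ^ m = 1`, so the sum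
vanishes modulo two. For `m = ∞`, encoded as `0`, the sum is empty. -/
theorem isLiftable_signAct : M.IsLiftable cs.signAct := by
  classical
  intro i j
  funext ⟨t, e⟩
  rw [signAct_mul_pow_apply, simple_mul_simple_pow]
  have : ∑ k ∈ Finset.range (2 * M i j),
      (if cs.simple j * (cs.simple i * cs.simple j) ^ k = t then (1 : ZMod 2) else 0) = 0 := by
    rw [two_mul, Finset.sum_range_add]
    simp only [pow_add, simple_mul_simple_pow, one_mul]
    exact CharTwo.add_self_eq_zero _
  rw [this]
  simp [Function.End.one_def]

/-- The action of `W` on `W × ZMod 2`; the second component counts inversions modulo two. -/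
noncomputable def signHom : W →* Function.End (W × ZMod 2) := cs.lift ⟨_, cs.isLiftable_signAct⟩

-- Consequently the parity of the number of occurrences of `t` in the inversion sequence depends
-- only on the group element and not on the word.
open Classical in
theorem signHom_wordProd (ω : List B) (t : W) (e : ZMod 2) :
    cs.signHom (cs.wordProd ω) (t, e) =
      (cs.wordProd ω * t * (cs.wordProd ω)⁻¹, e + ((cs.rightInvSeq ω).count t : ZMod 2)) := by
  induction ω with
  | nil => simp [Function.End.one_def]
  | cons i ω ih =>
    rw [wordProd_cons, map_mul]
    change cs.signHom (cs.simple i) (cs.signHom _ (t, e)) = _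
    rw [ih, signHom, lift_apply_simple, rightInvSeq, List.count_cons]
    simp only [signAct, beq_iff_eq]
    have : cs.simple i = cs.wordProd ω * t * (cs.wordProd ω)⁻¹ ↔
        (cs.wordProd ω)⁻¹ * cs.simple i * cs.wordProd ω = t := by
      constructor
      · intro h; rw [h]; group
      · intro h; rw [← h]; group
    simp only [this]
    push_cast
    ext
    · simp [mul_assoc]
    · simp [add_assoc]

theorem signHom_add (w t : W) (e e' : ZMod 2) :
    cs.signHom w (t, e + e') = ((cs.signHom w (t, e)).1, (cs.signHom w (t, e)).2 + e') := by
  classical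
  obtain ⟨ω, rfl⟩ := cs.wordProd_surjective w
  simp [signHom_wordProd, add_right_comm]

/-- With `t = u s u⁻¹`, the sign picked up along `u⁻¹` is undone by `u`, and the simple reflection
in the middle contributes the `1`. -/
theorem IsReflection.signHom_self {t : W} (ht : cs.IsReflection t) (e : ZMod 2) :
    cs.signHom t (t, e) = (t, e + 1) := by
  classical
  obtain ⟨u, i, rfl⟩ := ht
  have h1 : ∀ x : W × ZMod 2, cs.signHom u (cs.signHom u⁻¹ x) = x := by
    intro x
    change (cs.signHom u * cs.signHom u⁻¹) x = x
    rw [← map_mul, mul_inv_cancel, map_one]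
    rfl
  rw [map_mul, map_mul]
  change cs.signHom u (cs.signHom (cs.simple i) (cs.signHom u⁻¹ _)) = _
  have h2 : (cs.signHom u⁻¹ (u * cs.simple i * u⁻¹, e)).1 = cs.simple i := by
    obtain ⟨ω, h⟩ := cs.wordProd_surjective u⁻¹
    rw [← h, signHom_wordProd, h]
    simp [mul_assoc]
  have h3 : cs.signHom (cs.simple i) (cs.signHom u⁻¹ (u * cs.simple i * u⁻¹, e)) =
      (cs.simple i, (cs.signHom u⁻¹ (u * cs.simple i * u⁻¹, e)).2 + 1) := by
    conv_lhs => rw [signHom, lift_apply_simple]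
    simp only [signAct]
    rw [← signHom, h2]
    simp
  rw [h3, signHom_add]
  have h4 := h1 (u * cs.simple i * u⁻¹, e)
  rw [← Prod.mk.eta (p := cs.signHom u⁻¹ (u * cs.simple i * u⁻¹, e)), h2] at h4
  rw [h4]

/-- The strong exchange condition. -/
theorem IsRightInversion.mem_rightInvSeq {ω : List B} {t : W}
    (h : cs.IsRightInversion (cs.wordProd ω) t) : t ∈ cs.rightInvSeq ω := by
  classical
  by_contra hn
  obtain ⟨ht, hl⟩ := h
  obtain ⟨ω', hr, hω'⟩ := cs.exists_isReduced (cs.wordProd ω * t)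
  -- If `t` is missing from the sequence of `ω`, its parity for `w t` is odd. So `t` is an inversion
  -- of `w t`, and `w` is shorter than `w t`, a contradiction.
  have h1 : (cs.signHom (cs.wordProd ω * t) (t, 0)).2 = 1 := by
    rw [map_mul]
    change (cs.signHom _ (cs.signHom _ _)).2 = _
    rw [ht.signHom_self, signHom_wordProd, List.count_eq_zero_of_not_mem hn]
    simp
  rw [hω', signHom_wordProd] at h1
  have h2 : t ∈ cs.rightInvSeq ω' := by
    by_contra h3
    rw [List.count_eq_zero_of_not_mem h3] at h1
    simp at h1
  have h3 := (cs.isRightInversion_of_mem_rightInvSeq hr h2).2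
  rw [← hω', mul_assoc, ht.mul_self, mul_one] at h3
  omega

theorem exists_eraseIdx_of_isRightInversion {ω : List B} {t : W}
    (h : cs.IsRightInversion (cs.wordProd ω) t) :
    ∃ j < ω.length, cs.wordProd ω * t = cs.wordProd (ω.eraseIdx j) := by
  obtain ⟨j, hj, rfl⟩ := List.getElem_of_mem (h.mem_rightInvSeq)
  refine ⟨j, by simpa using hj, ?_⟩
  rw [← wordProd_mul_getD_rightInvSeq, List.getD_eq_getElem _ _ hj]

theorem exists_eraseIdx_of_isLeftInversion {ω : List B} {t : W}
    (h : cs.IsLeftInversion (cs.wordProd ω) t) :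
    ∃ j < ω.length, t * cs.wordProd ω = cs.wordProd (ω.eraseIdx j) := by
  have h' := cs.isRightInversion_inv_iff.2 h
  rw [← wordProd_reverse] at h'
  have h2 := h'.mem_rightInvSeq
  rw [rightInvSeq_reverse, List.mem_reverse] at h2
  obtain ⟨j, hj, rfl⟩ := List.getElem_of_mem h2
  refine ⟨j, by simpa using hj, ?_⟩
  rw [← getD_leftInvSeq_mul_wordProd, List.getD_eq_getElem _ _ hj]

theorem length_wordProd_eraseIdx_lt {ω : List B} {j : ℕ} (hj : j < ω.length) :
    cs.length (cs.wordProd (ω.eraseIdx j)) < ω.length :=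
  (cs.length_wordProd_le _).trans_lt (by rw [List.length_eraseIdx_of_lt hj]; omega)

/-- Exchange on `i :: ω`, with `ω` reduced for `a`, deletes a letter. Deleting the first gives `s_i
a = a t`; deleting a later one would make `a t` shorter than `a`. -/
theorem eq_or_length_lt_of_reflection {a t : W} (ht : cs.IsReflection t)
    (h : cs.length a < cs.length (a * t)) (i : B) :
    cs.simple i * a = a * t ∨
      cs.length (cs.simple i * a) < cs.length (cs.simple i * (a * t)) := by
  by_contra! hc
  obtain ⟨h1, h2⟩ := hc
  have h3 : cs.length (cs.simple i * (a * t)) ≠ cs.length (cs.simple i * a) := by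
    rw [← mul_assoc]; exact ht.length_mul_left_ne _
  obtain ⟨ω, hr, ha⟩ := cs.exists_isReduced a
  have h4 := cs.length_simple_mul a i
  have h5 := cs.length_simple_mul (a * t) i
  have hinv : cs.IsRightInversion (cs.wordProd (i :: ω)) t := by
    refine ⟨ht, ?_⟩
    rw [wordProd_cons, ← ha, mul_assoc]
    omega
  obtain ⟨j, hj, hp⟩ := cs.exists_eraseIdx_of_isRightInversion hinv
  rw [wordProd_cons, ← ha] at hp
  cases j with
  | zero =>
    simp only [List.eraseIdx_cons_zero, ← ha] at hp
    apply h1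
    conv_rhs => rw [← cs.simple_mul_simple_cancel_left (w := a * t) i, ← mul_assoc _ a t, hp]
  | succ j =>
    rw [List.eraseIdx_cons_succ, wordProd_cons, mul_assoc, mul_right_inj] at hp
    have := cs.length_wordProd_eraseIdx_lt (ω := ω) (j := j) (by simpa using hj)
    rw [← hp, ← hr.eq, ← ha] at this
    omega

theorem simple_mul_eq_mul_simple {w : W} {i j : B}
    (hj : cs.length w < cs.length (w * cs.simple j))
    (hij : cs.length (cs.simple i * (w * cs.simple j)) < cs.length (cs.simple i * w)) :
    cs.simple i * w = w * cs.simple j :=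
  (cs.eq_or_length_lt_of_reflection (cs.isReflection_simple j) hj i).resolve_right hij.not_gt

end Exchange

end CoxeterSystem

namespace CoxeterMatrix

/-! ### The geometric representation and the exact order of a product of two simple reflections -/

section Geometric

variable {B : Type*} (M : CoxeterMatrix B)

/-- The Cartan integers `-2 cos (π / m)` of the geometric representation. -/
noncomputable def cartan (i j : B) : ℝ :=
  if M i j = 0 then -2 else -2 * Real.cos (Real.pi / M i j)

theorem cartan_self (i : B) : M.cartan i i = 2 := by simp [cartan]

theorem cartan_symm (i j : B) : M.cartan i j = M.cartan j i := by
  rw [cartan, cartan, M.symmetric]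

/-- The simple coroots of the geometric representation. -/
noncomputable def coroot (i : B) : Module.Dual ℝ (B →₀ ℝ) :=
  Finsupp.linearCombination ℝ (M.cartan i)

theorem coroot_single (i j : B) : M.coroot i (Finsupp.single j 1) = M.cartan i j := by
  simp [coroot]

theorem coroot_single_self (i : B) : M.coroot i (Finsupp.single i 1) = 2 := by
  rw [coroot_single, cartan_self]

/-- The simple reflections of the geometric representation. -/
noncomputable def geomReflection (i : B) : (B →₀ ℝ) ≃ₗ[ℝ] (B →₀ ℝ) :=
  Module.reflection (M.coroot_single_self i)

theorem cartan_mul_cartan {i j : B} (h : M i j ≠ 0) :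
    M.cartan i j * M.cartan j i - 2 = 2 * Real.cos (2 * Real.pi / M i j) := by
  rw [M.cartan_symm j i, cartan, if_neg h, mul_div_assoc, Real.cos_two_mul]
  ring

theorem sin_ne_zero {i j : B} (h : 3 ≤ M i j) : Real.sin (2 * Real.pi / M i j) ≠ 0 := by
  have h3 : (3 : ℝ) ≤ M i j := by exact_mod_cast h
  apply ne_of_gt
  apply Real.sin_pos_of_pos_of_lt_pi
  · positivity
  · rw [div_lt_iff₀ (by linarith)]
    nlinarith [Real.pi_pos]

-- Powers of a product of two reflections are given by Chebyshev polynomials `S` at `2 cos φ`, `φ =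
-- 2π/m`, and `S_k(2 cos φ) sin φ = sin ((k + 1) φ)`. For even `m` the single factor `S_{m/2-1}`
-- vanishes; for odd `m` the sum of two neighbouring ones does. The case `m = 2` is separate because
-- there `sin φ = 0`.
open Polynomial.Chebyshev in
theorem isLiftable_geomReflection : M.IsLiftable M.geomReflection := by
  intro i j
  by_cases h0 : M i j = 0
  · rw [h0, pow_zero]
  by_cases h1 : i = j
  · subst h1
    rw [M.diagonal, pow_one]
    ext1 z
    exact Module.involutive_reflection (M.coroot_single_self i) z
  have h2 : M i j ≠ 1 := M.off_diagonal i j h1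
  have hji : M.cartan j i = M.cartan i j := M.cartan_symm j i
  have ht : M.cartan i j * M.cartan j i - 2 =
      M.coroot i (Finsupp.single j 1) * M.coroot j (Finsupp.single i 1) - 2 := by
    rw [coroot_single, coroot_single]
  refine LinearEquiv.ext fun z => ?_
  rw [geomReflection, geomReflection,
    Module.reflection_mul_reflection_pow_apply _ _ (M i j) z _ ht]
  rcases (show M i j = 2 ∨ 3 ≤ M i j by omega) with h | h
  · have hc : M.cartan i j = 0 := by rw [cartan, if_neg h0, h]; simp
    rw [coroot_single, coroot_single, hji, hc, h]
    rw [show (((2 : ℕ) : ℤ) - 2) / 2 = 0 by norm_num, show (((2 : ℕ) : ℤ) - 1) / 2 = 0 by norm_num,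
      show (((2 : ℕ) : ℤ) - 3) / 2 = -1 by norm_num, show ((2 : ℕ) : ℤ) / 2 = 1 by norm_num]
    simp only [S_zero, S_one, S_neg_one, Polynomial.eval_one, Polynomial.eval_X,
      Polynomial.eval_zero, LinearEquiv.coe_one, id]
    module
  · rw [cartan_mul_cartan M h0]
    have hs := M.sin_ne_zero h
    set φ := 2 * Real.pi / M i j with hφ
    have hm : (M i j : ℝ) ≠ 0 := by exact_mod_cast h0
    rcases Nat.even_or_odd' (M i j) with ⟨k, hk | hk⟩
    · have e : ((M i j : ℤ) - 1) / 2 = k - 1 := by omega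
      have e' : ((M i j : ℤ) - 2) / 2 = k - 1 := by omega
      have z0 : (S ℝ ((k : ℤ) - 1)).eval (2 * Real.cos φ) = 0 := by
        have := S_two_mul_real_cos φ ((k : ℤ) - 1)
        have e2 : ((((k : ℤ) - 1 : ℤ) : ℝ) + 1) * φ = Real.pi := by
          push_cast
          rw [hφ]
          have : (M i j : ℝ) = 2 * k := by exact_mod_cast hk
          rw [this] at hm ⊢
          have hk0 : (k : ℝ) ≠ 0 := fun h => hm (by rw [h, mul_zero])
          field_simp
          ring
        rw [e2, Real.sin_pi] at this
        exact (mul_eq_zero.1 this).resolve_right hs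
      rw [e, e', z0]
      simp
    · have e : ((M i j : ℤ) - 1) / 2 = k := by omega
      have e' : ((M i j : ℤ) - 2) / 2 = k - 1 := by omega
      have e'' : ((M i j : ℤ) - 3) / 2 = k - 1 := by omega
      have e3 : (M i j : ℤ) / 2 = k := by omega
      have z0 : (S ℝ (k : ℤ)).eval (2 * Real.cos φ) +
          (S ℝ ((k : ℤ) - 1)).eval (2 * Real.cos φ) = 0 := by
        have t1 := S_two_mul_real_cos φ ((k : ℤ) - 1)
        have t2 := S_two_mul_real_cos φ (k : ℤ)
        have e2 : (((k : ℤ) : ℝ) + 1) * φ = 2 * Real.pi - k * φ := by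
          push_cast
          have : (M i j : ℝ) = 2 * k + 1 := by exact_mod_cast hk
          rw [this] at hm
          rw [hφ, this]
          field_simp
          ring
        rw [e2, Real.sin_two_pi_sub] at t2
        have e4 : ((((k : ℤ) - 1 : ℤ) : ℝ) + 1) * φ = k * φ := by push_cast; ring
        rw [e4] at t1
        refine (mul_eq_zero.1 (?_ : _ * Real.sin φ = 0)).resolve_right hs
        rw [add_mul, t1, t2]
        ring
      rw [e, e', e'', e3, z0]
      simp

-- Evaluating at the simple root `α_i` and comparing both coefficients gives `S_{n-1} = 0` and `S_n
-- = 1` when `m ≥ 3`, hence `cos (n φ) = 1`. For `m = ∞` the coefficient of `α_j` grows linearly in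
-- `n`; for `m = 2` a sign detects the parity of `n`.
open Polynomial.Chebyshev in
theorem dvd_of_geomReflection_mul_pow {i j : B} {n : ℕ}
    (h : (M.geomReflection i * M.geomReflection j) ^ n = 1) : M i j ∣ n := by
  by_cases h1 : i = j
  · subst h1; simp
  have h2 : M i j ≠ 1 := M.off_diagonal i j h1
  have hji : M.cartan j i = M.cartan i j := M.cartan_symm j i
  have ht : M.cartan i j * M.cartan j i - 2 =
      M.coroot i (Finsupp.single j 1) * M.coroot j (Finsupp.single i 1) - 2 := by
    rw [coroot_single, coroot_single]
  have hx := LinearEquiv.congr_fun h (Finsupp.single i 1)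
  rw [geomReflection, geomReflection,
    Module.reflection_mul_reflection_pow_apply_self _ _ n _ ht] at hx
  have c1 := DFunLike.congr_fun hx i
  have c2 := DFunLike.congr_fun hx j
  have hj' : (Finsupp.single i (1 : ℝ)) j = 0 := by simp [h1]
  have hi' : (Finsupp.single j (1 : ℝ)) i = 0 := by simp [Ne.symm h1]
  simp only [Finsupp.add_apply, Finsupp.smul_apply, Finsupp.single_eq_same, hi', hj', smul_eq_mul,
    mul_zero, mul_one, add_zero, zero_add, coroot_single, LinearEquiv.coe_one, id] at c1 c2
  by_cases h0 : M i j = 0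
  · have hc : M.cartan i j = -2 := by rw [cartan, if_pos h0]
    rw [hji, hc] at c2
    norm_num at c2
    rw [h0, c2]
  rcases (show M i j = 2 ∨ 3 ≤ M i j by omega) with h | h
  · have hc : M.cartan i j = 0 := by rw [cartan, if_neg h0, h]; simp
    rw [hji, hc] at c1
    rw [show (0 : ℝ) * 0 - 2 = -2 by norm_num, S_eval_neg_two,
      S_eval_neg_two] at c1
    rw [h]
    rcases Nat.even_or_odd n with he | ho
    · exact he.two_dvd
    · exfalso
      rw [Int.negOnePow_odd _ (by exact_mod_cast ho), Int.negOnePow_even] at c1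
      · push_cast at c1; linarith
      · obtain ⟨k, rfl⟩ := ho
        exact ⟨k, by push_cast; ring⟩
  · have hs := M.sin_ne_zero h
    have h3 : (3 : ℝ) ≤ M i j := by exact_mod_cast h
    have hc : M.cartan i j ≠ 0 := by
      rw [cartan, if_neg h0]
      apply mul_ne_zero (by norm_num)
      apply ne_of_gt
      apply Real.cos_pos_of_mem_Ioo
      have := Real.pi_pos
      constructor
      · have : 0 < Real.pi / M i j := by positivity
        linarith
      · rw [div_lt_div_iff₀ (by linarith) (by norm_num)]
        nlinarith
    rw [cartan_mul_cartan M h0] at c1 c2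
    set φ := 2 * Real.pi / M i j with hφ
    have t1 := S_two_mul_real_cos φ ((n : ℤ) - 1)
    have t2 := S_two_mul_real_cos φ (n : ℤ)
    have z1 : (S ℝ ((n : ℤ) - 1)).eval (2 * Real.cos φ) = 0 := by
      rw [hji] at c2
      simpa [hc] using c2
    have z2 : (S ℝ (n : ℤ)).eval (2 * Real.cos φ) = 1 := by simpa [z1] using c1
    rw [z1] at t1
    rw [z2] at t2
    have e4 : ((((n : ℤ) - 1 : ℤ) : ℝ) + 1) * φ = n * φ := by push_cast; ring
    have e5 : (((n : ℤ) : ℝ) + 1) * φ = n * φ + φ := by push_cast; ring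
    rw [e4, zero_mul] at t1
    rw [e5, Real.sin_add, ← t1, zero_mul, zero_add, one_mul] at t2
    have t3 : Real.cos (n * φ) = 1 := mul_right_cancel₀ hs (by rw [← t2, one_mul])
    obtain ⟨k, hk⟩ := (Real.cos_eq_one_iff _).1 t3
    have h4 : (k : ℝ) * M i j = n := by
      rw [hφ] at hk
      have := Real.pi_pos
      field_simp at hk
      linarith
    have h5 : (k : ℤ) * (M i j : ℤ) = n := by exact_mod_cast h4
    exact Int.natCast_dvd_natCast.1 ⟨k, by rw [← h5, mul_comm]⟩

end Geometric

end CoxeterMatrix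

namespace CoxeterSystem

section Order

variable {B W : Type*} [Group W] {M : CoxeterMatrix B} (cs : CoxeterSystem M W)

theorem simple_mul_simple_pow_eq_one_iff (i j : B) (n : ℕ) :
    (cs.simple i * cs.simple j) ^ n = 1 ↔ M i j ∣ n := by
  constructor
  · intro h
    apply M.dvd_of_geomReflection_mul_pow
    have := congrArg (cs.lift ⟨M.geomReflection, M.isLiftable_geomReflection⟩) h
    rwa [map_pow, map_mul, lift_apply_simple, lift_apply_simple, map_one] at this
  · rintro ⟨k, rfl⟩
    rw [pow_mul, simple_mul_simple_pow, one_pow]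

end Order

end CoxeterSystem

/-! ### Alternating words -/

/-- The word of length `k` that starts with `s` and alternates between `s` and `t`. -/
def altWord {B : Type*} : B → B → ℕ → List B
  | _, _, 0 => []
  | s, t, k + 1 => s :: altWord t s k

section AltWord

variable {B : Type*}

@[simp]
theorem length_altWord (s t : B) (k : ℕ) : (altWord s t k).length = k := by
  induction k generalizing s t with
  | zero => rfl
  | succ k ih => simp [altWord, ih]

theorem exists_altWord_add (s t : B) (m n : ℕ) : ∃ l, altWord s t (m + n) = altWord s t m ++ l := by
  induction m generalizing s t with
  | zero => exact ⟨_, rfl⟩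
  | succ m ih =>
    obtain ⟨l, hl⟩ := ih t s
    exact ⟨l, by rw [Nat.succ_add, altWord, hl, altWord, List.cons_append]⟩

/-- A word in two letters without repeated neighbours is determined by its first letter; the `t` in
front forces this letter to be `s`. -/
theorem eq_altWord {s t : B} {l : List B} (h : ∀ x ∈ l, x = s ∨ x = t)
    (hc : (t :: l).IsChain (· ≠ ·)) : l = altWord s t l.length := by
  induction l generalizing s t with
  | nil => rfl
  | cons a l ih =>
    rw [List.isChain_cons_cons] at hc
    obtain rfl : a = s := (h a (by simp)).resolve_right (Ne.symm hc.1)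
    rw [List.length_cons, altWord, ← ih (fun x hx => (h x (by simp [hx])).symm) hc.2]

end AltWord

namespace CoxeterSystem

/-! ### Dihedral factors, unique reduced words and braid-free words -/

section Dihedral

variable {B W : Type*} [Group W] {M : CoxeterMatrix B} (cs : CoxeterSystem M W)

theorem wordProd_altWord_mul_inv (s t : B) (k : ℕ) :
    cs.wordProd (altWord s t k) * (cs.wordProd (altWord t s k))⁻¹ =
      (cs.simple s * cs.simple t) ^ k := by
  induction k generalizing s t with
  | zero => simp [altWord]
  | succ k ih =>
    rw [altWord, altWord, wordProd_cons, wordProd_cons, mul_inv_rev, inv_simple]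
    have h := ih t s
    have e : (cs.simple s * cs.simple t) ^ (k + 1) =
        cs.simple s * (cs.simple t * cs.simple s) ^ k * cs.simple t := by
      rw [pow_succ]
      have : ∀ n : ℕ, (cs.simple s * cs.simple t) ^ n * cs.simple s =
          cs.simple s * (cs.simple t * cs.simple s) ^ n := by
        intro n
        induction n with
        | zero => simp
        | succ n ihn => rw [pow_succ', mul_assoc, ihn, pow_succ']; simp only [mul_assoc]
      rw [← mul_assoc, this]
    rw [e, ← h]
    simp only [mul_assoc]

theorem wordProd_altWord_eq_iff (s t : B) (k : ℕ) :
    cs.wordProd (altWord s t k) = cs.wordProd (altWord t s k) ↔ M s t ∣ k := by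
  rw [← simple_mul_simple_pow_eq_one_iff cs, ← wordProd_altWord_mul_inv, mul_inv_eq_one]

theorem wordProd_altWord_braid (s t : B) :
    cs.wordProd (altWord s t (M s t)) = cs.wordProd (altWord t s (M s t)) :=
  (cs.wordProd_altWord_eq_iff s t _).2 dvd_rfl

theorem isReduced_append_right {a b : List B} (h : cs.IsReduced (a ++ b)) : cs.IsReduced b := by
  simpa using h.drop a.length

theorem isReduced_cons_iff {i : B} {ω : List B} :
    cs.IsReduced (i :: ω) ↔ cs.IsReduced ω ∧ ¬ cs.IsLeftDescent (cs.wordProd ω) i := by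
  constructor
  · intro h
    have h2 : cs.IsReduced ω := cs.isReduced_append_right (a := [i]) h
    refine ⟨h2, ?_⟩
    rw [not_isLeftDescent_iff, ← wordProd_cons, h.eq, h2.eq]
    rfl
  · rintro ⟨h1, h2⟩
    rw [not_isLeftDescent_iff, ← wordProd_cons, h1.eq] at h2
    exact h2

theorem IsReduced.isLeftDescent {cs : CoxeterSystem M W} {i : B} {ω : List B}
    (h : cs.IsReduced (i :: ω)) : cs.IsLeftDescent (cs.wordProd (i :: ω)) i := by
  have := (cs.isReduced_cons_iff.1 h).1
  rw [IsLeftDescent, h.eq, wordProd_cons, simple_mul_simple_cancel_left, this.eq]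
  simp

theorem exists_isReduced_cons {w : W} {i : B} (h : cs.IsLeftDescent w i) :
    ∃ ω, cs.IsReduced (i :: ω) ∧ w = cs.wordProd (i :: ω) := by
  obtain ⟨ω, hr, hω⟩ := cs.exists_isReduced (cs.simple i * w)
  refine ⟨ω, ?_, ?_⟩
  · rw [isReduced_cons_iff, ← hω]
    exact ⟨hr, cs.isLeftDescent_iff_not_isLeftDescent_mul.1 h⟩
  · rw [wordProd_cons, ← hω, simple_mul_simple_cancel_left]

theorem IsReduced.isChain {cs : CoxeterSystem M W} {ω : List B} (h : cs.IsReduced ω) :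
    ω.IsChain (· ≠ ·) := by
  induction ω with
  | nil => exact List.isChain_nil
  | cons a ω ih =>
    have h2 := cs.isReduced_cons_iff.1 h
    cases ω with
    | nil => exact List.isChain_singleton a
    | cons b ω =>
      refine List.isChain_cons_cons.2 ⟨?_, ih h2.1⟩
      rintro rfl
      exact h2.2 h2.1.isLeftDescent

/-- An element with two different left descents `s`, `t` starts with the longest element of the
dihedral parabolic subgroup generated by `s` and `t`. -/
theorem exists_altWord_of_isLeftDescent {z : W} {s t : B} (hst : s ≠ t)
    (hs : cs.IsLeftDescent z s) (ht : cs.IsLeftDescent z t) :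
    M s t ≠ 0 ∧ ∃ y, z = cs.wordProd (altWord s t (M s t)) * y ∧
      cs.length z = M s t + cs.length y := by
  classical
  -- Write `z` as a word `a` in `s`, `t` times `y`, first with `y` as short as possible, that is, a
  -- minimal coset representative, and then with `a` as short as possible.
  have hP : ∃ n, ∃ a : List B, ∃ y, (∀ x ∈ a, x = s ∨ x = t) ∧ cs.wordProd a * y = z ∧
      cs.length y = n := ⟨_, [], z, by simp, by simp, rfl⟩
  obtain ⟨a0, y, ha0, hay0, hy⟩ := Nat.find_spec hP
  have hmin : ∀ (b : List B) (y' : W), (∀ x ∈ b, x = s ∨ x = t) → cs.wordProd b * y' = z →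
      cs.length y ≤ cs.length y' := fun b y' hb hy' => by
    rw [hy]; exact Nat.find_min' hP ⟨b, y', hb, hy', rfl⟩
  have hQ : ∃ k, ∃ a : List B, (∀ x ∈ a, x = s ∨ x = t) ∧ cs.wordProd a * y = z ∧
      a.length = k := ⟨_, a0, ha0, hay0, rfl⟩
  obtain ⟨a, ha, hay, hal⟩ := Nat.find_spec hQ
  have hmin2 : ∀ (b : List B), (∀ x ∈ b, x = s ∨ x = t) → cs.wordProd b * y = z →
      a.length ≤ b.length := fun b hb hy' => by
    rw [hal]; exact Nat.find_min' hQ ⟨b, hb, hy', rfl⟩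
  obtain ⟨ω, hω, rfl⟩ := cs.exists_isReduced y
  -- The letter that exchange deletes lies in the `s`, `t` part, since deleting one from the word of
  -- `y` would contradict minimality of `y`.
  have hX : ∀ (a1 a2 : List B) (r : B), (∀ x ∈ a1, x = s ∨ x = t) → (∀ x ∈ a2, x = s ∨ x = t) →
      cs.wordProd a1 * (cs.simple r * (cs.wordProd a2 * cs.wordProd ω)) = z →
      cs.IsLeftDescent (cs.wordProd a2 * cs.wordProd ω) r →
      ∃ j < a2.length, cs.simple r * cs.wordProd a2 = cs.wordProd (a2.eraseIdx j) := by
    intro a1 a2 r h1 h2 hz hd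
    rw [← wordProd_append, ← isLeftInversion_simple_iff_isLeftDescent] at hd
    obtain ⟨j, hj, he⟩ := cs.exists_eraseIdx_of_isLeftInversion hd
    by_cases hja : j < a2.length
    · refine ⟨j, hja, ?_⟩
      rw [List.eraseIdx_append_of_lt_length hja, wordProd_append, wordProd_append,
        ← mul_assoc] at he
      exact mul_right_cancel he
    · exfalso
      push Not at hja
      rw [List.eraseIdx_append_of_length_le hja, wordProd_append, wordProd_append] at he
      have hj2 : j - a2.length < ω.length := by simp at hj; omega
      have h3 := hmin (a1 ++ a2) _ (by
        intro x hx
        rcases List.mem_append.1 hx with h | h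
        exacts [h1 x h, h2 x h]) (by rw [wordProd_append, mul_assoc, ← he, hz])
      have := cs.length_wordProd_eraseIdx_lt hj2
      rw [hω.eq] at h3
      omega
  have hlen : ∀ a2 a1 : List B, a = a1 ++ a2 →
      cs.length (cs.wordProd a2 * cs.wordProd ω) = a2.length + ω.length := by
    intro a2
    induction a2 with
    | nil => intro a1 _; simp [hω.eq]
    | cons r a2 ih =>
      intro a1 h
      have ih' := ih (a1 ++ [r]) (by simp [h])
      have ha1 : ∀ x ∈ a1, x = s ∨ x = t := fun x hx => ha x (by simp [h, hx])
      have ha2 : ∀ x ∈ a2, x = s ∨ x = t := fun x hx => ha x (by simp [h, hx])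
      rw [wordProd_cons, mul_assoc]
      have hz : cs.wordProd a1 * (cs.simple r * (cs.wordProd a2 * cs.wordProd ω)) = z := by
        rw [← hay, h, wordProd_append, wordProd_cons]; simp only [mul_assoc]
      by_cases hd : cs.IsLeftDescent (cs.wordProd a2 * cs.wordProd ω) r
      · exfalso
        obtain ⟨j, hj, he⟩ := hX a1 a2 r ha1 ha2 hz hd
        have := hmin2 (a1 ++ a2.eraseIdx j) (by
          intro x hx
          rcases List.mem_append.1 hx with h | h
          exacts [ha1 x h, ha2 x (List.mem_of_mem_eraseIdx h)]) (by
            rw [wordProd_append, ← he, ← hz]; simp only [mul_assoc])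
        rw [h, List.length_append, List.length_append, List.length_eraseIdx_of_lt hj] at this
        simp at this
        omega
      · rw [not_isLeftDescent_iff] at hd
        rw [hd, ih', List.length_cons]
        ring
  have hz := hlen a [] rfl
  rw [hay] at hz
  have har : cs.length (cs.wordProd a) = a.length := by
    have h1 := cs.length_mul_le (cs.wordProd a) (cs.wordProd ω)
    rw [hay, hz, hω.eq] at h1
    have := cs.length_wordProd_le a
    omega
  -- A descent `r` can be exchanged to the front of `a`, so `a` may be replaced by the alternating
  -- word of the same length that starts with `r`.
  have halt : ∀ r r' : B, r ≠ r' → (∀ x, (x = s ∨ x = t) ↔ (x = r ∨ x = r')) →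
      cs.IsLeftDescent z r → 0 < a.length ∧ cs.wordProd a = cs.wordProd (altWord r r' a.length) := by
    intro r r' hrr hr hd
    obtain ⟨j, hj, he⟩ := hX [r] a r (by simp [hr]) ha (by simp [hay]) (by rwa [hay])
    have e1 : cs.wordProd a = cs.wordProd (r :: a.eraseIdx j) := by
      rw [wordProd_cons, ← he, simple_mul_simple_cancel_left]
    have e2 : (r :: a.eraseIdx j).length = a.length := by
      rw [List.length_cons, List.length_eraseIdx_of_lt hj]; omega
    have e3 : cs.IsReduced (r :: a.eraseIdx j) := by
      rw [IsReduced, ← e1, har, e2]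
    refine ⟨by omega, ?_⟩
    rw [e1, ← e2, ← eq_altWord]
    · intro x hx
      rcases List.mem_cons.1 hx with rfl | h
      · exact Or.inl rfl
      · exact (hr x).1 (ha x (List.mem_of_mem_eraseIdx h))
    · exact List.isChain_cons_cons.2 ⟨hrr.symm, e3.isChain⟩
  obtain ⟨hpos, h1⟩ := halt s t hst (fun x => Iff.rfl) hs
  obtain ⟨-, h2⟩ := halt t s hst.symm (fun x => or_comm) ht
  have hdvd := (cs.wordProd_altWord_eq_iff s t a.length).1 (h1.symm.trans h2)
  have hM : M s t ≠ 0 := by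
    intro h0
    rw [h0, zero_dvd_iff] at hdvd
    omega
  -- An alternating word longer than `m` is not reduced: after one braid move two equal letters meet
  -- and cancel.
  have hk : a.length = M s t := by
    refine le_antisymm ?_ (Nat.le_of_dvd hpos hdvd)
    by_contra! hlt
    obtain ⟨n, hn⟩ : ∃ n, a.length = M s t + n + 1 := ⟨a.length - M s t - 1, by omega⟩
    obtain ⟨m, hm⟩ := Nat.exists_eq_succ_of_ne_zero hM
    obtain ⟨l, hl⟩ := exists_altWord_add t s (M s t) n
    have hll : l.length = n := by
      have := congrArg List.length hl
      simpa using this.symm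
    rw [hn, altWord, hl, wordProd_cons, wordProd_append, ← wordProd_altWord_braid] at h1
    nth_rw 1 [hm] at h1
    rw [altWord, wordProd_cons, mul_assoc, simple_mul_simple_cancel_left, ← wordProd_append] at h1
    have := cs.length_wordProd_le (altWord t s m ++ l)
    rw [← h1, har] at this
    simp [hll] at this
    omega
  refine ⟨hM, cs.wordProd ω, ?_, ?_⟩
  · rw [← hk, ← h1, hay]
  · rw [hz, hk, hω.eq]

/-- An element with a unique reduced expression. -/
def HasUniqueReducedWord (z : W) : Prop :=
  ∀ ω ω' : List B, cs.IsReduced ω → cs.IsReduced ω' → z = cs.wordProd ω → z = cs.wordProd ω' →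
    ω = ω'

variable {cs}

theorem HasUniqueReducedWord.eq_of_isLeftDescent {z : W} (h : cs.HasUniqueReducedWord z) {s t : B}
    (hs : cs.IsLeftDescent z s) (ht : cs.IsLeftDescent z t) : s = t := by
  obtain ⟨ω, h1, h2⟩ := cs.exists_isReduced_cons hs
  obtain ⟨ω', h1', h2'⟩ := cs.exists_isReduced_cons ht
  exact (List.cons.inj (h _ _ h1 h1' h2 h2')).1

theorem HasUniqueReducedWord.simple_mul {z : W} (h : cs.HasUniqueReducedWord z) {s : B}
    (hs : cs.IsLeftDescent z s) : cs.HasUniqueReducedWord (cs.simple s * z) := by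
  intro ω ω' h1 h1' h2 h2'
  have hn := cs.isLeftDescent_iff_not_isLeftDescent_mul.1 hs
  have := h (s :: ω) (s :: ω') (cs.isReduced_cons_iff.2 ⟨h1, by rwa [← h2]⟩)
    (cs.isReduced_cons_iff.2 ⟨h1', by rwa [← h2']⟩)
    (by rw [wordProd_cons, ← h2, simple_mul_simple_cancel_left])
    (by rw [wordProd_cons, ← h2', simple_mul_simple_cancel_left])
  exact (List.cons.inj this).2

theorem HasUniqueReducedWord.inv {z : W} (h : cs.HasUniqueReducedWord z) :
    cs.HasUniqueReducedWord z⁻¹ := by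
  intro ω ω' h1 h1' h2 h2'
  have := h _ _ h1.reverse h1'.reverse (by rw [wordProd_reverse, ← h2, inv_inv])
    (by rw [wordProd_reverse, ← h2', inv_inv])
  exact List.reverse_injective this

variable (cs)

theorem hasUniqueReducedWord_one : cs.HasUniqueReducedWord 1 := by
  intro ω ω' h1 h1' h2 h2'
  have e := h1.eq
  have e' := h1'.eq
  rw [← h2, length_one] at e
  rw [← h2', length_one] at e'
  rw [List.eq_nil_of_length_eq_zero e.symm, List.eq_nil_of_length_eq_zero e'.symm]

/-- If `t` were the only left descent, every reduced word of `z` would be `t` followed by the unique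
reduced word of `t z`. -/
theorem exists_isLeftDescent_ne {z : W} {t : B} (hz : ¬ cs.HasUniqueReducedWord z)
    (ht : cs.IsLeftDescent z t) (h : cs.HasUniqueReducedWord (cs.simple t * z)) :
    ∃ r, r ≠ t ∧ cs.IsLeftDescent z r := by
  by_contra! hc
  apply hz
  have key : ∀ ω, cs.IsReduced ω → z = cs.wordProd ω → ∃ ω', ω = t :: ω' ∧ cs.IsReduced ω' ∧
      cs.simple t * z = cs.wordProd ω' := by
    intro ω h1 h2
    cases ω with
    | nil => rw [h2, wordProd_nil] at ht; exact absurd ht (cs.not_isLeftDescent_one t)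
    | cons a ω =>
      have ha : a = t := by
        by_contra hne
        exact hc a hne (h2 ▸ h1.isLeftDescent)
      subst ha
      exact ⟨ω, rfl, (cs.isReduced_cons_iff.1 h1).1,
        by rw [h2, wordProd_cons, simple_mul_simple_cancel_left]⟩
  intro ω ω' h1 h1' h2 h2'
  obtain ⟨a, rfl, h3, h4⟩ := key ω h1 h2
  obtain ⟨b, rfl, h3', h4'⟩ := key ω' h1' h2'
  rw [h a b h3 h3' h4 h4']

theorem two_le_of_ne {s t : B} (hst : s ≠ t) (h : M s t ≠ 0) : 2 ≤ M s t := by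
  have := M.off_diagonal s t hst
  omega

/-- With both descents, `z` begins reducedly with the braid word `t r ⋯`, which has at least two
letters, so `t z` begins with `r`. -/
theorem isLeftDescent_simple_mul_of_ne {z : W} {r t : B} (hrt : r ≠ t)
    (hr : cs.IsLeftDescent z r) (ht : cs.IsLeftDescent z t) :
    cs.IsLeftDescent (cs.simple t * z) r := by
  obtain ⟨hM, y, hy, hl⟩ := cs.exists_altWord_of_isLeftDescent hrt.symm ht hr
  have h2 := two_le_of_ne hrt.symm hM
  obtain ⟨m, hm⟩ : ∃ m, M t r = m + 1 + 1 := ⟨M t r - 2, by omega⟩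
  rw [isLeftDescent_iff] at ht
  rw [IsLeftDescent]
  rw [hm, altWord, altWord, wordProd_cons, wordProd_cons] at hy
  have : cs.simple r * (cs.simple t * z) = cs.wordProd (altWord t r m) * y := by
    rw [hy]; simp only [mul_assoc, simple_mul_simple_cancel_left]
  rw [this]
  have h3 := cs.length_mul_le (cs.wordProd (altWord t r m)) y
  have h4 := cs.length_wordProd_le (altWord t r m)
  rw [length_altWord] at h4
  omega

/-- If `u` has a unique reduced expression and `t u > u` does not, then every left descent of `u`
is one of `t u`. -/
theorem HasUniqueReducedWord.isLeftDescent_simple_mul {u : W} {s t : B}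
    {cs : CoxeterSystem M W} (hu : cs.HasUniqueReducedWord u) (hs : cs.IsLeftDescent u s)
    (ht : ¬ cs.IsLeftDescent u t) (h : ¬ cs.HasUniqueReducedWord (cs.simple t * u)) :
    cs.IsLeftDescent (cs.simple t * u) s := by
  have ht' : cs.IsLeftDescent (cs.simple t * u) t := by
    rw [isLeftDescent_iff_not_isLeftDescent_mul, simple_mul_simple_cancel_left]; exact ht
  obtain ⟨r, hrt, hr⟩ := cs.exists_isLeftDescent_ne h ht'
    (by rwa [simple_mul_simple_cancel_left])
  have := cs.isLeftDescent_simple_mul_of_ne hrt hr ht'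
  rw [simple_mul_simple_cancel_left] at this
  rwa [hu.eq_of_isLeftDescent hs this]

/-- An element with several reduced expressions has a reduced expression with a braid word as a
factor. -/
theorem exists_braid_factor {z : W} (hz : ¬ cs.HasUniqueReducedWord z) :
    ∃ x y : W, ∃ s t : B, s ≠ t ∧ M s t ≠ 0 ∧
      z = x * (cs.wordProd (altWord s t (M s t)) * y) ∧
      cs.length z = cs.length x + (M s t + cs.length y) := by
  induction hn : cs.length z generalizing z with
  | zero =>
    rw [cs.length_eq_zero_iff.1 hn] at hz
    exact absurd cs.hasUniqueReducedWord_one hz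
  | succ n ih =>
    have h1 : z ≠ 1 := by rintro rfl; simp at hn
    obtain ⟨t, ht⟩ := cs.exists_leftDescent_of_ne_one h1
    by_cases hu : cs.HasUniqueReducedWord (cs.simple t * z)
    · obtain ⟨r, hrt, hr⟩ := cs.exists_isLeftDescent_ne hz ht hu
      obtain ⟨hM, y, hy, hl⟩ := cs.exists_altWord_of_isLeftDescent hrt hr ht
      exact ⟨1, y, r, t, hrt, hM, by rw [one_mul, hy], by rw [← hn, hl]; simp⟩
    · have hl := cs.isLeftDescent_iff.1 ht
      obtain ⟨x, y, s, r, hsr, hM, hy, hl2⟩ := ih hu (by omega)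
      refine ⟨cs.simple t * x, y, s, r, hsr, hM, ?_, ?_⟩
      · rw [mul_assoc, ← hy, simple_mul_simple_cancel_left]
      · have h3 := cs.length_mul_le (cs.simple t * x) (cs.wordProd (altWord s r (M s r)) * y)
        rw [mul_assoc, ← hy, simple_mul_simple_cancel_left] at h3
        have h4 := cs.length_mul_le (cs.wordProd (altWord s r (M s r))) y
        have h5 := cs.length_wordProd_le (altWord s r (M s r))
        rw [length_altWord] at h5
        have h6 := cs.length_mul_le (cs.simple t) x
        rw [length_simple] at h6
        omega

/-- Words without repeated adjacent letters that contain no braid word. -/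
def IsBraidFree (M : CoxeterMatrix B) (ω : List B) : Prop :=
  ω.IsChain (· ≠ ·) ∧ ∀ s t, s ≠ t → M s t ≠ 0 → ¬ altWord s t (M s t) <:+: ω

theorem IsBraidFree.of_cons {i : B} {ω : List B} (h : IsBraidFree M (i :: ω)) : IsBraidFree M ω :=
  ⟨h.1.tail, fun s t hst hM hi => h.2 s t hst hM (hi.trans (List.suffix_cons i ω).isInfix)⟩

/-- Induction on the word. Failure of reducedness would make `i` the only descent of the tail, a
repeated letter. Failure of uniqueness gives a second descent, hence a braid word at the front of
the element; by uniqueness for the tail it is literally a prefix of the word. -/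
theorem IsBraidFree.isReduced_and_hasUniqueReducedWord {ω : List B} (h : IsBraidFree M ω) :
    cs.IsReduced ω ∧ cs.HasUniqueReducedWord (cs.wordProd ω) := by
  induction ω with
  | nil => exact ⟨by simp [IsReduced], by simpa using cs.hasUniqueReducedWord_one⟩
  | cons i ω ih =>
    obtain ⟨hr, hu⟩ := ih h.of_cons
    have hni : ¬ cs.IsLeftDescent (cs.wordProd ω) i := by
      intro hd
      cases ω with
      | nil => exact cs.not_isLeftDescent_one i (by simpa using hd)
      | cons j ω =>
        have := hu.eq_of_isLeftDescent hd hr.isLeftDescent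
        exact (List.isChain_cons_cons.1 h.1).1 this
    have hr' : cs.IsReduced (i :: ω) := cs.isReduced_cons_iff.2 ⟨hr, hni⟩
    refine ⟨hr', ?_⟩
    by_contra hnu
    have hd := hr'.isLeftDescent
    obtain ⟨r, hri, hdr⟩ := cs.exists_isLeftDescent_ne hnu hd
      (by rwa [wordProd_cons, simple_mul_simple_cancel_left])
    obtain ⟨hM, y, hy, hl⟩ := cs.exists_altWord_of_isLeftDescent hri.symm hd hdr
    obtain ⟨υ, hυ, rfl⟩ := cs.exists_isReduced y
    have h2 := two_le_of_ne hri.symm hM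
    obtain ⟨m, hm⟩ : ∃ m, M i r = m + 1 := ⟨M i r - 1, by omega⟩
    have hωυ : cs.wordProd ω = cs.wordProd (altWord r i m ++ υ) := by
      rw [hm, altWord, wordProd_cons, wordProd_cons, mul_assoc, mul_right_inj] at hy
      rw [hy, wordProd_append]
    have e : ω = altWord r i m ++ υ := by
      refine hu _ _ hr ?_ rfl hωυ
      rw [IsReduced, ← hωυ, hr.eq, List.length_append, length_altWord]
      rw [hr'.eq, hυ.eq, List.length_cons] at hl
      omega
    refine h.2 i r hri.symm hM ⟨[], υ, ?_⟩
    rw [hm, altWord, e]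
    simp

/-- A braid move on a factor produces a second word of the same length for the same element. -/
theorem HasUniqueReducedWord.isBraidFree {cs : CoxeterSystem M W} {ω : List B}
    (hu : cs.HasUniqueReducedWord (cs.wordProd ω)) (h : cs.IsReduced ω) : IsBraidFree M ω := by
  refine ⟨h.isChain, ?_⟩
  rintro s t hst hM ⟨a, b, rfl⟩
  have e : cs.wordProd (a ++ altWord s t (M s t) ++ b) =
      cs.wordProd (a ++ altWord t s (M s t) ++ b) := by
    rw [wordProd_append, wordProd_append, wordProd_append, wordProd_append,
      wordProd_altWord_braid]
  have h' : cs.IsReduced (a ++ altWord t s (M s t) ++ b) := by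
    rw [IsReduced, ← e, h.eq]; simp
  have := hu _ _ h h' rfl e
  simp only [List.append_cancel_left_eq, List.append_cancel_right_eq] at this
  obtain ⟨m, hm⟩ := Nat.exists_eq_succ_of_ne_zero hM
  rw [hm, altWord, altWord] at this
  exact hst (List.cons.inj this).1

/-- The elements with a unique reduced expression correspond to the braid-free words. -/
theorem finite_hasUniqueReducedWord_iff :
    {z : W | cs.HasUniqueReducedWord z}.Finite ↔ {ω : List B | IsBraidFree M ω}.Finite := by
  have himg : {z : W | cs.HasUniqueReducedWord z} = cs.wordProd '' {ω | IsBraidFree M ω} := by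
    ext z
    constructor
    · intro hz
      obtain ⟨ω, h1, rfl⟩ := cs.exists_isReduced z
      exact ⟨ω, HasUniqueReducedWord.isBraidFree hz h1, rfl⟩
    · rintro ⟨ω, h, rfl⟩
      exact (IsBraidFree.isReduced_and_hasUniqueReducedWord cs h).2
  rw [himg]
  refine Set.finite_image_iff ?_
  intro ω h ω' h' e
  have h1 := IsBraidFree.isReduced_and_hasUniqueReducedWord cs h
  have h2 := IsBraidFree.isReduced_and_hasUniqueReducedWord cs h'
  exact h1.2 _ _ h1.1 h2.1 rfl e

end Dihedral

end CoxeterSystem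

namespace CoxeterSystem

theorem end_ext {W : Type*} {X Y : Module.End ℤ[T;T⁻¹] (W →₀ ℤ[T;T⁻¹])}
    (h : ∀ w, X (Finsupp.single w 1) = Y (Finsupp.single w 1)) : X = Y :=
  Finsupp.lhom_ext' fun w => LinearMap.ext_ring (h w)

theorem sub_mul_add_eq_zero {R A : Type*} [CommRing R] [Ring A] [Algebra R A] {a b : R} {x : A}
    (hab : a * b = 1) (h : x * x = 1 + (a - b) • x) :
    (x - algebraMap R A a) * (x + algebraMap R A b) = 0 := by
  rw [sub_mul, mul_add, mul_add, h, ← map_mul, hab, ← Algebra.smul_def, ← Algebra.commutes,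
    ← Algebra.smul_def, map_one, sub_smul]
  abel

/-! ### The regular representation and the standard basis of the Hecke algebra -/

section HeckeBasis

variable {B W : Type*} [Group W] {M : CoxeterMatrix B} (cs : CoxeterSystem M W)

theorem simple_mul_eq_mul_simple_of_isLeftDescent {w : W} {i j : B}
    (h1 : ¬ cs.IsLeftDescent w i) (h2 : cs.IsLeftDescent (w * cs.simple j) i) :
    cs.simple i * w = w * cs.simple j := by
  rw [not_isLeftDescent_iff] at h1
  rw [isLeftDescent_iff] at h2
  have h3 := cs.length_mul_simple w j
  have h4 := cs.length_mul_simple (cs.simple i * w) j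
  rw [mul_assoc] at h4
  exact cs.simple_mul_eq_mul_simple (by omega) (by omega)

/-- The only situation in which left and right multiplication by simple reflections interfere;
elsewhere left descents are unaffected by the right factor. -/
theorem simple_mul_eq_mul_simple_of_not_iff {w : W} {i j : B}
    (h : ¬ (cs.IsLeftDescent (w * cs.simple j) i ↔ cs.IsLeftDescent w i)) :
    cs.simple i * w = w * cs.simple j := by
  by_cases h1 : cs.IsLeftDescent w i
  · have := cs.simple_mul_eq_mul_simple_of_isLeftDescent (w := w * cs.simple j) (i := i) (j := j)
      (by tauto) (by simpa using h1)
    rw [simple_mul_simple_cancel_right] at this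
    calc cs.simple i * w = cs.simple i * (cs.simple i * (w * cs.simple j)) := by rw [this]
      _ = _ := by rw [simple_mul_simple_cancel_left]
  · exact cs.simple_mul_eq_mul_simple_of_isLeftDescent h1 (by tauto)

theorem simple_mul_eq_mul_simple_of_not_iff' {w : W} {i j : B}
    (h : ¬ (cs.IsRightDescent (cs.simple i * w) j ↔ cs.IsRightDescent w j)) :
    cs.simple i * w = w * cs.simple j := by
  rw [← isLeftDescent_inv_iff, ← isLeftDescent_inv_iff, mul_inv_rev, inv_simple] at h
  have := congrArg (·⁻¹) (cs.simple_mul_eq_mul_simple_of_not_iff h)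
  simpa using this.symm

open Classical in
/-- Left multiplication by `δ_i` on the free module with basis `W`. -/
noncomputable def leftOp (i : B) : Module.End ℤ[T;T⁻¹] (W →₀ ℤ[T;T⁻¹]) :=
  Finsupp.linearCombination ℤ[T;T⁻¹] fun w =>
    Finsupp.single (cs.simple i * w) 1 +
      (if cs.IsLeftDescent w i then (LaurentPolynomial.T (-1) - LaurentPolynomial.T 1 : ℤ[T;T⁻¹])
        else 0) • Finsupp.single w 1

open Classical in
/-- Right multiplication by `δ_i` on the free module with basis `W`. -/
noncomputable def rightOp (i : B) : Module.End ℤ[T;T⁻¹] (W →₀ ℤ[T;T⁻¹]) :=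
  Finsupp.linearCombination ℤ[T;T⁻¹] fun w =>
    Finsupp.single (w * cs.simple i) 1 +
      (if cs.IsRightDescent w i then (LaurentPolynomial.T (-1) - LaurentPolynomial.T 1 : ℤ[T;T⁻¹])
        else 0) • Finsupp.single w 1

open Classical in
theorem leftOp_single (i : B) (w : W) : cs.leftOp i (Finsupp.single w 1) =
    Finsupp.single (cs.simple i * w) 1 +
      (if cs.IsLeftDescent w i then (LaurentPolynomial.T (-1) - LaurentPolynomial.T 1 : ℤ[T;T⁻¹])
        else 0) • Finsupp.single w 1 := by
  rw [leftOp, Finsupp.linearCombination_single, one_smul]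

open Classical in
theorem rightOp_single (i : B) (w : W) : cs.rightOp i (Finsupp.single w 1) =
    Finsupp.single (w * cs.simple i) 1 +
      (if cs.IsRightDescent w i then (LaurentPolynomial.T (-1) - LaurentPolynomial.T 1 : ℤ[T;T⁻¹])
        else 0) • Finsupp.single w 1 := by
  rw [rightOp, Finsupp.linearCombination_single, one_smul]

/-- If `s_i w = w s_j`, both operators act alike on the pair `w`, `w s_j`; otherwise each descent
condition is insensitive to the other multiplication and the two formulas expand to the same sum. -/
theorem commute_leftOp_rightOp (i j : B) : Commute (cs.leftOp i) (cs.rightOp j) := by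
  classical
  refine end_ext fun w => ?_
  change cs.leftOp i (cs.rightOp j (Finsupp.single w 1)) =
    cs.rightOp j (cs.leftOp i (Finsupp.single w 1))
  simp only [leftOp_single, rightOp_single, map_add, map_smul]
  by_cases he : cs.simple i * w = w * cs.simple j
  · have e0 : cs.simple i * (w * cs.simple j) = w := by
      rw [← he, simple_mul_simple_cancel_left]
    have e1 : cs.IsLeftDescent (w * cs.simple j) i ↔ ¬ cs.IsLeftDescent w i := by
      rw [← he, isLeftDescent_iff_not_isLeftDescent_mul, simple_mul_simple_cancel_left]
    have e2 : cs.IsRightDescent (w * cs.simple j) j ↔ ¬ cs.IsRightDescent w j := by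
      rw [isRightDescent_iff_not_isRightDescent_mul, simple_mul_simple_cancel_right]
    have e3 : cs.IsLeftDescent w i ↔ cs.IsRightDescent w j := by
      rw [IsLeftDescent, IsRightDescent, he]
    simp only [he, e0, e1, e2, e3, simple_mul_simple_cancel_right]
  · have e1 : cs.IsLeftDescent (w * cs.simple j) i ↔ cs.IsLeftDescent w i := by
      by_contra h
      exact he (cs.simple_mul_eq_mul_simple_of_not_iff h)
    have e2 : cs.IsRightDescent (cs.simple i * w) j ↔ cs.IsRightDescent w j := by
      by_contra h
      exact he (cs.simple_mul_eq_mul_simple_of_not_iff' h)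
    simp only [e1, e2, mul_assoc, smul_add, smul_smul]
    rw [mul_comm (if cs.IsRightDescent w j then _ else _)]
    abel

theorem leftOp_mul_self (i : B) : cs.leftOp i * cs.leftOp i =
    1 + (LaurentPolynomial.T (-1) - LaurentPolynomial.T 1 : ℤ[T;T⁻¹]) • cs.leftOp i := by
  classical
  refine end_ext fun w => ?_
  rw [Module.End.mul_apply, LinearMap.add_apply, Module.End.one_apply, LinearMap.smul_apply]
  simp only [leftOp_single, map_add, map_smul, simple_mul_simple_cancel_left]
  have e := cs.isLeftDescent_iff_not_isLeftDescent_mul (w := w) (i := i)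
  by_cases h : cs.IsLeftDescent w i
  · simp only [h, true_iff] at e
    simp only [h, e, if_true, if_false, zero_smul, add_zero, smul_add]
  · simp only [h, false_iff, not_not] at e
    simp only [h, e, if_true, if_false, zero_smul, add_zero]

/-- Operators that commute with all right multiplications are determined by their value at `1`. -/
theorem eq_of_commute_rightOp {X Y : Module.End ℤ[T;T⁻¹] (W →₀ ℤ[T;T⁻¹])}
    (hX : ∀ i, Commute X (cs.rightOp i)) (hY : ∀ i, Commute Y (cs.rightOp i))
    (h : X (Finsupp.single 1 1) = Y (Finsupp.single 1 1)) : X = Y := by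
  classical
  refine end_ext fun w => ?_
  induction hn : cs.length w generalizing w with
  | zero => rw [cs.length_eq_zero_iff.1 hn, h]
  | succ n ih =>
    have h1 : w ≠ 1 := by rintro rfl; simp at hn
    obtain ⟨i, hi⟩ := cs.exists_rightDescent_of_ne_one h1
    have e : cs.rightOp i (Finsupp.single (w * cs.simple i) 1) = Finsupp.single w 1 := by
      rw [rightOp_single, simple_mul_simple_cancel_right,
        if_neg (cs.isRightDescent_iff_not_isRightDescent_mul.1 hi), zero_smul, add_zero]
    rw [← e]
    have h2 := DFunLike.congr_fun (hX i).eq (Finsupp.single (w * cs.simple i) 1)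
    have h3 := DFunLike.congr_fun (hY i).eq (Finsupp.single (w * cs.simple i) 1)
    simp only [Module.End.mul_apply] at h2 h3
    rw [h2, h3, ih _ (by rw [isRightDescent_iff] at hi; omega)]

theorem leftOp_list_prod_single {ω : List B} {w : W}
    (h : cs.length (cs.wordProd ω * w) = ω.length + cs.length w) :
    (ω.map cs.leftOp).prod (Finsupp.single w 1) = Finsupp.single (cs.wordProd ω * w) 1 := by
  induction ω with
  | nil => simp
  | cons i ω ih =>
    rw [wordProd_cons, mul_assoc] at h
    have h1 := cs.length_mul_le (cs.wordProd ω) w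
    have h2 := cs.length_wordProd_le ω
    have h3 := cs.length_simple_mul (cs.wordProd ω * w) i
    rw [List.length_cons] at h
    rw [List.map_cons, List.prod_cons, Module.End.mul_apply, ih (by omega), leftOp_single,
      if_neg, zero_smul, add_zero, wordProd_cons, mul_assoc]
    rw [not_isLeftDescent_iff]
    omega

/-- Left multiplication by `δ_w` on the free module with basis `W`. -/
noncomputable def stdOp (w : W) : Module.End ℤ[T;T⁻¹] (W →₀ ℤ[T;T⁻¹]) :=
  ((cs.exists_isReduced w).choose.map cs.leftOp).prod

theorem stdOp_single {x y : W} (h : cs.length (x * y) = cs.length x + cs.length y) :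
    cs.stdOp x (Finsupp.single y 1) = Finsupp.single (x * y) 1 := by
  obtain ⟨h1, h2⟩ := (cs.exists_isReduced x).choose_spec
  rw [stdOp, leftOp_list_prod_single, ← h2]
  rw [← h2, h, ← h1.eq, ← h2]

theorem commute_stdOp_rightOp (w : W) (i : B) : Commute (cs.stdOp w) (cs.rightOp i) := by
  refine Commute.list_prod_left _ _ ?_
  intro X hX
  obtain ⟨j, -, rfl⟩ := List.mem_map.1 hX
  exact cs.commute_leftOp_rightOp j i

theorem stdOp_simple (i : B) : cs.stdOp (cs.simple i) = cs.leftOp i := by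
  classical
  refine cs.eq_of_commute_rightOp (cs.commute_stdOp_rightOp _) (cs.commute_leftOp_rightOp i) ?_
  rw [stdOp_single _ (by simp), leftOp_single, if_neg (cs.not_isLeftDescent_one i)]
  simp

/-- Both sides commute with all right multiplications, so the unit and length-additive relations
need checking only on the basis vector at `1`. The quadratic relation is `leftOp_mul_self`. -/
theorem stdOp_rel ⦃a b : FreeAlgebra ℤ[T;T⁻¹] W⦄ (h : HeckeRel cs a b) :
    FreeAlgebra.lift ℤ[T;T⁻¹] cs.stdOp a = FreeAlgebra.lift ℤ[T;T⁻¹] cs.stdOp b := by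
  cases h with
  | one =>
    rw [FreeAlgebra.lift_ι_apply, map_one]
    refine cs.eq_of_commute_rightOp (cs.commute_stdOp_rightOp _) (fun i => Commute.one_left _) ?_
    rw [stdOp_single _ (by simp)]
    simp
  | mul x y h =>
    rw [map_mul, FreeAlgebra.lift_ι_apply, FreeAlgebra.lift_ι_apply, FreeAlgebra.lift_ι_apply]
    refine cs.eq_of_commute_rightOp
      (fun i => (cs.commute_stdOp_rightOp x i).mul_left (cs.commute_stdOp_rightOp y i))
      (cs.commute_stdOp_rightOp _) ?_
    rw [Module.End.mul_apply, cs.stdOp_single (x := y) (y := 1) (by simp), mul_one,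
      stdOp_single _ h, cs.stdOp_single (x := x * y) (y := 1) (by simp), mul_one]
  | quadratic s =>
    rw [map_mul, map_sub, map_add, map_zero, FreeAlgebra.lift_ι_apply, AlgHom.commutes,
      AlgHom.commutes, stdOp_simple]
    have h : (LaurentPolynomial.T (-1) * LaurentPolynomial.T 1 : ℤ[T;T⁻¹]) = 1 := by
      rw [← LaurentPolynomial.T_add]; simp
    exact sub_mul_add_eq_zero (A := Module.End ℤ[T;T⁻¹] (W →₀ ℤ[T;T⁻¹])) h (cs.leftOp_mul_self s)

/-- The left regular representation of the Hecke algebra in terms of the standard basis. -/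
noncomputable def heckeRep : cs.Hecke →ₐ[ℤ[T;T⁻¹]] Module.End ℤ[T;T⁻¹] (W →₀ ℤ[T;T⁻¹]) :=
  RingQuot.liftAlgHom ℤ[T;T⁻¹] ⟨FreeAlgebra.lift ℤ[T;T⁻¹] cs.stdOp, cs.stdOp_rel⟩

theorem heckeRep_heckeStd (w : W) : cs.heckeRep (cs.heckeStd w) = cs.stdOp w := by
  have h := RingQuot.liftAlgHom_mkAlgHom_apply ℤ[T;T⁻¹] (FreeAlgebra.lift ℤ[T;T⁻¹] cs.stdOp)
    cs.stdOp_rel (FreeAlgebra.ι ℤ[T;T⁻¹] w)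
  rw [FreeAlgebra.lift_ι_apply] at h
  exact h

/-- The coordinates of an element of the Hecke algebra with respect to the standard basis. -/
noncomputable def heckeCoord : cs.Hecke →ₗ[ℤ[T;T⁻¹]] (W →₀ ℤ[T;T⁻¹]) :=
  (LinearMap.applyₗ (Finsupp.single 1 1)).comp cs.heckeRep.toLinearMap

theorem heckeCoord_heckeStd (w : W) : cs.heckeCoord (cs.heckeStd w) = Finsupp.single w 1 := by
  change cs.heckeRep (cs.heckeStd w) (Finsupp.single 1 1) = _
  rw [heckeRep_heckeStd, stdOp_single _ (by simp), mul_one]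

theorem heckeStd_simple_sq (i : B) : cs.heckeStd (cs.simple i) * cs.heckeStd (cs.simple i) =
    1 + (LaurentPolynomial.T (-1) - LaurentPolynomial.T 1 : ℤ[T;T⁻¹]) •
      cs.heckeStd (cs.simple i) := by
  have h := (cs.heckeStd_simple_mul i).1
  rw [mul_sub, mul_add, ← Algebra.commutes, ← Algebra.commutes, ← Algebra.smul_def,
    ← Algebra.smul_def] at h
  rw [← h, sub_smul]
  abel

open Classical in
theorem heckeStd_simple_mul_heckeStd (i : B) (w : W) :
    cs.heckeStd (cs.simple i) * cs.heckeStd w = cs.heckeStd (cs.simple i * w) +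
      (if cs.IsLeftDescent w i then (LaurentPolynomial.T (-1) - LaurentPolynomial.T 1 : ℤ[T;T⁻¹])
        else 0) • cs.heckeStd w := by
  by_cases h : cs.IsLeftDescent w i
  · rw [if_pos h]
    have hl := cs.isLeftDescent_iff.1 h
    have e : cs.heckeStd (cs.simple i) * cs.heckeStd (cs.simple i * w) = cs.heckeStd w := by
      rw [heckeStd_mul, simple_mul_simple_cancel_left]
      rw [simple_mul_simple_cancel_left, length_simple]
      omega
    nth_rw 1 [← e]
    rw [← mul_assoc, heckeStd_simple_sq, add_mul, one_mul, smul_mul_assoc, e]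
  · rw [if_neg h, zero_smul, add_zero, heckeStd_mul]
    rw [not_isLeftDescent_iff] at h
    rw [h, length_simple, add_comm]

theorem heckeMk_surjective : Function.Surjective cs.heckeMk :=
  RingQuot.mkAlgHom_surjective _ _

/-- Left ideals of the Hecke algebra are the submodules stable under the `δ_s`. -/
theorem mul_mem_of_simple {N : Submodule ℤ[T;T⁻¹] cs.Hecke}
    (hN : ∀ i, ∀ x ∈ N, cs.heckeStd (cs.simple i) * x ∈ N) (h : cs.Hecke) {x : cs.Hecke}
    (hx : x ∈ N) : h * x ∈ N := by
  have hw : ∀ w : W, ∀ x ∈ N, cs.heckeStd w * x ∈ N := by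
    intro w
    induction hn : cs.length w generalizing w with
    | zero => intro x hx; rwa [cs.length_eq_zero_iff.1 hn, heckeStd_one, one_mul]
    | succ n ih =>
      intro x hx
      have h1 : w ≠ 1 := by rintro rfl; simp at hn
      obtain ⟨i, hi⟩ := cs.exists_leftDescent_of_ne_one h1
      rw [isLeftDescent_iff] at hi
      rw [← cs.simple_mul_simple_cancel_left (w := w) i, ← heckeStd_mul, mul_assoc]
      · exact hN i _ (ih _ (by omega) x hx)
      · rw [simple_mul_simple_cancel_left, length_simple]; omega
  obtain ⟨a, rfl⟩ := cs.heckeMk_surjective h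
  induction a using FreeAlgebra.induction generalizing x with
  | grade0 r => rw [AlgHom.commutes, ← Algebra.smul_def]; exact N.smul_mem _ hx
  | grade1 w => exact hw w x hx
  | mul a b ha hb => rw [map_mul, mul_assoc]; exact ha (hb hx)
  | add a b ha hb => rw [map_add, add_mul]; exact N.add_mem (ha hx) (hb hx)

theorem range_linearCombination_heckeStd :
    LinearMap.range (Finsupp.linearCombination ℤ[T;T⁻¹] cs.heckeStd) = ⊤ := by
  classical
  rw [eq_top_iff]
  intro h _
  have h1 : ∀ w, cs.heckeStd w ∈ LinearMap.range (Finsupp.linearCombination ℤ[T;T⁻¹] cs.heckeStd) :=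
    fun w => ⟨Finsupp.single w 1, by simp⟩
  rw [← mul_one h]
  refine cs.mul_mem_of_simple ?_ h (by rw [← heckeStd_one]; exact h1 1)
  rintro i _ ⟨f, rfl⟩
  rw [Finsupp.linearCombination_apply, Finsupp.sum, Finset.mul_sum]
  refine Submodule.sum_mem _ fun w _ => ?_
  rw [mul_smul_comm, heckeStd_simple_mul_heckeStd]
  exact Submodule.smul_mem _ _ (Submodule.add_mem _ (h1 _) (Submodule.smul_mem _ _ (h1 _)))

/-- The Hecke algebra is free on the standard basis. -/
noncomputable def heckeEquiv : cs.Hecke ≃ₗ[ℤ[T;T⁻¹]] (W →₀ ℤ[T;T⁻¹]) :=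
  have h : cs.heckeCoord.comp (Finsupp.linearCombination ℤ[T;T⁻¹] cs.heckeStd) =
      LinearMap.id := by
    refine Finsupp.lhom_ext' fun w => LinearMap.ext_ring ?_
    simp [heckeCoord_heckeStd]
  LinearEquiv.ofLinearMap cs.heckeCoord (Finsupp.linearCombination ℤ[T;T⁻¹] cs.heckeStd) h (by
    ext x
    obtain ⟨f, rfl⟩ : x ∈ LinearMap.range (Finsupp.linearCombination ℤ[T;T⁻¹] cs.heckeStd) := by
      rw [range_linearCombination_heckeStd]; trivial
    have := DFunLike.congr_fun h f
    simp only [LinearMap.comp_apply, LinearMap.id_apply] at this ⊢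
    rw [this])

theorem heckeEquiv_symm_apply (f : W →₀ ℤ[T;T⁻¹]) :
    cs.heckeEquiv.symm f = f.sum fun w a => a • cs.heckeStd w := rfl

/-- The standard basis of the Hecke algebra. -/
noncomputable def heckeBasis : Module.Basis W ℤ[T;T⁻¹] cs.Hecke := ⟨cs.heckeEquiv⟩

@[simp]
theorem heckeBasis_apply (w : W) : cs.heckeBasis w = cs.heckeStd w := by
  rw [← Module.Basis.repr_symm_single_one]
  simp [heckeBasis, heckeEquiv_symm_apply]

@[simp]
theorem heckeBasis_repr_heckeStd (w : W) :
    cs.heckeBasis.repr (cs.heckeStd w) = Finsupp.single w 1 := cs.heckeCoord_heckeStd w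

end HeckeBasis

end CoxeterSystem

/-! ### Laurent polynomials with bounded pole -/

namespace LaurentPolynomial

/-- The Laurent polynomials in `v ^ k ℤ[v]`. -/
def orderGE (k : ℤ) : AddSubgroup ℤ[T;T⁻¹] where
  carrier := {a | ∀ i < k, a.coeff i = 0}
  zero_mem' := fun i _ => rfl
  add_mem' := fun {a b} ha hb i hi => by
    rw [AddMonoidAlgebra.coeff_add, Finsupp.add_apply, ha i hi, hb i hi, add_zero]
  neg_mem' := fun {a} ha i hi => by
    rw [AddMonoidAlgebra.coeff_neg, Finsupp.neg_apply, ha i hi, neg_zero]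

theorem orderGE_mono {k l : ℤ} (h : k ≤ l) : orderGE l ≤ orderGE k :=
  fun _ ha i hi => ha i (hi.trans_le h)

theorem coeff_T_mul (n i : ℤ) (a : ℤ[T;T⁻¹]) : (T n * a).coeff i = a.coeff (i - n) := by
  induction a using LaurentPolynomial.induction_on' with
  | add p q hp hq => rw [mul_add, AddMonoidAlgebra.coeff_add, AddMonoidAlgebra.coeff_add,
      Finsupp.add_apply, Finsupp.add_apply, hp, hq]
  | C_mul_T m r =>
    rw [mul_left_comm, ← T_add, ← single_eq_C_mul_T, ← single_eq_C_mul_T]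
    simp only [AddMonoidAlgebra.coeff_single, Finsupp.single_apply]
    congr 1
    exact propext ⟨fun h => by omega, fun h => by omega⟩

theorem T_mul_mem_orderGE {n k : ℤ} {a : ℤ[T;T⁻¹]} (ha : a ∈ orderGE k) :
    T n * a ∈ orderGE (k + n) := by
  intro i hi
  rw [coeff_T_mul]
  exact ha _ (by omega)

theorem one_mem_orderGE : (1 : ℤ[T;T⁻¹]) ∈ orderGE 0 := by
  intro i hi
  rw [← T_zero, T_apply, if_neg (by omega)]

theorem toLaurent_mem_orderGE (p : ℤ[X]) : Polynomial.toLaurent p ∈ orderGE 0 := by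
  intro i hi
  induction p using Polynomial.induction_on' with
  | add p q hp hq => rw [map_add, AddMonoidAlgebra.coeff_add, Finsupp.add_apply, hp, hq, add_zero]
  | monomial n r =>
    rw [← Polynomial.C_mul_X_pow_eq_monomial, Polynomial.toLaurent_C_mul_X_pow,
      ← single_eq_C_mul_T]
    simp only [AddMonoidAlgebra.coeff_single, Finsupp.single_apply]
    rw [if_neg (by omega)]

theorem mem_orderGE_zero_iff {a : ℤ[T;T⁻¹]} :
    a ∈ orderGE 0 ↔ a ∈ Set.range (Polynomial.toLaurent : ℤ[X] → ℤ[T;T⁻¹]) := by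
  constructor
  · intro ha
    obtain ⟨n, f, hf⟩ := exists_T_pow a
    induction n generalizing f with
    | zero => exact ⟨f, by simpa using hf⟩
    | succ n ih =>
      -- Here `f` is `a` times `v ^ (n + 1)`; as `a` has no pole, `f` is divisible by `X`, which
      -- lowers the exponent.
      have h0 : f.coeff 0 = 0 := by
        have h1 : (Polynomial.toLaurent f).coeff 0 = 0 := by
          rw [hf, mul_comm, coeff_T_mul]
          exact ha _ (by push_cast; omega)
        have h2 := f.divX_mul_X_add
        rw [← h2, map_add, map_mul, Polynomial.toLaurent_X, Polynomial.toLaurent_C,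
          AddMonoidAlgebra.coeff_add, Finsupp.add_apply, mul_comm, coeff_T_mul,
          toLaurent_mem_orderGE _ _ (by omega), C_apply, if_pos rfl, zero_add] at h1
        exact h1
      refine ih f.divX ?_
      have h2 := f.divX_mul_X_add
      rw [h0, map_zero, add_zero] at h2
      rw [← h2, map_mul, Polynomial.toLaurent_X] at hf
      have h3 := congrArg (· * T (-1)) hf
      simp only [mul_T_assoc] at h3
      simpa using h3
  · rintro ⟨p, rfl⟩
    exact toLaurent_mem_orderGE p

theorem mem_orderGE_one_iff {a : ℤ[T;T⁻¹]} :
    a ∈ orderGE 1 ↔ ∃ q : ℤ[X], a = Polynomial.toLaurent (Polynomial.X * q) := by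
  constructor
  · intro ha
    obtain ⟨q, hq⟩ := mem_orderGE_zero_iff.1 (T_mul_mem_orderGE (n := -1) ha)
    refine ⟨q, ?_⟩
    rw [map_mul, hq, Polynomial.toLaurent_X, ← mul_assoc, ← T_add]
    simp
  · rintro ⟨q, rfl⟩
    rw [map_mul, Polynomial.toLaurent_X]
    exact T_mul_mem_orderGE (n := 1) (toLaurent_mem_orderGE q)

theorem eq_zero_of_invert_eq {a : ℤ[T;T⁻¹]} (ha : a ∈ orderGE 1) (h : invert a = a) : a = 0 := by
  refine LaurentPolynomial.ext fun i => ?_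
  rcases lt_or_ge i 1 with hi | hi
  · exact ha i hi
  · rw [← h, invert_apply]
    exact ha _ (by omega)

theorem coeff_intCast (n i : ℤ) : ((n : ℤ[T;T⁻¹]).coeff i) = if i = 0 then n else 0 := by
  rw [← C_apply]
  simp

theorem sub_coeff_zero_mem_orderGE {a : ℤ[T;T⁻¹]} (ha : a ∈ orderGE 0) :
    a - (a.coeff 0 : ℤ[T;T⁻¹]) ∈ orderGE 1 := by
  intro i hi
  rw [AddMonoidAlgebra.coeff_sub, Finsupp.sub_apply, coeff_intCast]
  rcases (show i < 0 ∨ i = 0 by omega) with h | h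
  · rw [ha i h, if_neg (by omega), sub_zero]
  · rw [h, if_pos rfl, sub_self]

end LaurentPolynomial

namespace CoxeterSystem

open LaurentPolynomial (orderGE)

/-! ### The bar involution and the length filtration -/

section Bar

variable {B W : Type*} [Group W] {M : CoxeterMatrix B} (cs : CoxeterSystem M W)

/-- The coordinate of an element of the Hecke algebra at `δ_w`. -/
noncomputable def stdCoord (w : W) : cs.Hecke →ₗ[ℤ[T;T⁻¹]] ℤ[T;T⁻¹] := cs.heckeBasis.coord w

open Classical in
theorem stdCoord_heckeStd (u w : W) : cs.stdCoord u (cs.heckeStd w) = if w = u then 1 else 0 := by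
  rw [stdCoord, Module.Basis.coord_apply, heckeBasis_repr_heckeStd, Finsupp.single_apply]

theorem hecke_ext {x y : cs.Hecke} (h : ∀ u, cs.stdCoord u x = cs.stdCoord u y) : x = y :=
  cs.heckeBasis.ext_elem h

theorem hecke_induction {N : Submodule ℤ[T;T⁻¹] cs.Hecke} {h : cs.Hecke}
    (hN : ∀ u, cs.stdCoord u h ≠ 0 → cs.heckeStd u ∈ N) : h ∈ N := by
  rw [← cs.heckeBasis.linearCombination_repr h, Finsupp.linearCombination_apply]
  refine N.sum_mem fun u hu => N.smul_mem _ ?_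
  rw [heckeBasis_apply]
  exact hN u (Finsupp.mem_support_iff.1 hu)

theorem stdCoord_simple_mul_heckeStd_aux (i : B) (u w : W) :
    (cs.simple i * w = u) ↔ w = cs.simple i * u :=
  ⟨fun h => by rw [← h, simple_mul_simple_cancel_left],
    fun h => by rw [h, simple_mul_simple_cancel_left]⟩

open Classical in
theorem stdCoord_simple_mul (i : B) (u : W) (h : cs.Hecke) :
    cs.stdCoord u (cs.heckeStd (cs.simple i) * h) = cs.stdCoord (cs.simple i * u) h +
      (if cs.IsLeftDescent u i then (LaurentPolynomial.T (-1) - LaurentPolynomial.T 1 : ℤ[T;T⁻¹])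
        else 0) * cs.stdCoord u h := by
  set q : ℤ[T;T⁻¹] := if cs.IsLeftDescent u i then
    (LaurentPolynomial.T (-1) - LaurentPolynomial.T 1 : ℤ[T;T⁻¹]) else 0 with hq
  have key : (cs.stdCoord u).comp (LinearMap.mulLeft ℤ[T;T⁻¹] (cs.heckeStd (cs.simple i))) =
      cs.stdCoord (cs.simple i * u) + q • cs.stdCoord u := by
    refine cs.heckeBasis.ext fun w => ?_
    rw [heckeBasis_apply]
    change cs.stdCoord u (cs.heckeStd (cs.simple i) * cs.heckeStd w) =
      cs.stdCoord (cs.simple i * u) (cs.heckeStd w) + q • cs.stdCoord u (cs.heckeStd w)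
    rw [heckeStd_simple_mul_heckeStd, map_add, map_smul, stdCoord_heckeStd, stdCoord_heckeStd,
      stdCoord_heckeStd]
    simp only [stdCoord_simple_mul_heckeStd_aux]
    congr 1
    by_cases hwu : w = u
    · rw [hwu, hq]
    · rw [if_neg hwu, smul_zero, smul_zero]
  exact DFunLike.congr_fun key h

/-- The elements of the Hecke algebra supported on group elements of length less than `n`. -/
def heckeFil (n : ℕ) : Submodule ℤ[T;T⁻¹] cs.Hecke where
  carrier := {h | ∀ u, n ≤ cs.length u → cs.stdCoord u h = 0}
  zero_mem' := fun u _ => map_zero _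
  add_mem' := fun {a b} ha hb u hu => by rw [map_add, ha u hu, hb u hu, add_zero]
  smul_mem' := fun c a ha u hu => by rw [map_smul, ha u hu, smul_zero]

theorem heckeFil_mono {m n : ℕ} (h : m ≤ n) : cs.heckeFil m ≤ cs.heckeFil n :=
  fun _ hx u hu => hx u (h.trans hu)

theorem heckeStd_mem_heckeFil {n : ℕ} {w : W} (h : cs.length w < n) :
    cs.heckeStd w ∈ cs.heckeFil n := by
  classical
  intro u hu
  rw [stdCoord_heckeStd, if_neg]
  rintro rfl
  omega

theorem heckeFil_le {n : ℕ} {N : Submodule ℤ[T;T⁻¹] cs.Hecke}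
    (h : ∀ u, cs.length u < n → cs.heckeStd u ∈ N) : cs.heckeFil n ≤ N := by
  intro x hx
  refine cs.hecke_induction fun u hu => h u ?_
  by_contra! hc
  exact hu (hx u hc)

theorem heckeFil_zero {h : cs.Hecke} (hh : h ∈ cs.heckeFil 0) : h = 0 :=
  cs.hecke_ext fun u => by rw [hh u (Nat.zero_le _), map_zero]

theorem exists_mem_heckeFil (h : cs.Hecke) : ∃ n, h ∈ cs.heckeFil n := by
  refine ⟨((cs.heckeBasis.repr h).support.sup cs.length) + 1, fun u hu => ?_⟩
  by_contra hne
  have := Finset.le_sup (s := (cs.heckeBasis.repr h).support) (f := cs.length) (b := u)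
      (Finsupp.mem_support_iff.2 hne)
  omega

theorem heckeStd_simple_mul_mem_heckeFil (i : B) {n : ℕ} {h : cs.Hecke} (hh : h ∈ cs.heckeFil n) :
    cs.heckeStd (cs.simple i) * h ∈ cs.heckeFil (n + 1) := by
  classical
  intro u hu
  have h1 := cs.length_simple_mul u i
  rw [stdCoord_simple_mul, hh _ (by omega), hh _ (by omega), mul_zero, add_zero]

theorem heckeStd_mul_mem_heckeFil (w : W) {n : ℕ} {h : cs.Hecke} (hh : h ∈ cs.heckeFil n) :
    cs.heckeStd w * h ∈ cs.heckeFil (n + cs.length w) := by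
  induction hn : cs.length w generalizing w with
  | zero => rw [cs.length_eq_zero_iff.1 hn, heckeStd_one, one_mul]; exact hh
  | succ m ih =>
    have h1 : w ≠ 1 := by rintro rfl; simp at hn
    obtain ⟨i, hi⟩ := cs.exists_leftDescent_of_ne_one h1
    rw [isLeftDescent_iff] at hi
    rw [← cs.simple_mul_simple_cancel_left (w := w) i, ← heckeStd_mul, mul_assoc]
    · exact cs.heckeStd_simple_mul_mem_heckeFil i (ih _ (by omega))
    · rw [simple_mul_simple_cancel_left, length_simple]; omega

/-- The filtration index is a strict bound on length, whence the shift: lengths `≤ m` and `< n`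
multiply into lengths `< m + n`. -/
theorem mul_mem_heckeFil {m n : ℕ} {g h : cs.Hecke} (hg : g ∈ cs.heckeFil (m + 1))
    (hh : h ∈ cs.heckeFil n) : g * h ∈ cs.heckeFil (m + n) := by
  suffices cs.heckeFil (m + 1) ≤ (cs.heckeFil (m + n)).comap (LinearMap.mulRight ℤ[T;T⁻¹] h) from
    this hg
  refine cs.heckeFil_le fun u hu => ?_
  exact cs.heckeFil_mono (by omega) (cs.heckeStd_mul_mem_heckeFil u hh)

theorem heckeBar_smul (a : ℤ[T;T⁻¹]) (h : cs.Hecke) :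
    cs.heckeBar (a • h) = LaurentPolynomial.invert a • cs.heckeBar h := by
  rw [Algebra.smul_def, map_mul, heckeBar_algebraMap, ← Algebra.smul_def]

theorem heckeBar_heckeStd_simple (i : B) : cs.heckeBar (cs.heckeStd (cs.simple i)) =
    cs.heckeStd (cs.simple i) + algebraMap ℤ[T;T⁻¹] cs.Hecke (LaurentPolynomial.T 1) -
        algebraMap ℤ[T;T⁻¹] cs.Hecke (LaurentPolynomial.T (-1)) := by
  have hu := cs.heckeStd_simple_mul i
  rw [heckeBar_heckeStd, inv_simple]
  exact Ring.inverse_unit (⟨_, _, hu.1, hu.2⟩ : cs.Heckeˣ)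

/-- The Kazhdan–Lusztig generator `b_s = δ_s + v`. -/
noncomputable def klGen (i : B) : cs.Hecke :=
  cs.heckeStd (cs.simple i) + algebraMap ℤ[T;T⁻¹] cs.Hecke (LaurentPolynomial.T 1)

theorem heckeBar_klGen (i : B) : cs.heckeBar (cs.klGen i) = cs.klGen i := by
  rw [klGen, map_add, heckeBar_heckeStd_simple, heckeBar_algebraMap, LaurentPolynomial.invert_T]
  abel

theorem klGen_mul (i : B) (h : cs.Hecke) : cs.klGen i * h =
    cs.heckeStd (cs.simple i) * h + (LaurentPolynomial.T 1 : ℤ[T;T⁻¹]) • h := by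
  rw [klGen, add_mul, ← Algebra.smul_def]

theorem klGen_mul_self (i : B) : cs.klGen i * cs.klGen i =
    (LaurentPolynomial.T 1 + LaurentPolynomial.T (-1) : ℤ[T;T⁻¹]) • cs.klGen i := by
  rw [klGen_mul]
  nth_rw 1 [klGen]
  have e : (LaurentPolynomial.T (-1) * LaurentPolynomial.T 1 : ℤ[T;T⁻¹]) = 1 := by
    rw [← LaurentPolynomial.T_add]; simp
  rw [mul_add, heckeStd_simple_sq, ← Algebra.commutes, ← Algebra.smul_def, klGen]
  simp only [Algebra.algebraMap_eq_smul_one, smul_add, add_smul, add_mul, sub_smul, smul_smul, e, one_smul]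
  abel

/-- Bar is unitriangular: in `δ_w = δ_s δ_{sw}`, bar adds `v - v⁻¹` to `δ_s`, and this correction
multiplies only terms of length below `ℓ(w)`. -/
theorem heckeBar_heckeStd_sub_mem (w : W) :
    cs.heckeBar (cs.heckeStd w) - cs.heckeStd w ∈ cs.heckeFil (cs.length w) := by
  induction hn : cs.length w generalizing w with
  | zero =>
    rw [cs.length_eq_zero_iff.1 hn, heckeStd_one, map_one, sub_self]
    exact Submodule.zero_mem _
  | succ m ih =>
    have h1 : w ≠ 1 := by rintro rfl; simp at hn
    obtain ⟨i, hi⟩ := cs.exists_leftDescent_of_ne_one h1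
    rw [isLeftDescent_iff] at hi
    have hm : cs.length (cs.simple i * w) = m := by omega
    have e : cs.heckeStd w = cs.heckeStd (cs.simple i) * cs.heckeStd (cs.simple i * w) := by
      rw [heckeStd_mul, simple_mul_simple_cancel_left]
      rw [simple_mul_simple_cancel_left, length_simple]; omega
    have ih' := ih _ hm
    set x := cs.heckeStd (cs.simple i * w) with hx
    have hxm : x ∈ cs.heckeFil (m + 1) := cs.heckeStd_mem_heckeFil (by omega)
    have hbx : cs.heckeBar x ∈ cs.heckeFil (m + 1) := by
      rw [← sub_add_cancel (cs.heckeBar x) x]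
      exact Submodule.add_mem _ (cs.heckeFil_mono (by omega) ih') hxm
    rw [e, map_mul, heckeBar_heckeStd_simple, sub_mul, add_mul, ← Algebra.smul_def,
      ← Algebra.smul_def]
    have : cs.heckeStd (cs.simple i) * cs.heckeBar x +
        (LaurentPolynomial.T 1 : ℤ[T;T⁻¹]) • cs.heckeBar x -
        (LaurentPolynomial.T (-1) : ℤ[T;T⁻¹]) • cs.heckeBar x - cs.heckeStd (cs.simple i) * x =
        cs.heckeStd (cs.simple i) * (cs.heckeBar x - x) +
        ((LaurentPolynomial.T 1 : ℤ[T;T⁻¹]) • cs.heckeBar x -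
        (LaurentPolynomial.T (-1) : ℤ[T;T⁻¹]) • cs.heckeBar x) := by
      rw [mul_sub]; abel
    rw [this]
    exact Submodule.add_mem _ (cs.heckeStd_simple_mul_mem_heckeFil i ih')
      (Submodule.sub_mem _ (Submodule.smul_mem _ _ hbx) (Submodule.smul_mem _ _ hbx))

/-- By unitriangularity, bar acts on coordinates of top length through `v ↦ v⁻¹` alone. A
bar-invariant element can thus be killed layer by layer. -/
theorem stdCoord_heckeBar {n : ℕ} {h : cs.Hecke} (hh : h ∈ cs.heckeFil (n + 1)) {u : W}
    (hu : cs.length u = n) :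
    cs.stdCoord u (cs.heckeBar h) = LaurentPolynomial.invert (cs.stdCoord u h) := by
  classical
  have key : ∀ w, cs.stdCoord w h ≠ 0 →
      cs.stdCoord u (cs.heckeBar (cs.heckeStd w)) = cs.stdCoord u (cs.heckeStd w) := by
    intro w hw
    have hl : cs.length w < n + 1 := by
      by_contra! hc
      exact hw (hh w hc)
    rw [← sub_eq_zero, ← map_sub]
    exact cs.heckeBar_heckeStd_sub_mem w u (by omega)
  have e := cs.heckeBasis.linearCombination_repr h
  rw [Finsupp.linearCombination_apply, Finsupp.sum] at e
  conv_lhs => rw [← e]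
  conv_rhs => rw [← e]
  rw [map_sum, map_sum, map_sum, map_sum]
  refine Finset.sum_congr rfl fun w hw => ?_
  rw [heckeBasis_apply, heckeBar_smul, map_smul, map_smul, key w (Finsupp.mem_support_iff.1 hw),
    stdCoord_heckeStd, smul_eq_mul, smul_eq_mul, map_mul]
  split_ifs <;> simp

/-- A bar-invariant element all of whose coordinates lie in `v ℤ[v]` vanishes. -/
theorem eq_zero_of_heckeBar_eq {h : cs.Hecke} (hb : cs.heckeBar h = h)
    (hc : ∀ u, cs.stdCoord u h ∈ orderGE 1) : h = 0 := by
  obtain ⟨n, hn⟩ := cs.exists_mem_heckeFil h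
  induction n with
  | zero => exact cs.heckeFil_zero hn
  | succ n ih =>
    refine ih fun u hu => ?_
    rcases hu.eq_or_lt with h1 | h1
    · have := cs.stdCoord_heckeBar hn h1.symm
      rw [hb] at this
      exact LaurentPolynomial.eq_zero_of_invert_eq (hc u) this.symm
    · exact hn u h1

end Bar

end CoxeterSystem

namespace CoxeterSystem

open LaurentPolynomial (orderGE)

/-! ### The Kazhdan–Lusztig basis and its multiplication formula -/

section KL

variable {B W : Type*} [Group W] {M : CoxeterMatrix B} (cs : CoxeterSystem M W)

theorem bruhatLT.length_lt {cs : CoxeterSystem M W} {y x : W} (h : cs.bruhatLT y x) :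
    cs.length y < cs.length x := by
  induction h with
  | single h => obtain ⟨t, -, -, h⟩ := h; exact h
  | tail _ h ih => obtain ⟨t, -, -, h⟩ := h; exact ih.trans h

theorem bruhatLT.trans {cs : CoxeterSystem M W} {x y z : W} (h : cs.bruhatLT x y)
    (h' : cs.bruhatLT y z) : cs.bruhatLT x z := Relation.TransGen.trans h h'

theorem bruhatLT_simple_mul {z : W} {i : B} (h : cs.length z < cs.length (cs.simple i * z)) :
    cs.bruhatLT z (cs.simple i * z) :=
  .single ⟨z⁻¹ * cs.simple i * z⁻¹⁻¹, (cs.isReflection_simple i).conj z⁻¹, by simp [mul_assoc], h⟩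

/-- Multiplying a chain by `s_i` preserves each step except possibly a step `a < s_i a`. There the
rest of the original chain, followed by `z < s_i z`, is used instead. -/
theorem bruhatLT.simple_mul {cs : CoxeterSystem M W} {y z : W} {i : B} (h : cs.bruhatLT y z)
    (hz : cs.length z < cs.length (cs.simple i * z)) :
    cs.bruhatLT (cs.simple i * y) (cs.simple i * z) := by
  have step : ∀ a b, (∃ t, cs.IsReflection t ∧ b = a * t ∧ cs.length a < cs.length b) →
      cs.simple i * a = b ∨ cs.bruhatLT (cs.simple i * a) (cs.simple i * b) := by
    rintro a b ⟨t, ht, rfl, hl⟩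
    rcases cs.eq_or_length_lt_of_reflection ht hl i with h | h
    · exact Or.inl h
    · exact Or.inr (.single ⟨t, ht, by rw [mul_assoc], h⟩)
  unfold bruhatLT at h
  induction h using Relation.TransGen.head_induction_on with
  | single h =>
    rcases step _ _ h with h | h
    · rw [h]; exact cs.bruhatLT_simple_mul hz
    · exact h
  | head h h' ih =>
    rcases step _ _ h with h | h
    · rw [h]; exact bruhatLT.trans h' (cs.bruhatLT_simple_mul hz)
    · exact h.trans ih

theorem bruhatLT.inv {cs : CoxeterSystem M W} {y z : W} (h : cs.bruhatLT y z) :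
    cs.bruhatLT y⁻¹ z⁻¹ := by
  unfold bruhatLT at h ⊢
  refine h.lift (·⁻¹) ?_
  rintro a _ ⟨t, ht, rfl, hl⟩
  refine ⟨a * t * a⁻¹, ht.conj a, by simp [ht.inv, mul_assoc], ?_⟩
  rwa [length_inv, length_inv]

theorem isKLElement_iff {x : W} {c : cs.Hecke} : cs.IsKLElement x c ↔
    cs.heckeBar c = c ∧ cs.stdCoord x c = 1 ∧
      ∀ y, y ≠ x → cs.stdCoord y c ∈ orderGE 1 ∧ (cs.stdCoord y c ≠ 0 → cs.bruhatLT y x) := by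
  classical
  have hsum : ∀ (p : W →₀ ℤ[X]) (y : W), cs.stdCoord y
      (p.sum fun y q => (Polynomial.toLaurent (Polynomial.X * q)) • cs.heckeStd y) =
      Polynomial.toLaurent (Polynomial.X * p y) := by
    intro p y
    rw [Finsupp.sum, map_sum]
    simp only [map_smul, stdCoord_heckeStd, smul_eq_mul, mul_ite, mul_one, mul_zero]
    rw [Finset.sum_ite_eq']
    split_ifs with h
    · rfl
    · rw [Finsupp.notMem_support_iff.1 h, mul_zero, map_zero]
  refine and_congr_right fun _ => ?_
  constructor
  · rintro ⟨p, hp, rfl⟩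
    simp only [map_add, hsum, stdCoord_heckeStd]
    constructor
    · have : p x = 0 := by
        by_contra h
        exact lt_irrefl _ (hp x h).length_lt
      rw [this]
      simp
    · intro y hy
      rw [if_neg (Ne.symm hy), zero_add]
      refine ⟨LaurentPolynomial.mem_orderGE_one_iff.2 ⟨_, rfl⟩, fun h => hp y ?_⟩
      intro h0
      rw [h0, mul_zero, map_zero] at h
      exact h rfl
  · rintro ⟨h1, h2⟩
    have hq : ∀ y, ∃ q : ℤ[X], y ≠ x →
        cs.stdCoord y c = Polynomial.toLaurent (Polynomial.X * q) := by
      intro y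
      by_cases hy : y = x
      · exact ⟨0, fun h => absurd hy h⟩
      · obtain ⟨q, hq⟩ := LaurentPolynomial.mem_orderGE_one_iff.1 (h2 y hy).1
        exact ⟨q, fun _ => hq⟩
    choose q hq using hq
    -- The chosen polynomials are cut off where `c` has no coordinate, for finite support, and at
    -- `x`, whose coefficient `1` is the separate leading term.
    let p : W →₀ ℤ[X] := Finsupp.onFinset ((cs.heckeBasis.repr c).support)
      (fun y => if y = x ∨ cs.stdCoord y c = 0 then 0 else q y) (by
        intro y hy
        simp only [ne_eq, ite_eq_left_iff, not_or, not_forall] at hy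
        obtain ⟨⟨_, h⟩, _⟩ := hy
        exact Finsupp.mem_support_iff.2 h)
    have hp : ∀ y, p y = if y = x ∨ cs.stdCoord y c = 0 then 0 else q y := fun y => rfl
    refine ⟨p, ?_, ?_⟩
    · intro y hy
      rw [hp] at hy
      simp only [ne_eq, ite_eq_left_iff, not_or, not_forall] at hy
      obtain ⟨⟨h3, h4⟩, _⟩ := hy
      exact (h2 y h3).2 h4
    · refine cs.hecke_ext fun y => ?_
      rw [map_add, hsum, stdCoord_heckeStd, hp]
      by_cases hy : y = x
      · subst hy
        simp [h1]
      · rw [if_neg (Ne.symm hy), zero_add]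
        by_cases h0 : cs.stdCoord y c = 0
        · simp [h0]
        · rw [if_neg (by tauto), hq y hy]

theorem IsKLElement.unique {cs : CoxeterSystem M W} {x : W} {c c' : cs.Hecke}
    (h : cs.IsKLElement x c) (h' : cs.IsKLElement x c') : c = c' := by
  rw [isKLElement_iff] at h h'
  rw [← sub_eq_zero]
  refine cs.eq_zero_of_heckeBar_eq (by rw [map_sub, h.1, h'.1]) fun u => ?_
  rw [map_sub]
  by_cases hu : u = x
  · rw [hu, h.2.1, h'.2.1, sub_self]; exact AddSubgroup.zero_mem _
  · exact AddSubgroup.sub_mem _ (h.2.2 u hu).1 (h'.2.2 u hu).1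

open Classical in
theorem stdCoord_klGen_mul (i : B) (u : W) (h : cs.Hecke) :
    cs.stdCoord u (cs.klGen i * h) = cs.stdCoord (cs.simple i * u) h +
      LaurentPolynomial.T (if cs.IsLeftDescent u i then (-1) else 1) * cs.stdCoord u h := by
  rw [klGen_mul, map_add, map_smul, stdCoord_simple_mul, smul_eq_mul]
  split_ifs <;> ring

/-- The coordinate of `b_s c` at `u` is `c_{su} + v^{±1} c_u`, with exponent `-1` exactly when `su <
u`. Away from `u = s z` a constant term can arise only in that case, and it is then the
`v`-coefficient of `c_u`. -/
theorem IsKLElement.stdCoord_klGen_mul_spec {cs : CoxeterSystem M W} {z : W} {c : cs.Hecke} {i : B}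
    (hc : cs.IsKLElement z c) (hz : ¬ cs.IsLeftDescent z i) :
    cs.stdCoord (cs.simple i * z) (cs.klGen i * c) = 1 ∧ ∀ u, u ≠ cs.simple i * z →
      cs.stdCoord u (cs.klGen i * c) ∈ orderGE 0 ∧
      (¬ cs.IsLeftDescent u i → cs.stdCoord u (cs.klGen i * c) ∈ orderGE 1) ∧
      (cs.IsLeftDescent u i →
        (cs.stdCoord u (cs.klGen i * c)).coeff 0 = (cs.stdCoord u c).coeff 1) ∧
      (cs.stdCoord u (cs.klGen i * c) ≠ 0 → cs.bruhatLT u (cs.simple i * z)) := by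
  classical
  obtain ⟨-, h1, h2⟩ := cs.isKLElement_iff.1 hc
  have hzl := cs.not_isLeftDescent_iff.1 hz
  have hlt : cs.length z < cs.length (cs.simple i * z) := by omega
  constructor
  · rw [stdCoord_klGen_mul, simple_mul_simple_cancel_left, h1]
    have : cs.stdCoord (cs.simple i * z) c = 0 := by
      by_contra h
      have hne : cs.simple i * z ≠ z := by
        intro h; rw [h] at hlt; exact lt_irrefl _ hlt
      have := ((h2 _ hne).2 h).length_lt
      omega
    rw [this, mul_zero, add_zero]
  · intro u hu
    have hu' : cs.simple i * u ≠ z := by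
      rintro rfl
      exact hu (by rw [simple_mul_simple_cancel_left])
    have h3 := h2 _ hu'
    rw [stdCoord_klGen_mul]
    have h4 : cs.stdCoord u c ∈ orderGE 0 := by
      by_cases huz : u = z
      · rw [huz, h1]; exact LaurentPolynomial.one_mem_orderGE
      · exact LaurentPolynomial.orderGE_mono (by norm_num) (h2 u huz).1
    have hnd : ¬ cs.IsLeftDescent u i →
        cs.stdCoord (cs.simple i * u) c + LaurentPolynomial.T
          (if cs.IsLeftDescent u i then (-1) else 1) * cs.stdCoord u c ∈ orderGE 1 := by
      intro hd
      rw [if_neg hd]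
      exact AddSubgroup.add_mem _ h3.1 (LaurentPolynomial.T_mul_mem_orderGE (n := 1) h4)
    refine ⟨?_, hnd, ?_, ?_⟩
    · by_cases hd : cs.IsLeftDescent u i
      · have huz : u ≠ z := by rintro rfl; exact hz hd
        rw [if_pos hd]
        exact AddSubgroup.add_mem _ (LaurentPolynomial.orderGE_mono (by norm_num) h3.1)
          (by simpa using LaurentPolynomial.T_mul_mem_orderGE (n := -1) (h2 u huz).1)
      · exact LaurentPolynomial.orderGE_mono (by norm_num) (hnd hd)
    · intro hd
      rw [if_pos hd, AddMonoidAlgebra.coeff_add, Finsupp.add_apply, h3.1 0 (by norm_num),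
        LaurentPolynomial.coeff_T_mul, zero_add]
      norm_num
    · intro hne
      by_cases h0 : cs.stdCoord (cs.simple i * u) c = 0
      · have h5 : cs.stdCoord u c ≠ 0 := by
          intro h5
          rw [h0, h5, mul_zero, add_zero] at hne
          exact hne rfl
        by_cases huz : u = z
        · rw [huz]; exact cs.bruhatLT_simple_mul hlt
        · exact ((h2 u huz).2 h5).trans (cs.bruhatLT_simple_mul hlt)
      · have := (h3.2 h0).simple_mul hlt
        rwa [simple_mul_simple_cancel_left] at this

/-- The set of `u ≠ s z` such that the coefficient of `δ_u` in `b_s c` has a constant term. -/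
noncomputable def muSupport (i : B) (z : W) (c : cs.Hecke) : Finset W :=
  open Classical in
  (cs.heckeBasis.repr (cs.klGen i * c)).support.filter fun u =>
    u ≠ cs.simple i * z ∧ (cs.stdCoord u (cs.klGen i * c)).coeff 0 ≠ 0

theorem mem_muSupport {i : B} {z u : W} {c : cs.Hecke} : u ∈ cs.muSupport i z c ↔
    u ≠ cs.simple i * z ∧ (cs.stdCoord u (cs.klGen i * c)).coeff 0 ≠ 0 := by
  classical
  rw [muSupport, Finset.mem_filter, Finsupp.mem_support_iff]
  refine ⟨fun h => h.2, fun h => ⟨?_, h⟩⟩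
  intro h0
  change cs.stdCoord u _ = 0 at h0
  rw [h0] at h
  exact h.2 rfl

theorem IsKLElement.mem_muSupport_spec {cs : CoxeterSystem M W} {z u : W} {c : cs.Hecke} {i : B}
    (hc : cs.IsKLElement z c) (hz : ¬ cs.IsLeftDescent z i) (hu : u ∈ cs.muSupport i z c) :
    cs.IsLeftDescent u i ∧ cs.bruhatLT u (cs.simple i * z) ∧ (cs.stdCoord u c).coeff 1 ≠ 0 := by
  rw [mem_muSupport] at hu
  obtain ⟨-, h0, h1, h2, h3⟩ := (hc.stdCoord_klGen_mul_spec hz).imp_right fun h => h u hu.1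
  have hd : cs.IsLeftDescent u i := by
    by_contra hd
    exact hu.2 (h1 hd 0 (by norm_num))
  refine ⟨hd, h3 ?_, by rw [← h2 hd]; exact hu.2⟩
  intro h
  rw [h] at hu
  exact hu.2 rfl

/-- The inductive construction of Kazhdan–Lusztig elements. -/
theorem IsKLElement.step {cs : CoxeterSystem M W} {z : W} {c : cs.Hecke} {i : B}
    (hc : cs.IsKLElement z c) (hz : ¬ cs.IsLeftDescent z i) {b : W → cs.Hecke}
    (hb : ∀ u, cs.bruhatLT u (cs.simple i * z) → cs.IsKLElement u (b u)) :
    cs.IsKLElement (cs.simple i * z) (cs.klGen i * c - ∑ u ∈ cs.muSupport i z c,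
      (((cs.stdCoord u (cs.klGen i * c)).coeff 0 : ℤ) : ℤ[T;T⁻¹]) • b u) := by
  classical
  have hspec := hc.stdCoord_klGen_mul_spec hz
  have hS := fun u (hu : u ∈ cs.muSupport i z c) => hc.mem_muSupport_spec hz hu
  have hb' := fun u (hu : u ∈ cs.muSupport i z c) => cs.isKLElement_iff.1 (hb u (hS u hu).2.1)
  set w := cs.simple i * z with hw
  set g := cs.klGen i * c with hg
  rw [isKLElement_iff]
  refine ⟨?_, ?_, ?_⟩
  · rw [map_sub, map_sum, hg, map_mul, heckeBar_klGen, hc.1, ← hg]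
    congr 1
    refine Finset.sum_congr rfl fun u hu => ?_
    rw [heckeBar_smul, (hb' u hu).1, map_intCast]
  · rw [map_sub, map_sum, hspec.1, Finset.sum_eq_zero, sub_zero]
    intro u hu
    have hl := (hS u hu).2.1.length_lt
    have h0 : cs.stdCoord w (b u) = 0 := by
      by_contra h
      have := (((hb' u hu).2.2 w (by rintro h; rw [h] at hl; exact lt_irrefl _ hl)).2 h).length_lt
      omega
    rw [map_smul, h0, smul_zero]
  · intro y hy
    obtain ⟨g0, g1, g2, g3⟩ := hspec.2 y hy
    rw [map_sub, map_sum]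
    have hterm : ∀ u ∈ cs.muSupport i z c, u ≠ y → cs.stdCoord y
        ((((cs.stdCoord u g).coeff 0 : ℤ) : ℤ[T;T⁻¹]) • b u) ∈ orderGE 1 := by
      intro u hu huy
      rw [map_smul, smul_eq_mul, ← zsmul_eq_mul]
      exact AddSubgroup.zsmul_mem _ ((hb' u hu).2.2 y (Ne.symm huy)).1 _
    constructor
    -- The summand for `b_y` itself cancels the constant term at `y`; every other `b_u` contributes
    -- an element of `v ℤ[v]` there.
    · by_cases hyS : y ∈ cs.muSupport i z c
      · rw [← Finset.add_sum_erase _ _ hyS, ← sub_sub]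
        refine AddSubgroup.sub_mem _ ?_ (AddSubgroup.sum_mem _ fun u hu =>
          hterm u (Finset.mem_of_mem_erase hu) (Finset.ne_of_mem_erase hu))
        rw [map_smul, (hb' y hyS).2.1, smul_eq_mul, mul_one]
        exact LaurentPolynomial.sub_coeff_zero_mem_orderGE g0
      · refine AddSubgroup.sub_mem _ ?_ (AddSubgroup.sum_mem _ fun u hu =>
          hterm u hu (by rintro rfl; exact hyS hu))
        have : (cs.stdCoord y g).coeff 0 = 0 := by
          by_contra h
          exact hyS (cs.mem_muSupport.2 ⟨hy, h⟩)
        have h2 := LaurentPolynomial.sub_coeff_zero_mem_orderGE g0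
        rwa [this, Int.cast_zero, sub_zero] at h2
    · intro hne
      by_cases hgy : cs.stdCoord y g = 0
      · rw [hgy, zero_sub, neg_ne_zero] at hne
        obtain ⟨u, hu, h⟩ := Finset.exists_ne_zero_of_sum_ne_zero hne
        have h4 : cs.stdCoord y (b u) ≠ 0 := by
          intro h0
          rw [map_smul, h0, smul_zero] at h
          exact h rfl
        by_cases hyu : y = u
        · rw [hyu]; exact (hS u hu).2.1
        · exact (((hb' u hu).2.2 y hyu).2 h4).trans (hS u hu).2.1
      · exact g3 hgy

theorem isKLElement_one : cs.IsKLElement 1 1 := by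
  classical
  rw [isKLElement_iff, map_one, ← heckeStd_one]
  refine ⟨rfl, by simp [stdCoord_heckeStd], fun y hy => ?_⟩
  rw [stdCoord_heckeStd, if_neg (Ne.symm hy)]
  exact ⟨AddSubgroup.zero_mem _, fun h => absurd rfl h⟩

theorem exists_isKLElement (w : W) : ∃ c, cs.IsKLElement w c := by
  induction hn : cs.length w using Nat.strong_induction_on generalizing w with
  | _ n ih =>
    by_cases h1 : w = 1
    · subst h1; exact ⟨1, cs.isKLElement_one⟩
    · obtain ⟨i, hi⟩ := cs.exists_leftDescent_of_ne_one h1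
      have hi' := cs.isLeftDescent_iff_not_isLeftDescent_mul.1 hi
      rw [isLeftDescent_iff] at hi
      obtain ⟨c, hc⟩ := ih _ (by omega) (cs.simple i * w) rfl
      have hb : ∀ u, ∃ b, cs.bruhatLT u w → cs.IsKLElement u b := by
        intro u
        by_cases hu : cs.bruhatLT u w
        · obtain ⟨b, hb⟩ := ih _ (by have := hu.length_lt; omega) u rfl
          exact ⟨b, fun _ => hb⟩
        · exact ⟨0, fun h => absurd h hu⟩
      choose b hb using hb
      have := hc.step hi' (b := b) (by simpa using hb)
      rw [simple_mul_simple_cancel_left] at this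
      exact ⟨_, this⟩

theorem isKLElement_klBasis (w : W) : cs.IsKLElement w (cs.klBasis w) :=
  Classical.epsilon_spec (cs.exists_isKLElement w)

theorem klBasis_eq {w : W} {c : cs.Hecke} (h : cs.IsKLElement w c) : cs.klBasis w = c :=
  (cs.isKLElement_klBasis w).unique h

theorem klBasis_one : cs.klBasis 1 = 1 := cs.klBasis_eq cs.isKLElement_one

theorem stdCoord_klBasis_self (w : W) : cs.stdCoord w (cs.klBasis w) = 1 :=
  (cs.isKLElement_iff.1 (cs.isKLElement_klBasis w)).2.1

theorem stdCoord_klBasis_mem {y w : W} (h : y ≠ w) : cs.stdCoord y (cs.klBasis w) ∈ orderGE 1 :=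
  ((cs.isKLElement_iff.1 (cs.isKLElement_klBasis w)).2.2 y h).1

theorem bruhatLT_of_stdCoord_klBasis_ne_zero {y w : W} (h : y ≠ w)
    (h' : cs.stdCoord y (cs.klBasis w) ≠ 0) : cs.bruhatLT y w :=
  ((cs.isKLElement_iff.1 (cs.isKLElement_klBasis w)).2.2 y h).2 h'

theorem stdCoord_klBasis_eq_zero {y w : W} (h : y ≠ w) (h' : cs.length w ≤ cs.length y) :
    cs.stdCoord y (cs.klBasis w) = 0 := by
  by_contra hne
  have := (cs.bruhatLT_of_stdCoord_klBasis_ne_zero h hne).length_lt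
  omega

theorem klBasis_sub_heckeStd_mem (w : W) :
    cs.klBasis w - cs.heckeStd w ∈ cs.heckeFil (cs.length w) := by
  classical
  intro u hu
  rw [map_sub, stdCoord_heckeStd]
  by_cases h : w = u
  · rw [if_pos h, ← h, stdCoord_klBasis_self, sub_self]
  · rw [if_neg h, cs.stdCoord_klBasis_eq_zero (Ne.symm h) hu, sub_zero]

/-- The multiplication formula `b_s b_z = b_{sz} + ∑ μ(u, z) b_u` for `s z > z`. -/
theorem exists_klGen_mul_klBasis {i : B} {z : W} (hz : ¬ cs.IsLeftDescent z i) :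
    ∃ (S : Finset W) (μ : W → ℤ), cs.klGen i * cs.klBasis z =
      cs.klBasis (cs.simple i * z) + ∑ u ∈ S, (μ u : ℤ[T;T⁻¹]) • cs.klBasis u ∧
      ∀ u ∈ S, cs.IsLeftDescent u i ∧ cs.bruhatLT u (cs.simple i * z) ∧
        (cs.stdCoord u (cs.klBasis z)).coeff 1 ≠ 0 := by
  refine ⟨cs.muSupport i z (cs.klBasis z),
    fun u => (cs.stdCoord u (cs.klGen i * cs.klBasis z)).coeff 0, ?_,
    fun u hu => (cs.isKLElement_klBasis z).mem_muSupport_spec hz hu⟩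
  rw [cs.klBasis_eq ((cs.isKLElement_klBasis z).step hz fun u _ => cs.isKLElement_klBasis u),
    sub_add_cancel]

/-- By the multiplication formula `b_z` is `b_s b_{sz}` minus a combination of shorter `b_u` with
left descent `s`. Then `b_s² = (v + v⁻¹) b_s` handles the first term and induction the others. -/
theorem klGen_mul_klBasis_of_isLeftDescent {i : B} {z : W} (hz : cs.IsLeftDescent z i) :
    cs.klGen i * cs.klBasis z =
      (LaurentPolynomial.T 1 + LaurentPolynomial.T (-1) : ℤ[T;T⁻¹]) • cs.klBasis z := by
  induction hn : cs.length z using Nat.strong_induction_on generalizing z with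
  | _ n ih =>
    have hz' := cs.isLeftDescent_iff_not_isLeftDescent_mul.1 hz
    obtain ⟨S, μ, he, hS⟩ := cs.exists_klGen_mul_klBasis hz'
    rw [simple_mul_simple_cancel_left] at he hS
    rw [← sub_eq_iff_eq_add] at he
    rw [← he, mul_sub, ← mul_assoc, klGen_mul_self, smul_mul_assoc, Finset.mul_sum, smul_sub,
      Finset.smul_sum]
    congr 1
    refine Finset.sum_congr rfl fun u hu => ?_
    obtain ⟨h1, h2, -⟩ := hS u hu
    rw [mul_smul_comm, ih _ (by have := h2.length_lt; omega) h1 rfl, smul_comm]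

theorem heckeStd_simple_mul_klBasis {i : B} {z : W} (hz : cs.IsLeftDescent z i) :
    cs.heckeStd (cs.simple i) * cs.klBasis z =
      (LaurentPolynomial.T (-1) : ℤ[T;T⁻¹]) • cs.klBasis z := by
  have h := cs.klGen_mul_klBasis_of_isLeftDescent hz
  rw [klGen_mul, add_smul, add_comm] at h
  exact add_left_cancel h

/-- If `μ(u, z) ≠ 0` and `t` is a left descent of `z` but not of `u`, then `z = t u`. -/
theorem eq_simple_mul_of_coeff_ne_zero {u z : W} {t : B}
    (h : (cs.stdCoord u (cs.klBasis z)).coeff 1 ≠ 0) (hz : cs.IsLeftDescent z t)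
    (hu : ¬ cs.IsLeftDescent u t) : cs.simple t * u = z := by
  classical
  by_contra hne
  -- The coordinate at `u` of `δ_t b_z = v⁻¹ b_z` says that the coefficient of `b_z` at `t u` is
  -- `v⁻¹` times that at `u`. If `t u ≠ z` the former lies in `v ℤ[v]`, so the `v`-coefficient at
  -- `u` vanishes.
  have h1 := congrArg (cs.stdCoord u) (cs.heckeStd_simple_mul_klBasis hz)
  rw [stdCoord_simple_mul, if_neg hu, zero_mul, add_zero, map_smul, smul_eq_mul] at h1
  have h2 := congrArg (fun a : ℤ[T;T⁻¹] => a.coeff 0) h1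
  simp only [LaurentPolynomial.coeff_T_mul] at h2
  rw [cs.stdCoord_klBasis_mem hne 0 (by norm_num)] at h2
  exact h h2.symm

theorem klBasis_simple (i : B) : cs.klBasis (cs.simple i) = cs.klGen i := by
  obtain ⟨S, μ, he, hS⟩ := cs.exists_klGen_mul_klBasis (cs.not_isLeftDescent_one i)
  rw [mul_one, klBasis_one, mul_one] at he
  rw [he, left_eq_add]
  refine Finset.sum_eq_zero fun u hu => ?_
  obtain ⟨h1, h2, h3⟩ := hS u hu
  have hu1 : u = 1 := by
    rw [← cs.length_eq_zero_iff]
    have := h2.length_lt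
    simp at this
    rw [this]; simp
  subst hu1
  exact absurd h1 (cs.not_isLeftDescent_one i)

theorem linearIndependent_klBasis : LinearIndependent ℤ[T;T⁻¹] cs.klBasis := by
  rw [linearIndependent_iff]
  intro l hl
  by_contra hne
  obtain ⟨u, hu, hmax⟩ := Finset.exists_max_image l.support cs.length
    (Finsupp.support_nonempty_iff.2 hne)
  have h := congrArg (cs.stdCoord u) hl
  rw [Finsupp.linearCombination_apply, Finsupp.sum, map_sum, map_zero,
    Finset.sum_eq_single_of_mem u hu, map_smul, stdCoord_klBasis_self, smul_eq_mul, mul_one] at h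
  · exact Finsupp.mem_support_iff.1 hu h
  · intro w hw hwu
    rw [map_smul, cs.stdCoord_klBasis_eq_zero hwu.symm (hmax w hw), smul_zero]

theorem heckeFil_le_span_klBasis (n : ℕ) :
    cs.heckeFil n ≤ Submodule.span ℤ[T;T⁻¹] (cs.klBasis '' {u | cs.length u < n}) := by
  induction n with
  | zero => intro h hh; rw [cs.heckeFil_zero hh]; exact Submodule.zero_mem _
  | succ n ih =>
    refine cs.heckeFil_le fun u hu => ?_
    rw [← sub_sub_cancel (cs.klBasis u) (cs.heckeStd u)]
    refine Submodule.sub_mem _ (Submodule.subset_span ⟨u, hu, rfl⟩) ?_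
    refine Submodule.span_mono (Set.image_mono fun w (hw : cs.length w < n) => ?_)
      (ih (cs.heckeFil_mono (by omega) (cs.klBasis_sub_heckeStd_mem u)))
    exact hw.trans (Nat.lt_succ_self n)

/-- The Kazhdan–Lusztig basis. -/
noncomputable def klB : Module.Basis W ℤ[T;T⁻¹] cs.Hecke :=
  Module.Basis.mk cs.linearIndependent_klBasis fun h _ => by
    obtain ⟨n, hn⟩ := cs.exists_mem_heckeFil h
    exact Submodule.span_mono (Set.image_subset_range _ _) (cs.heckeFil_le_span_klBasis n hn)

@[simp]
theorem klB_apply (w : W) : cs.klB w = cs.klBasis w := by simp [klB]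

@[simp]
theorem klB_repr_klBasis (w : W) : cs.klB.repr (cs.klBasis w) = Finsupp.single w 1 := by
  rw [← klB_apply, Module.Basis.repr_self]

/-- The coordinates in the basis `klB` satisfy the defining property, and linear independence makes
them the only choice. -/
theorem klCoeff_eq (x y : W) :
    cs.klCoeff x y = cs.klB.repr (cs.klBasis x * cs.klBasis y) := by
  have h : cs.klBasis x * cs.klBasis y = (cs.klCoeff x y).sum fun z a => a • cs.klBasis z := by
    refine Classical.epsilon_spec (p := fun h : W →₀ ℤ[T;T⁻¹] =>
      cs.klBasis x * cs.klBasis y = h.sum fun z a => a • cs.klBasis z)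
      ⟨cs.klB.repr (cs.klBasis x * cs.klBasis y), ?_⟩
    conv_lhs => rw [← cs.klB.linearCombination_repr (cs.klBasis x * cs.klBasis y)]
    rw [Finsupp.linearCombination_apply]
    simp only [klB_apply]
  rw [h]
  have e := cs.klB.repr_linearCombination (cs.klCoeff x y)
  rw [Finsupp.linearCombination_apply] at e
  simp only [klB_apply] at e
  exact e.symm

theorem klB_repr_eq_zero {n : ℕ} {h : cs.Hecke} (hh : h ∈ cs.heckeFil n) {z : W}
    (hz : n ≤ cs.length z) : cs.klB.repr h z = 0 := by
  have h1 := cs.heckeFil_le_span_klBasis n hh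
  have e : cs.klBasis = cs.klB := funext fun w => (cs.klB_apply w).symm
  rw [e, Module.Basis.mem_span_image] at h1
  by_contra hne
  have := h1 (Finsupp.mem_support_iff.2 hne)
  simp only [Set.mem_ofPred_eq] at this
  omega

end KL

end CoxeterSystem

namespace CoxeterSystem

open LaurentPolynomial (orderGE)

/-! ### The anti-involution exchanging left and right -/

section Anti

variable {B W : Type*} [Group W] {M : CoxeterMatrix B} (cs : CoxeterSystem M W)

open MulOpposite in
theorem heckeAntiOp_rel ⦃a b : FreeAlgebra ℤ[T;T⁻¹] W⦄ (h : HeckeRel cs a b) :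
    FreeAlgebra.lift ℤ[T;T⁻¹] (fun w : W => op (cs.heckeStd w⁻¹)) a =
      FreeAlgebra.lift ℤ[T;T⁻¹] (fun w : W => op (cs.heckeStd w⁻¹)) b := by
  cases h with
  | one => rw [FreeAlgebra.lift_ι_apply, map_one, inv_one, heckeStd_one, op_one]
  | mul x y h =>
    rw [map_mul, FreeAlgebra.lift_ι_apply, FreeAlgebra.lift_ι_apply, FreeAlgebra.lift_ι_apply,
      ← op_mul, heckeStd_mul, mul_inv_rev]
    rw [← mul_inv_rev, length_inv, length_inv, length_inv, h, add_comm]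
  | quadratic s =>
    rw [map_mul, map_sub, map_add, map_zero, FreeAlgebra.lift_ι_apply, AlgHom.commutes,
      AlgHom.commutes, inv_simple]
    apply unop_injective
    have h := cs.heckeStd_quadratic s
    have c : Commute (cs.heckeStd (cs.simple s) -
        algebraMap ℤ[T;T⁻¹] cs.Hecke (LaurentPolynomial.T (-1)))
        (cs.heckeStd (cs.simple s) + algebraMap ℤ[T;T⁻¹] cs.Hecke (LaurentPolynomial.T 1)) :=
      Commute.sub_left
        (Commute.add_right (Commute.refl _) (Algebra.commute_algebraMap_right _ _))
        (Algebra.commute_algebraMap_left _ _)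
    exact c.symm.eq.trans h

/-- The anti-involution `δ_w ↦ δ_{w⁻¹}`, as a homomorphism to the opposite algebra. -/
noncomputable def heckeAntiOp : cs.Hecke →ₐ[ℤ[T;T⁻¹]] cs.Heckeᵐᵒᵖ :=
  RingQuot.liftAlgHom ℤ[T;T⁻¹] ⟨FreeAlgebra.lift ℤ[T;T⁻¹]
    (fun w : W => MulOpposite.op (cs.heckeStd w⁻¹)), cs.heckeAntiOp_rel⟩

/-- The anti-involution `δ_w ↦ δ_{w⁻¹}`. -/
noncomputable def heckeAnti : cs.Hecke →ₗ[ℤ[T;T⁻¹]] cs.Hecke :=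
  ((MulOpposite.opLinearEquiv ℤ[T;T⁻¹]).symm.toLinearMap).comp cs.heckeAntiOp.toLinearMap

theorem heckeAnti_mul (x y : cs.Hecke) :
    cs.heckeAnti (x * y) = cs.heckeAnti y * cs.heckeAnti x := by
  change MulOpposite.unop (cs.heckeAntiOp (x * y)) = _
  rw [map_mul, MulOpposite.unop_mul]
  rfl

theorem heckeAnti_heckeStd (w : W) : cs.heckeAnti (cs.heckeStd w) = cs.heckeStd w⁻¹ := by
  have h := RingQuot.liftAlgHom_mkAlgHom_apply ℤ[T;T⁻¹]
    (FreeAlgebra.lift ℤ[T;T⁻¹] (fun w : W => MulOpposite.op (cs.heckeStd w⁻¹)))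
    cs.heckeAntiOp_rel (FreeAlgebra.ι ℤ[T;T⁻¹] w)
  rw [FreeAlgebra.lift_ι_apply] at h
  exact congrArg MulOpposite.unop h

theorem heckeAnti_one : cs.heckeAnti 1 = 1 := by
  rw [← heckeStd_one, heckeAnti_heckeStd, inv_one]

theorem heckeAnti_heckeAnti (h : cs.Hecke) : cs.heckeAnti (cs.heckeAnti h) = h := by
  have : cs.heckeAnti.comp cs.heckeAnti = LinearMap.id :=
    cs.heckeBasis.ext fun w => by simp [heckeAnti_heckeStd]
  exact DFunLike.congr_fun this h

theorem stdCoord_heckeAnti (u : W) (h : cs.Hecke) :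
    cs.stdCoord u (cs.heckeAnti h) = cs.stdCoord u⁻¹ h := by
  classical
  have : (cs.stdCoord u).comp cs.heckeAnti = cs.stdCoord u⁻¹ := by
    refine cs.heckeBasis.ext fun w => ?_
    rw [heckeBasis_apply, LinearMap.comp_apply, heckeAnti_heckeStd, stdCoord_heckeStd,
      stdCoord_heckeStd]
    simp only [inv_eq_iff_eq_inv]
  exact DFunLike.congr_fun this h

theorem heckeAnti_heckeBar (h : cs.Hecke) :
    cs.heckeAnti (cs.heckeBar h) = cs.heckeBar (cs.heckeAnti h) := by
  have key : ∀ w, cs.heckeAnti (cs.heckeBar (cs.heckeStd w)) =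
      cs.heckeBar (cs.heckeAnti (cs.heckeStd w)) := by
    intro w
    rw [heckeAnti_heckeStd, heckeBar_heckeStd, heckeBar_heckeStd, inv_inv]
    have h1 := cs.isUnit_heckeStd w⁻¹
    have h2 := cs.isUnit_heckeStd w
    have h3 := congrArg cs.heckeAnti (Ring.mul_inverse_cancel _ h1)
    rw [heckeAnti_mul, heckeAnti_one, heckeAnti_heckeStd, inv_inv] at h3
    calc _ = cs.heckeAnti (Ring.inverse (cs.heckeStd w⁻¹)) *
          (cs.heckeStd w * Ring.inverse (cs.heckeStd w)) := by
          rw [Ring.mul_inverse_cancel _ h2, mul_one]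
      _ = _ := by rw [← mul_assoc, h3, one_mul]
  rw [← cs.heckeBasis.linearCombination_repr h, Finsupp.linearCombination_apply, Finsupp.sum]
  simp only [map_sum, heckeBar_smul, map_smul, heckeBasis_apply, key]

/-- The anti-involution commutes with bar, and inversion preserves the Bruhat order, so uniqueness
of Kazhdan–Lusztig elements applies. -/
theorem heckeAnti_klBasis (w : W) : cs.heckeAnti (cs.klBasis w) = cs.klBasis w⁻¹ := by
  refine (cs.klBasis_eq ?_).symm
  obtain ⟨h1, h2, h3⟩ := cs.isKLElement_iff.1 (cs.isKLElement_klBasis w)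
  rw [isKLElement_iff]
  refine ⟨by rw [← heckeAnti_heckeBar, h1], by rw [stdCoord_heckeAnti, inv_inv, h2], ?_⟩
  intro y hy
  rw [stdCoord_heckeAnti]
  obtain ⟨h4, h5⟩ := h3 y⁻¹ (fun h => hy (by rw [← h, inv_inv]))
  exact ⟨h4, fun h => by simpa using (h5 h).inv⟩

theorem klB_repr_heckeAnti (z : W) (h : cs.Hecke) :
    cs.klB.repr (cs.heckeAnti h) z = cs.klB.repr h z⁻¹ := by
  have : (cs.klB.coord z).comp cs.heckeAnti = cs.klB.coord z⁻¹ := by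
    classical
    refine cs.klB.ext fun w => ?_
    rw [klB_apply, LinearMap.comp_apply, heckeAnti_klBasis, Module.Basis.coord_apply,
      Module.Basis.coord_apply, klB_repr_klBasis, klB_repr_klBasis, Finsupp.single_apply,
      Finsupp.single_apply]
    simp only [inv_eq_iff_eq_inv]
  exact DFunLike.congr_fun this h

theorem klBasis_mul_heckeStd_simple {i : B} {z : W} (hz : cs.IsRightDescent z i) :
    cs.klBasis z * cs.heckeStd (cs.simple i) =
      (LaurentPolynomial.T (-1) : ℤ[T;T⁻¹]) • cs.klBasis z := by
  rw [← isLeftDescent_inv_iff] at hz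
  have h := congrArg cs.heckeAnti (cs.heckeStd_simple_mul_klBasis hz)
  rwa [heckeAnti_mul, map_smul, heckeAnti_klBasis, heckeAnti_heckeStd, inv_inv, inv_simple] at h

end Anti

/-! ### Elements with a unique reduced expression have `a`-value one -/

section Ideal

variable {B W : Type*} [Group W] {M : CoxeterMatrix B} (cs : CoxeterSystem M W)

/-- The span of the `b_z` where `z` has several reduced expressions. -/
noncomputable def nonUniqueIdeal : Submodule ℤ[T;T⁻¹] cs.Hecke where
  carrier := {h | ∀ z, cs.HasUniqueReducedWord z → cs.klB.repr h z = 0}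
  zero_mem' := fun z _ => by simp
  add_mem' := fun {a b} ha hb z hz => by
    rw [map_add, Finsupp.add_apply, ha z hz, hb z hz, add_zero]
  smul_mem' := fun c a ha z hz => by rw [map_smul, Finsupp.smul_apply, ha z hz, smul_zero]

theorem klBasis_mem_nonUniqueIdeal {z : W} (hz : ¬ cs.HasUniqueReducedWord z) :
    cs.klBasis z ∈ cs.nonUniqueIdeal := by
  classical
  intro u hu
  rw [klB_repr_klBasis, Finsupp.single_apply, if_neg]
  rintro rfl
  exact hz hu

theorem sum_klB_repr (h : cs.Hecke) :
    h = ∑ z ∈ (cs.klB.repr h).support, cs.klB.repr h z • cs.klBasis z := by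
  conv_lhs => rw [← cs.klB.linearCombination_repr h, Finsupp.linearCombination_apply, Finsupp.sum]
  simp only [klB_apply]

/-- Suppose `b_u` with `u` of unique expression occurs in `b_i b_z`, `i` no descent of `z`. The only
left descent of `u` is `i`, so a left descent `t` of `z` is none of `u` and `z = t u`. But then `i`
remains a left descent of `t u`, which has several expressions: a contradiction. -/
theorem klGen_mul_klBasis_mem_nonUniqueIdeal (i : B) {z : W} (hz : ¬ cs.HasUniqueReducedWord z) :
    cs.klGen i * cs.klBasis z ∈ cs.nonUniqueIdeal := by
  by_cases hd : cs.IsLeftDescent z i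
  · rw [cs.klGen_mul_klBasis_of_isLeftDescent hd]
    exact Submodule.smul_mem _ _ (cs.klBasis_mem_nonUniqueIdeal hz)
  · obtain ⟨S, μ, he, hS⟩ := cs.exists_klGen_mul_klBasis hd
    rw [he]
    refine Submodule.add_mem _ (cs.klBasis_mem_nonUniqueIdeal fun h => ?_)
      (Submodule.sum_mem _ fun u hu => Submodule.smul_mem _ _
        (cs.klBasis_mem_nonUniqueIdeal fun hun => ?_))
    · have := h.simple_mul (s := i) (by
        rw [isLeftDescent_iff_not_isLeftDescent_mul, simple_mul_simple_cancel_left]; exact hd)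
      rw [simple_mul_simple_cancel_left] at this
      exact hz this
    · obtain ⟨h1, h2, h3⟩ := hS u hu
      have hz1 : z ≠ 1 := by rintro rfl; exact hz cs.hasUniqueReducedWord_one
      obtain ⟨t, ht⟩ := cs.exists_leftDescent_of_ne_one hz1
      have htu : ¬ cs.IsLeftDescent u t := by
        intro h
        rw [hun.eq_of_isLeftDescent h h1] at ht
        exact hd ht
      have hzt := cs.eq_simple_mul_of_coeff_ne_zero h3 ht htu
      rw [← hzt] at hz hd
      exact hd (hun.isLeftDescent_simple_mul h1 htu hz)

theorem klGen_mul_mem_nonUniqueIdeal (i : B) {h : cs.Hecke} (hh : h ∈ cs.nonUniqueIdeal) :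
    cs.klGen i * h ∈ cs.nonUniqueIdeal := by
  rw [cs.sum_klB_repr h, Finset.mul_sum]
  refine Submodule.sum_mem _ fun z hz => ?_
  rw [mul_smul_comm]
  exact Submodule.smul_mem _ _ (cs.klGen_mul_klBasis_mem_nonUniqueIdeal i fun hu =>
    Finsupp.mem_support_iff.1 hz (hh z hu))

theorem mul_mem_nonUniqueIdeal_left (g : cs.Hecke) {h : cs.Hecke} (hh : h ∈ cs.nonUniqueIdeal) :
    g * h ∈ cs.nonUniqueIdeal := by
  refine cs.mul_mem_of_simple (fun i x hx => ?_) g hh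
  have h1 := cs.klGen_mul_mem_nonUniqueIdeal i hx
  rw [klGen_mul] at h1
  simpa using Submodule.sub_mem _ h1 (Submodule.smul_mem _ (LaurentPolynomial.T 1 : ℤ[T;T⁻¹]) hx)

theorem heckeAnti_mem_nonUniqueIdeal {h : cs.Hecke} (hh : h ∈ cs.nonUniqueIdeal) :
    cs.heckeAnti h ∈ cs.nonUniqueIdeal := fun z hz => by
  rw [klB_repr_heckeAnti]; exact hh _ hz.inv

theorem mul_mem_nonUniqueIdeal_right {g : cs.Hecke} (hg : g ∈ cs.nonUniqueIdeal) (h : cs.Hecke) :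
    g * h ∈ cs.nonUniqueIdeal := by
  rw [← cs.heckeAnti_heckeAnti (g * h), heckeAnti_mul]
  exact cs.heckeAnti_mem_nonUniqueIdeal
    (cs.mul_mem_nonUniqueIdeal_left _ (cs.heckeAnti_mem_nonUniqueIdeal hg))

/-- The elements that are, modulo `nonUniqueIdeal`, `ℤ l`-linear combinations of basis elements
`b_z` such that `t` is a left descent of `z`. -/
noncomputable def intLattice (l : ℤ[T;T⁻¹]) (t : B) : AddSubgroup cs.Hecke where
  carrier := {h | ∀ z, cs.HasUniqueReducedWord z → ∃ n : ℤ, cs.klB.repr h z = n • l ∧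
    (n ≠ 0 → cs.IsLeftDescent z t)}
  zero_mem' := fun z _ => ⟨0, by simp⟩
  add_mem' := fun {a b} ha hb z hz => by
    obtain ⟨m, h1, h2⟩ := ha z hz
    obtain ⟨n, h3, h4⟩ := hb z hz
    refine ⟨m + n, by rw [map_add, Finsupp.add_apply, h1, h3, add_smul], fun h => ?_⟩
    by_cases hm : m = 0
    · exact h4 (by rintro rfl; simp [hm] at h)
    · exact h2 hm
  neg_mem' := fun {a} ha z hz => by
    obtain ⟨m, h1, h2⟩ := ha z hz
    exact ⟨-m, by rw [map_neg, Finsupp.neg_apply, h1, neg_smul], fun h => h2 (neg_ne_zero.1 h)⟩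

theorem mem_intLattice_of_mem_nonUniqueIdeal {l : ℤ[T;T⁻¹]} {t : B} {h : cs.Hecke}
    (hh : h ∈ cs.nonUniqueIdeal) : h ∈ cs.intLattice l t :=
  fun z hz => ⟨0, by rw [hh z hz, zero_smul], fun h => absurd rfl h⟩

theorem smul_klBasis_mem_intLattice {l : ℤ[T;T⁻¹]} {t : B} {z : W} (hz : cs.IsLeftDescent z t) :
    l • cs.klBasis z ∈ cs.intLattice l t := by
  classical
  intro u _
  rw [map_smul, klB_repr_klBasis, Finsupp.smul_apply, Finsupp.single_apply]
  by_cases h : z = u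
  · exact ⟨1, by rw [if_pos h]; simp, fun _ => h ▸ hz⟩
  · exact ⟨0, by rw [if_neg h]; simp, fun h => absurd rfl h⟩

theorem smul_klGen_mul_klBasis_mem_intLattice {l : ℤ[T;T⁻¹]} {t : B} {z : W}
    (hz : ¬ cs.IsLeftDescent z t) : l • (cs.klGen t * cs.klBasis z) ∈ cs.intLattice l t := by
  obtain ⟨S, μ, he, hS⟩ := cs.exists_klGen_mul_klBasis hz
  rw [he, smul_add, Finset.smul_sum]
  refine AddSubgroup.add_mem _ (cs.smul_klBasis_mem_intLattice ?_)
    (AddSubgroup.sum_mem _ fun u hu => ?_)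
  · rw [isLeftDescent_iff_not_isLeftDescent_mul, simple_mul_simple_cancel_left]; exact hz
  · rw [smul_comm, Int.cast_smul_eq_zsmul]
    exact AddSubgroup.zsmul_mem _ (cs.smul_klBasis_mem_intLattice (hS u hu).1) _

/-- Modulo the ideal only elements with the single left descent `t'` are present. Since `t ≠ t'`,
multiplication by `b_t` goes up and produces integer coefficients, never `v + v⁻¹`. -/
theorem klGen_mul_mem_intLattice {l : ℤ[T;T⁻¹]} {t t' : B} (htt : t ≠ t') {h : cs.Hecke}
    (hh : h ∈ cs.intLattice l t') : cs.klGen t * h ∈ cs.intLattice l t := by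
  rw [cs.sum_klB_repr h, Finset.mul_sum]
  refine AddSubgroup.sum_mem _ fun z _ => ?_
  rw [mul_smul_comm]
  by_cases hz : cs.HasUniqueReducedWord z
  · obtain ⟨n, h1, h2⟩ := hh z hz
    rw [h1, smul_assoc]
    by_cases hn : n = 0
    · rw [hn, zero_smul]; exact AddSubgroup.zero_mem _
    · refine AddSubgroup.zsmul_mem _ (cs.smul_klGen_mul_klBasis_mem_intLattice fun hd => ?_) _
      exact htt (hz.eq_of_isLeftDescent hd (h2 hn))
  · exact cs.mem_intLattice_of_mem_nonUniqueIdeal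
      (Submodule.smul_mem _ _ (cs.klGen_mul_klBasis_mem_nonUniqueIdeal t hz))

theorem HasUniqueReducedWord.eq_of_isRightDescent {cs : CoxeterSystem M W} {z : W}
    (h : cs.HasUniqueReducedWord z) {s t : B}
    (hs : cs.IsRightDescent z s) (ht : cs.IsRightDescent z t) : s = t :=
  h.inv.eq_of_isLeftDescent (cs.isLeftDescent_inv_iff.2 hs) (cs.isLeftDescent_inv_iff.2 ht)

theorem IsRightDescent.of_simple_mul {cs : CoxeterSystem M W} {x : W} {t r : B}
    (ht : cs.IsLeftDescent x t) (h : cs.IsRightDescent (cs.simple t * x) r) :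
    cs.IsRightDescent x r := by
  rw [isLeftDescent_iff] at ht
  rw [isRightDescent_iff, mul_assoc] at h
  have := cs.length_simple_mul (x * cs.simple r) t
  rw [IsRightDescent]
  omega

-- Induction on `x`, peeling off its first letter. The last letter `r` alone may meet a left descent
-- of `y` and yield `v + v⁻¹`; each further letter differs from the preceding one, so
-- `klGen_mul_mem_intLattice` applies.
open Classical in
theorem klBasis_mul_klBasis_mem_intLattice {x y : W} {t r : B} (hx : cs.HasUniqueReducedWord x)
    (ht : cs.IsLeftDescent x t) (hr : cs.IsRightDescent x r) :
    cs.klBasis x * cs.klBasis y ∈ cs.intLattice (if cs.IsLeftDescent y r then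
      LaurentPolynomial.T 1 + LaurentPolynomial.T (-1) else 1) t := by
  induction hn : cs.length x using Nat.strong_induction_on generalizing x t with
  | _ n ih =>
    set l : ℤ[T;T⁻¹] := if cs.IsLeftDescent y r then
      LaurentPolynomial.T 1 + LaurentPolynomial.T (-1) else 1 with hl
    have hx' := hx.simple_mul ht
    have ht' := cs.isLeftDescent_iff_not_isLeftDescent_mul.1 ht
    have hlen := cs.isLeftDescent_iff.1 ht
    by_cases h1 : cs.simple t * x = 1
    · have hxt : x = cs.simple t := by
        rw [← cs.simple_mul_simple_cancel_left (w := x) t, h1, mul_one]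
      have htr : t = r := by
        refine hx.eq_of_isRightDescent ?_ hr
        rw [hxt, IsRightDescent]
        simp
      subst htr
      rw [hxt, klBasis_simple]
      by_cases hy : cs.IsLeftDescent y t
      · rw [cs.klGen_mul_klBasis_of_isLeftDescent hy, hl, if_pos hy]
        exact cs.smul_klBasis_mem_intLattice hy
      · rw [hl, if_neg hy]
        simpa using cs.smul_klGen_mul_klBasis_mem_intLattice (l := 1) hy
    · obtain ⟨t', htx⟩ := cs.exists_leftDescent_of_ne_one h1
      have htt : t ≠ t' := by rintro rfl; exact ht' htx
      have hright : ∀ w, w ≠ 1 → (∀ q, cs.IsRightDescent w q → cs.IsRightDescent x q) →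
          cs.IsRightDescent w r := by
        intro w hw hq
        obtain ⟨q, hq'⟩ := cs.exists_rightDescent_of_ne_one hw
        rwa [hx.eq_of_isRightDescent hr (hq q hq')]
      have hrx' := hright _ h1 (fun q hq => IsRightDescent.of_simple_mul ht hq)
      have ih1 := ih _ (by omega) hx' htx hrx' rfl
      obtain ⟨S, μ, he, hS⟩ := cs.exists_klGen_mul_klBasis ht'
      rw [simple_mul_simple_cancel_left, ← sub_eq_iff_eq_add] at he
      rw [← he, sub_mul, mul_assoc, Finset.sum_mul]
      refine AddSubgroup.sub_mem _ (cs.klGen_mul_mem_intLattice htt ih1)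
        (AddSubgroup.sum_mem _ fun u hu => ?_)
      rw [smul_mul_assoc, Int.cast_smul_eq_zsmul]
      refine AddSubgroup.zsmul_mem _ ?_ _
      -- A correction term outside the ideal is `u = t' t x`: its only left descent is `t`, so `t'`
      -- is not one and `t x = t' u`. It is shorter than `x` and ends in the same letter, so
      -- induction applies.
      by_cases hun : cs.HasUniqueReducedWord u
      · obtain ⟨h2, -, h4⟩ := hS u hu
        have htu : ¬ cs.IsLeftDescent u t' := fun h => htt (hun.eq_of_isLeftDescent h2 h)
        have hxu := cs.eq_simple_mul_of_coeff_ne_zero h4 htx htu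
        have hu1 : u ≠ 1 := by
          rintro rfl
          exact cs.not_isLeftDescent_one t h2
        have hux : cs.simple t' * (cs.simple t * x) = u := by
          rw [← hxu, simple_mul_simple_cancel_left]
        have hlu := cs.isLeftDescent_iff.1 htx
        rw [hux] at hlu
        refine ih _ (by omega) hun h2 (hright u hu1 fun q hq => ?_) rfl
        refine IsRightDescent.of_simple_mul ht (IsRightDescent.of_simple_mul htx ?_)
        rwa [hux]
      · exact cs.mem_intLattice_of_mem_nonUniqueIdeal
          (cs.mul_mem_nonUniqueIdeal_right (cs.klBasis_mem_nonUniqueIdeal hun) _)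

theorem T_add_T_mem_orderGE :
    (LaurentPolynomial.T 1 + LaurentPolynomial.T (-1) : ℤ[T;T⁻¹]) ∈ orderGE (-1) := by
  intro i hi
  rw [AddMonoidAlgebra.coeff_add, Finsupp.add_apply, LaurentPolynomial.T_apply,
    LaurentPolynomial.T_apply, if_neg (by omega), if_neg (by omega), add_zero]

theorem klCoeff_mem_orderGE (x y : W) {z : W} (hz : cs.HasUniqueReducedWord z) :
    cs.klCoeff x y z ∈ orderGE (-1) := by
  classical
  rw [klCoeff_eq]
  by_cases hx1 : x = 1
  · rw [hx1, klBasis_one, one_mul, klB_repr_klBasis, Finsupp.single_apply]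
    split_ifs
    · exact LaurentPolynomial.orderGE_mono (by norm_num) LaurentPolynomial.one_mem_orderGE
    · exact AddSubgroup.zero_mem _
  by_cases hx : cs.HasUniqueReducedWord x
  · obtain ⟨t, ht⟩ := cs.exists_leftDescent_of_ne_one hx1
    obtain ⟨r, hr⟩ := cs.exists_rightDescent_of_ne_one hx1
    obtain ⟨n, h1, -⟩ := cs.klBasis_mul_klBasis_mem_intLattice (y := y) hx ht hr z hz
    rw [h1]
    refine AddSubgroup.zsmul_mem _ ?_ _
    split_ifs
    · exact T_add_T_mem_orderGE
    · exact LaurentPolynomial.orderGE_mono (by norm_num) LaurentPolynomial.one_mem_orderGE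
  · rw [cs.mul_mem_nonUniqueIdeal_right (cs.klBasis_mem_nonUniqueIdeal hx) _ z hz]
    exact AddSubgroup.zero_mem _

theorem aFunction_eq_one_of_hasUniqueReducedWord {z : W} (hz : cs.HasUniqueReducedWord z)
    (h1 : z ≠ 1) : cs.aFunction z = 1 := by
  classical
  apply le_antisymm
  · refine sInf_le ⟨1, by simp, fun x y => ?_⟩
    rw [← LaurentPolynomial.mem_orderGE_zero_iff]
    exact LaurentPolynomial.T_mul_mem_orderGE (n := 1) (cs.klCoeff_mem_orderGE x y hz)
  · refine le_sInf ?_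
    rintro k ⟨n, rfl, hn⟩
    rcases Nat.eq_zero_or_pos n with rfl | hpos
    · exfalso
      obtain ⟨i, hi⟩ := cs.exists_leftDescent_of_ne_one h1
      have h2 := hn (cs.simple i) z
      rw [← LaurentPolynomial.mem_orderGE_zero_iff, klCoeff_eq, klBasis_simple,
        cs.klGen_mul_klBasis_of_isLeftDescent hi, map_smul, klB_repr_klBasis,
        Finsupp.smul_apply, Finsupp.single_eq_same] at h2
      have h3 := h2 (-1) (by norm_num)
      simp at h3
    · exact_mod_cast hpos

end Ideal

end CoxeterSystem

namespace CoxeterSystem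

open LaurentPolynomial (orderGE)

/-! ### Elements with several reduced expressions have larger `a`-value -/

section Parabolic

variable {B W : Type*} [Group W] {M : CoxeterMatrix B} (cs : CoxeterSystem M W)

theorem mem_altWord {s t x : B} {k : ℕ} (h : x ∈ altWord s t k) : x = s ∨ x = t := by
  induction k generalizing s t with
  | zero => simp [altWord] at h
  | succ k ih =>
    rcases List.mem_cons.1 h with h | h
    · exact Or.inl h
    · exact (ih h).symm

/-- Otherwise the shorter alternating word has both descents `s` and `t`, so its length is at least
`m`. -/
theorem isReduced_altWord {s t : B} (hst : s ≠ t) (hM : M s t ≠ 0) {k : ℕ} (hk : k ≤ M s t) :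
    cs.IsReduced (altWord s t k) := by
  induction k generalizing s t with
  | zero => simp [IsReduced, altWord]
  | succ k ih =>
    have hsym := M.symmetric s t
    have h1 : cs.IsReduced (altWord t s k) := ih hst.symm (by rwa [← hsym]) (by omega)
    refine cs.isReduced_cons_iff.2 ⟨h1, fun hd => ?_⟩
    cases k with
    | zero => exact cs.not_isLeftDescent_one s (by simpa [altWord] using hd)
    | succ k =>
      obtain ⟨-, y, -, hl⟩ := cs.exists_altWord_of_isLeftDescent hst hd h1.isLeftDescent
      rw [h1.eq, length_altWord] at hl
      omega

theorem reverse_altWord {s t : B} (hst : s ≠ t) (hM : M s t ≠ 0) {k : ℕ} (hk : k ≤ M s t) :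
    (altWord s t k).reverse = altWord s t k ∨ (altWord s t k).reverse = altWord t s k := by
  -- A statement about words only; the Coxeter group of `M` serves to show that the reversed word
  -- has no equal neighbours.
  have hr := (M.toCoxeterSystem.isReduced_altWord hst hM hk).reverse.isChain
  have hm : ∀ x ∈ (altWord s t k).reverse, x = s ∨ x = t :=
    fun x hx => mem_altWord (List.mem_reverse.1 hx)
  have hl : ((altWord s t k).reverse).length = k := by simp
  generalize (altWord s t k).reverse = l at *
  cases l with
  | nil => subst hl; exact Or.inl rfl
  | cons a l =>
    rcases hm a (by simp) with rfl | rfl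
    · left
      rw [← hl]
      exact eq_altWord hm (List.isChain_cons_cons.2 ⟨hst.symm, hr⟩)
    · right
      rw [← hl]
      exact eq_altWord (fun x hx => (hm x hx).symm) (List.isChain_cons_cons.2 ⟨hst, hr⟩)

theorem inv_wordProd_altWord {s t : B} (hst : s ≠ t) (hM : M s t ≠ 0) :
    (cs.wordProd (altWord s t (M s t)))⁻¹ = cs.wordProd (altWord s t (M s t)) := by
  rw [← wordProd_reverse]
  rcases reverse_altWord hst hM le_rfl with h | h
  · rw [h]
  · rw [h, wordProd_altWord_braid]

theorem isLeftDescent_altWord {s t : B} (hst : s ≠ t) (hM : M s t ≠ 0) :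
    cs.IsLeftDescent (cs.wordProd (altWord s t (M s t))) s ∧
      cs.IsLeftDescent (cs.wordProd (altWord s t (M s t))) t := by
  obtain ⟨m, hm⟩ := Nat.exists_eq_succ_of_ne_zero hM
  have h1 := cs.isReduced_altWord hst hM le_rfl
  have h2 := cs.isReduced_altWord hst.symm (by rwa [M.symmetric]) (M.symmetric s t).le
  constructor
  · rw [hm] at h1 ⊢
    exact h1.isLeftDescent
  · rw [wordProd_altWord_braid]
    rw [hm] at h2 ⊢
    exact h2.isLeftDescent

theorem isLeftDescent_altWord_mul {s t : B} (hst : s ≠ t) (hM : M s t ≠ 0) {y : W}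
    (hl : cs.length (cs.wordProd (altWord s t (M s t)) * y) = M s t + cs.length y) :
    cs.IsLeftDescent (cs.wordProd (altWord s t (M s t)) * y) s ∧
      cs.IsLeftDescent (cs.wordProd (altWord s t (M s t)) * y) t := by
  obtain ⟨h1, h2⟩ := cs.isLeftDescent_altWord hst hM
  have hr := cs.isReduced_altWord hst hM le_rfl
  rw [IsLeftDescent, hr.eq, length_altWord] at h1 h2
  constructor
  · rw [IsLeftDescent, hl, ← mul_assoc]
    have := cs.length_mul_le (cs.simple s * cs.wordProd (altWord s t (M s t))) y
    omega
  · rw [IsLeftDescent, hl, ← mul_assoc]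
    have := cs.length_mul_le (cs.simple t * cs.wordProd (altWord s t (M s t))) y
    omega

theorem isRightDescent_mul_altWord {s t : B} (hst : s ≠ t) (hM : M s t ≠ 0) {x : W}
    (hl : cs.length (x * cs.wordProd (altWord s t (M s t))) = cs.length x + M s t) :
    cs.IsRightDescent (x * cs.wordProd (altWord s t (M s t))) s ∧
      cs.IsRightDescent (x * cs.wordProd (altWord s t (M s t))) t := by
  rw [← isLeftDescent_inv_iff, ← isLeftDescent_inv_iff, mul_inv_rev,
    cs.inv_wordProd_altWord hst hM]
  refine cs.isLeftDescent_altWord_mul hst hM ?_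
  rw [← cs.inv_wordProd_altWord hst hM, ← mul_inv_rev, length_inv, length_inv, hl, add_comm]

/-- The Kazhdan–Lusztig element of the longest element of a dihedral parabolic subgroup, up to
a unit. -/
noncomputable def dihedralElt (s t : B) : cs.Hecke :=
  ∑ k ∈ Finset.range (M s t), (LaurentPolynomial.T ((M s t : ℤ) - k - 1) : ℤ[T;T⁻¹]) •
    (cs.klGen s * cs.heckeStd (cs.wordProd (altWord t s k)))

theorem klGen_mul_heckeStd_altWord {s t : B} (hst : s ≠ t) (hM : M s t ≠ 0) {k : ℕ}
    (hk : k < M s t) : cs.klGen s * cs.heckeStd (cs.wordProd (altWord t s k)) =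
      cs.heckeStd (cs.wordProd (altWord s t (k + 1))) +
        (LaurentPolynomial.T 1 : ℤ[T;T⁻¹]) • cs.heckeStd (cs.wordProd (altWord t s k)) := by
  have h1 := cs.isReduced_altWord hst hM (show k + 1 ≤ M s t from hk)
  have h2 := cs.isReduced_cons_iff.1 h1
  rw [klGen_mul, heckeStd_mul, altWord, wordProd_cons]
  have h3 := cs.not_isLeftDescent_iff.1 h2.2
  rw [h3, length_simple, add_comm]

theorem dihedralElt_sub_mem {s t : B} (hst : s ≠ t) (hM : M s t ≠ 0) :
    cs.dihedralElt s t - cs.heckeStd (cs.wordProd (altWord s t (M s t))) ∈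
      cs.heckeFil (M s t) := by
  obtain ⟨m, hm⟩ := Nat.exists_eq_succ_of_ne_zero hM
  have hmem : ∀ (a b : B) (k : ℕ), k < M s t →
      cs.heckeStd (cs.wordProd (altWord a b k)) ∈ cs.heckeFil (M s t) := by
    intro a b k hk
    refine cs.heckeStd_mem_heckeFil ((cs.length_wordProd_le _).trans_lt ?_)
    rwa [length_altWord]
  have hmem' : ∀ k < m, cs.klGen s * cs.heckeStd (cs.wordProd (altWord t s k)) ∈
      cs.heckeFil (M s t) := by
    intro k hk
    rw [cs.klGen_mul_heckeStd_altWord hst hM (by omega)]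
    exact Submodule.add_mem _ (hmem _ _ _ (by omega))
      (Submodule.smul_mem _ _ (hmem _ _ _ (by omega)))
  have hlast := cs.klGen_mul_heckeStd_altWord hst hM (show m < M s t by omega)
  have e : cs.dihedralElt s t = ∑ k ∈ Finset.range m,
      (LaurentPolynomial.T ((M s t : ℤ) - k - 1) : ℤ[T;T⁻¹]) •
        (cs.klGen s * cs.heckeStd (cs.wordProd (altWord t s k))) +
      (cs.heckeStd (cs.wordProd (altWord s t (M s t))) +
        (LaurentPolynomial.T 1 : ℤ[T;T⁻¹]) • cs.heckeStd (cs.wordProd (altWord t s m))) := by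
    have e2 : m + 1 = M s t := hm.symm
    rw [dihedralElt]
    nth_rw 1 [hm]
    rw [Finset.sum_range_succ, hlast, e2]
    have : ((M s t : ℤ) - m - 1) = 0 := by omega
    rw [this, LaurentPolynomial.T_zero, one_smul]
  rw [e]
  have h : ∀ a b c : cs.Hecke, a + (b + c) - b = a + c := fun a b c => by abel
  rw [h]
  exact Submodule.add_mem _
    (Submodule.sum_mem _ fun k hk => Submodule.smul_mem _ _ (hmem' k (Finset.mem_range.1 hk)))
    (Submodule.smul_mem _ _ (hmem _ _ _ (by omega)))

/-- Both sums expand to `∑ v ^ (m - ℓ(u)) δ_u` over the dihedral group. They distribute lengths `0`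
and `m` differently between the two families of alternating words, which agree in these lengths. -/
theorem dihedralElt_comm {s t : B} (hst : s ≠ t) (hM : M s t ≠ 0) :
    cs.dihedralElt s t = cs.dihedralElt t s := by
  have hsym := M.symmetric s t
  have hM' : M t s ≠ 0 := by rwa [← hsym]
  set a : ℕ → cs.Hecke := fun k => (LaurentPolynomial.T ((M s t : ℤ) - k) : ℤ[T;T⁻¹]) •
    cs.heckeStd (cs.wordProd (altWord s t k)) with ha
  set b : ℕ → cs.Hecke := fun k => (LaurentPolynomial.T ((M s t : ℤ) - k) : ℤ[T;T⁻¹]) •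
    cs.heckeStd (cs.wordProd (altWord t s k)) with hb
  have e1 : cs.dihedralElt s t = ∑ k ∈ Finset.range (M s t), (a (k + 1) + b k) := by
    refine Finset.sum_congr rfl fun k hk => ?_
    rw [cs.klGen_mul_heckeStd_altWord hst hM (Finset.mem_range.1 hk), smul_add, smul_smul,
      ← LaurentPolynomial.T_add, sub_add_cancel]
    simp only [ha, hb]
    push_cast
    rw [sub_sub]
  have e2 : cs.dihedralElt t s = ∑ k ∈ Finset.range (M s t), (b (k + 1) + a k) := by
    rw [dihedralElt, ← hsym]
    refine Finset.sum_congr rfl fun k hk => ?_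
    rw [cs.klGen_mul_heckeStd_altWord hst.symm hM' (by rw [← hsym]; exact Finset.mem_range.1 hk),
      smul_add, smul_smul, ← LaurentPolynomial.T_add, sub_add_cancel]
    simp only [ha, hb]
    push_cast
    rw [sub_sub]
  rw [e1, e2, Finset.sum_add_distrib, Finset.sum_add_distrib]
  have h1 := Finset.sum_range_succ a (M s t)
  have h2 := Finset.sum_range_succ b (M s t)
  rw [Finset.sum_range_succ'] at h1 h2
  have h3 : a 0 = b 0 := rfl
  have h4 : a (M s t) = b (M s t) := by
    simp only [ha, hb]
    rw [wordProd_altWord_braid]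
  rw [h3, h4] at h1
  have h5 := congrArg₂ (· - ·) h1 h2
  simp only [add_sub_add_right_eq_sub] at h5
  rw [sub_eq_sub_iff_add_eq_add] at h5
  rw [h5, add_comm]

theorem heckeStd_simple_mul_klGen_mul (i : B) (h : cs.Hecke) :
    cs.heckeStd (cs.simple i) * (cs.klGen i * h) =
      (LaurentPolynomial.T (-1) : ℤ[T;T⁻¹]) • (cs.klGen i * h) := by
  have e := cs.klGen_mul i (cs.klGen i * h)
  rw [← mul_assoc, klGen_mul_self, smul_mul_assoc, add_smul, add_comm] at e
  exact (add_right_cancel e).symm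

theorem heckeStd_simple_mul_dihedralElt {s t : B} (hst : s ≠ t) (hM : M s t ≠ 0) :
    cs.heckeStd (cs.simple s) * cs.dihedralElt s t =
      (LaurentPolynomial.T (-1) : ℤ[T;T⁻¹]) • cs.dihedralElt s t ∧
    cs.heckeStd (cs.simple t) * cs.dihedralElt s t =
      (LaurentPolynomial.T (-1) : ℤ[T;T⁻¹]) • cs.dihedralElt s t := by
  have key : ∀ a b : B, cs.heckeStd (cs.simple a) * cs.dihedralElt a b =
      (LaurentPolynomial.T (-1) : ℤ[T;T⁻¹]) • cs.dihedralElt a b := by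
    intro a b
    rw [dihedralElt, Finset.mul_sum, Finset.smul_sum]
    refine Finset.sum_congr rfl fun k _ => ?_
    rw [mul_smul_comm, heckeStd_simple_mul_klGen_mul, smul_comm]
  exact ⟨key s t, by rw [cs.dihedralElt_comm hst hM]; exact key t s⟩

/-- An element with `δ_s d = v⁻¹ d` and `δ_t d = v⁻¹ d` is a right multiple of the dihedral
element. -/
theorem exists_eq_dihedralElt_mul {s t : B} (hst : s ≠ t) {n : ℕ} {d : cs.Hecke}
    (hd : d ∈ cs.heckeFil (M s t + n))
    (hs : cs.heckeStd (cs.simple s) * d = (LaurentPolynomial.T (-1) : ℤ[T;T⁻¹]) • d)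
    (ht : cs.heckeStd (cs.simple t) * d = (LaurentPolynomial.T (-1) : ℤ[T;T⁻¹]) • d)
    (hM : M s t ≠ 0) :
    ∃ h ∈ cs.heckeFil n, d = cs.dihedralElt s t * h := by
  classical
  -- If `i` were no descent of a top-length `u`, then `d` has no coordinate at the longer `s_i u`,
  -- and comparing coordinates of `δ_i d = v⁻¹ d` there kills the one at `u`.
  have hdesc : ∀ (N : ℕ) (d : cs.Hecke), d ∈ cs.heckeFil (N + 1) → ∀ i : B,
      cs.heckeStd (cs.simple i) * d = (LaurentPolynomial.T (-1) : ℤ[T;T⁻¹]) • d →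
      ∀ u, cs.length u = N → cs.stdCoord u d ≠ 0 → cs.IsLeftDescent u i := by
    intro N d hd i hi u hu hne
    by_contra hn
    have h1 := congrArg (cs.stdCoord (cs.simple i * u)) hi
    have h2 : cs.stdCoord (cs.simple i * u) d = 0 :=
      hd _ (by rw [cs.not_isLeftDescent_iff.1 hn, hu])
    rw [stdCoord_simple_mul, simple_mul_simple_cancel_left, map_smul, h2] at h1
    exact hne (by simpa using h1)
  -- The support bound `N` is decoupled from `n`: induction strips off the top layer of `d`, while
  -- the bound on the quotient `h` stays fixed.
  suffices H : ∀ N n : ℕ, ∀ d : cs.Hecke, d ∈ cs.heckeFil N → N ≤ M s t + n →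
      cs.heckeStd (cs.simple s) * d = (LaurentPolynomial.T (-1) : ℤ[T;T⁻¹]) • d →
      cs.heckeStd (cs.simple t) * d = (LaurentPolynomial.T (-1) : ℤ[T;T⁻¹]) • d →
      ∃ h ∈ cs.heckeFil n, d = cs.dihedralElt s t * h from H _ n d hd le_rfl hs ht
  intro N
  induction N with
  | zero =>
    intro n d hd _ _ _
    exact ⟨0, Submodule.zero_mem _, by rw [cs.heckeFil_zero hd, mul_zero]⟩
  | succ N ih =>
    intro n d hd hN hs ht
    set S := (cs.heckeBasis.repr d).support.filter fun u => cs.length u = N with hS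
    have hfac : ∀ u, ∃ y, u ∈ S → u = cs.wordProd (altWord s t (M s t)) * y ∧
        N = M s t + cs.length y := by
      intro u
      by_cases hu : u ∈ S
      · obtain ⟨hu1, hu2⟩ := Finset.mem_filter.1 hu
        have hne : cs.stdCoord u d ≠ 0 := Finsupp.mem_support_iff.1 hu1
        obtain ⟨-, y, hy, hl⟩ := cs.exists_altWord_of_isLeftDescent hst
          (hdesc N d hd s hs u hu2 hne) (hdesc N d hd t ht u hu2 hne)
        exact ⟨y, fun _ => ⟨hy, by omega⟩⟩
      · exact ⟨1, fun h => absurd h hu⟩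
    choose y hy using hfac
    -- Each top-length `u` starts with the longest dihedral element, `u = w y(u)`, so `dihedralElt s
    -- t * h0` has the same top layer as `d`.
    set h0 : cs.Hecke := ∑ u ∈ S, cs.stdCoord u d • cs.heckeStd (y u) with hh0
    have hh0mem : h0 ∈ cs.heckeFil n := Submodule.sum_mem _ fun u hu =>
      Submodule.smul_mem _ _ (cs.heckeStd_mem_heckeFil (by have := (hy u hu).2; omega))
    obtain ⟨hes, het⟩ := cs.heckeStd_simple_mul_dihedralElt hst hM
    obtain ⟨m, hm⟩ := Nat.exists_eq_succ_of_ne_zero hM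
    have hlead : ∀ u ∈ S, cs.dihedralElt s t * cs.heckeStd (y u) - cs.heckeStd u ∈
        cs.heckeFil N := by
      intro u hu
      obtain ⟨h1, h2⟩ := hy u hu
      have hlu : cs.length u = N := (Finset.mem_filter.1 hu).2
      have e : cs.heckeStd u = cs.heckeStd (cs.wordProd (altWord s t (M s t))) *
          cs.heckeStd (y u) := by
        rw [heckeStd_mul, ← h1]
        rw [← h1, (cs.isReduced_altWord hst hM le_rfl).eq, length_altWord, hlu, h2]
      rw [e, ← sub_mul]
      have h3 := cs.dihedralElt_sub_mem hst hM
      rw [hm] at h3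
      have h4 := cs.mul_mem_heckeFil (n := cs.length (y u) + 1) h3
        (cs.heckeStd_mem_heckeFil (Nat.lt_succ_self _))
      rw [← hm] at h4
      refine cs.heckeFil_mono ?_ h4
      omega
    have hsum : d - ∑ u ∈ S, cs.stdCoord u d • cs.heckeStd u ∈ cs.heckeFil N := by
      intro u hu
      rw [map_sub, map_sum]
      simp only [map_smul, stdCoord_heckeStd, smul_eq_mul, mul_ite, mul_one, mul_zero]
      rw [Finset.sum_ite_eq']
      split_ifs with huS
      · rw [sub_self]
      · rw [sub_zero]
        by_contra hne
        rcases hu.eq_or_lt with h | h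
        · exact huS (Finset.mem_filter.2 ⟨Finsupp.mem_support_iff.2 hne, h.symm⟩)
        · exact hne (hd u h)
    have hrest : d - cs.dihedralElt s t * h0 ∈ cs.heckeFil N := by
      have e : d - cs.dihedralElt s t * h0 = (d - ∑ u ∈ S, cs.stdCoord u d • cs.heckeStd u) -
          ∑ u ∈ S, cs.stdCoord u d • (cs.dihedralElt s t * cs.heckeStd (y u) -
            cs.heckeStd u) := by
        rw [hh0, Finset.mul_sum]
        simp only [smul_sub, Finset.sum_sub_distrib, mul_smul_comm]
        abel
      rw [e]
      exact Submodule.sub_mem _ hsum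
        (Submodule.sum_mem _ fun u hu => Submodule.smul_mem _ _ (hlead u hu))
    obtain ⟨h, hh, he⟩ := ih n _ hrest (by omega)
      (by rw [mul_sub, hs, ← mul_assoc, hes, smul_mul_assoc, smul_sub])
      (by rw [mul_sub, ht, ← mul_assoc, het, smul_mul_assoc, smul_sub])
    exact ⟨h + h0, Submodule.add_mem _ hh hh0mem, by rw [mul_add, ← he, sub_add_cancel]⟩

theorem mul_heckeStd_wordProd {c : cs.Hecke} {ω : List B} (hω : cs.IsReduced ω)
    (hc : ∀ i ∈ ω, c * cs.heckeStd (cs.simple i) = (LaurentPolynomial.T (-1) : ℤ[T;T⁻¹]) • c) :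
    c * cs.heckeStd (cs.wordProd ω) =
      (LaurentPolynomial.T (-(ω.length : ℤ)) : ℤ[T;T⁻¹]) • c := by
  induction ω with
  | nil => simp [heckeStd_one]
  | cons i ω ih =>
    have h := cs.isReduced_cons_iff.1 hω
    rw [wordProd_cons, ← heckeStd_mul, ← mul_assoc, hc i (by simp), smul_mul_assoc,
      ih h.1 (fun j hj => hc j (by simp [hj])), smul_smul, ← LaurentPolynomial.T_add]
    · congr 2
      rw [List.length_cons]
      push_cast
      ring
    · rw [cs.not_isLeftDescent_iff.1 h.2, length_simple, add_comm]

/-- On `c`, right multiplication by `b_s` is the scalar `v + v⁻¹` and by `δ_u` the scalar `v ^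
(-ℓ(u))`. The `k`-th summand becomes `v ^ (m - 2k) + v ^ (m - 2k - 2)`, so only `k = m - 1` reaches
`v ^ (-m)`. -/
theorem exists_mul_dihedralElt_eq {s t : B} (hst : s ≠ t) (hM : M s t ≠ 0) {c : cs.Hecke}
    (hs : c * cs.heckeStd (cs.simple s) = (LaurentPolynomial.T (-1) : ℤ[T;T⁻¹]) • c)
    (ht : c * cs.heckeStd (cs.simple t) = (LaurentPolynomial.T (-1) : ℤ[T;T⁻¹]) • c) :
    ∃ p : ℤ[T;T⁻¹], p.coeff (-(M s t : ℤ)) = 1 ∧ c * cs.dihedralElt s t = p • c := by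
  have hM' : M t s ≠ 0 := by rwa [M.symmetric t s]
  refine ⟨∑ k ∈ Finset.range (M s t), (LaurentPolynomial.T ((M s t : ℤ) - k - 1) *
    (LaurentPolynomial.T 1 + LaurentPolynomial.T (-1)) *
      LaurentPolynomial.T (-(k : ℤ)) : ℤ[T;T⁻¹]), ?_, ?_⟩
  · obtain ⟨m, hm⟩ := Nat.exists_eq_succ_of_ne_zero hM
    have e : ∀ k : ℕ, (LaurentPolynomial.T ((M s t : ℤ) - k - 1) *
        (LaurentPolynomial.T 1 + LaurentPolynomial.T (-1)) *
          LaurentPolynomial.T (-(k : ℤ)) : ℤ[T;T⁻¹]) =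
        LaurentPolynomial.T ((M s t : ℤ) - 2 * k) +
          LaurentPolynomial.T ((M s t : ℤ) - 2 * k - 2) := by
      intro k
      rw [mul_add, add_mul, ← LaurentPolynomial.T_add, ← LaurentPolynomial.T_add,
        ← LaurentPolynomial.T_add, ← LaurentPolynomial.T_add]
      congr 2 <;> ring
    simp only [e]
    rw [AddMonoidAlgebra.coeff_sum, Finset.sum_apply', hm, Finset.sum_range_succ,
      Finset.sum_eq_zero]
    · rw [AddMonoidAlgebra.coeff_add, Finsupp.add_apply, LaurentPolynomial.T_apply,
        LaurentPolynomial.T_apply, if_neg (by push_cast; omega), if_pos (by push_cast; omega)]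
      rfl
    · intro k hk
      have := Finset.mem_range.1 hk
      rw [AddMonoidAlgebra.coeff_add, Finsupp.add_apply, LaurentPolynomial.T_apply,
        LaurentPolynomial.T_apply, if_neg (by push_cast; omega), if_neg (by push_cast; omega)]
      rfl
  · have hgen : c * cs.klGen s = (LaurentPolynomial.T 1 + LaurentPolynomial.T (-1) : ℤ[T;T⁻¹]) • c := by
      rw [klGen, mul_add, hs, ← Algebra.commutes, ← Algebra.smul_def, add_smul, add_comm]
    rw [dihedralElt, Finset.mul_sum, Finset.sum_smul]
    refine Finset.sum_congr rfl fun k hk => ?_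
    have hk' : k ≤ M t s := by
      rw [M.symmetric t s]; exact (Finset.mem_range.1 hk).le
    rw [mul_smul_comm, ← mul_assoc, hgen, smul_mul_assoc,
      cs.mul_heckeStd_wordProd (cs.isReduced_altWord hst.symm hM' hk'), length_altWord, smul_smul,
      smul_smul, mul_assoc]
    intro i hi
    rcases mem_altWord hi with rfl | rfl
    exacts [ht, hs]

/-- The witnesses are `x w` and `w y` for a factorization `z = x w y` through a longest dihedral
element `w`: overlapping the two factors in `w` produces the scalar `p` with its pole of order `m`.
-/
theorem exists_klCoeff_coeff_ne_zero {z : W} (hz : ¬ cs.HasUniqueReducedWord z) :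
    ∃ x y : W, ∃ m : ℕ, 2 ≤ m ∧ (cs.klCoeff x y z).coeff (-(m : ℤ)) ≠ 0 := by
  obtain ⟨x, y, s, t, hst, hM, hxy, hl⟩ := cs.exists_braid_factor hz
  have hm2 := two_le_of_ne hst hM
  have hw := (cs.isReduced_altWord hst hM le_rfl).eq
  rw [length_altWord] at hw
  set w := cs.wordProd (altWord s t (M s t)) with hwdef
  have h1 := cs.length_mul_le x (w * y)
  have h2 := cs.length_mul_le w y
  have h3 := cs.length_mul_le x w
  have h4 := cs.length_mul_le (x * w) y
  rw [mul_assoc] at h4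
  rw [← hxy] at h1 h4
  have hlwy : cs.length (w * y) = M s t + cs.length y := by omega
  have hlxw : cs.length (x * w) = cs.length x + M s t := by omega
  refine ⟨x * w, w * y, M s t, hm2, ?_⟩
  obtain ⟨ds, dt⟩ := cs.isLeftDescent_altWord_mul hst hM hlwy
  obtain ⟨cs', ct'⟩ := cs.isRightDescent_mul_altWord hst hM hlxw
  obtain ⟨p, hp, hcp⟩ := cs.exists_mul_dihedralElt_eq hst hM
    (cs.klBasis_mul_heckeStd_simple cs') (cs.klBasis_mul_heckeStd_simple ct')
  obtain ⟨hes, het⟩ := cs.heckeStd_simple_mul_dihedralElt hst hM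
  have hds := cs.heckeStd_simple_mul_klBasis ds
  have hdt := cs.heckeStd_simple_mul_klBasis dt
  rw [← hwdef] at hcp hds hdt
  set c := cs.klBasis (x * w) with hc
  set d := cs.klBasis (w * y) with hd
  obtain ⟨m, hm⟩ := Nat.exists_eq_succ_of_ne_zero hM
  -- Only the difference is divided by the dihedral element: this keeps the leading term `δ_y` of
  -- the quotient under control.
  have hrest : d - cs.dihedralElt s t * cs.heckeStd y ∈ cs.heckeFil (M s t + cs.length y) := by
    have e : cs.heckeStd (w * y) = cs.heckeStd w * cs.heckeStd y := by
      rw [heckeStd_mul]; rw [hlwy, hw]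
    have e2 : d - cs.dihedralElt s t * cs.heckeStd y = (d - cs.heckeStd (w * y)) -
        (cs.dihedralElt s t - cs.heckeStd w) * cs.heckeStd y := by
      rw [e, sub_mul]; abel
    rw [e2]
    refine Submodule.sub_mem _ (by rw [← hlwy]; exact cs.klBasis_sub_heckeStd_mem _) ?_
    have h5 := cs.dihedralElt_sub_mem hst hM
    rw [hm] at h5
    have h6 := cs.mul_mem_heckeFil (n := cs.length y + 1) h5
      (cs.heckeStd_mem_heckeFil (Nat.lt_succ_self _))
    rw [← hm] at h6
    refine cs.heckeFil_mono ?_ h6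
    omega
  obtain ⟨h, hh, he⟩ := cs.exists_eq_dihedralElt_mul hst hrest
    (by rw [mul_sub, hds, ← mul_assoc, hes, smul_mul_assoc, smul_sub])
    (by rw [mul_sub, hdt, ← mul_assoc, het, smul_mul_assoc, smul_sub]) hM
  have hde : d = cs.dihedralElt s t * (h + cs.heckeStd y) := by
    rw [mul_add, ← he, sub_add_cancel]
  have hhy : h + cs.heckeStd y ∈ cs.heckeFil (cs.length y + 1) :=
    Submodule.add_mem _ (cs.heckeFil_mono (by omega) hh)
      (cs.heckeStd_mem_heckeFil (Nat.lt_succ_self _))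
  have hlz : cs.length z = cs.length (x * w) + cs.length y := by omega
  -- Since lengths add in `(x w) y`, the leading term is `δ_z`, and the coefficient of `b_z` is
  -- exactly `1`.
  have hprod : c * (h + cs.heckeStd y) - cs.klBasis z ∈ cs.heckeFil (cs.length z) := by
    have e : cs.heckeStd z = cs.heckeStd (x * w) * cs.heckeStd y := by
      rw [heckeStd_mul, mul_assoc, ← hxy]
      rw [mul_assoc, ← hxy, hlz]
    have e2 : c * (h + cs.heckeStd y) - cs.klBasis z =
        (c - cs.heckeStd (x * w)) * (h + cs.heckeStd y) + cs.heckeStd (x * w) * h -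
          (cs.klBasis z - cs.heckeStd z) := by
      rw [e, sub_mul, mul_add (cs.heckeStd (x * w))]; abel
    rw [e2]
    refine Submodule.sub_mem _ (Submodule.add_mem _ ?_ ?_) (cs.klBasis_sub_heckeStd_mem z)
    · have h5 := cs.klBasis_sub_heckeStd_mem (x * w)
      obtain ⟨k, hk⟩ : ∃ k, cs.length (x * w) = k + 1 :=
        ⟨cs.length (x * w) - 1, by omega⟩
      rw [hk] at h5
      refine cs.heckeFil_mono ?_ (cs.mul_mem_heckeFil h5 hhy)
      omega
    · refine cs.heckeFil_mono ?_ (cs.heckeStd_mul_mem_heckeFil (x * w) hh)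
      omega
  have hcoef : cs.klCoeff (x * w) (w * y) z = p := by
    have h6 := cs.klB_repr_eq_zero hprod le_rfl
    rw [map_sub, Finsupp.sub_apply, klB_repr_klBasis, Finsupp.single_eq_same, sub_eq_zero] at h6
    rw [klCoeff_eq, ← hc, ← hd, hde, ← mul_assoc, hcp, smul_mul_assoc, map_smul,
      Finsupp.smul_apply, h6, smul_eq_mul, mul_one]
  rw [hcoef, hp]
  exact one_ne_zero

theorem hasUniqueReducedWord_of_aFunction_eq_one {z : W} (h : cs.aFunction z = 1) :
    cs.HasUniqueReducedWord z := by
  by_contra hz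
  rw [aFunction] at h
  set S := {k : ℕ∞ | ∃ n : ℕ, k = n ∧ ∀ x y : W,
    LaurentPolynomial.T (n : ℤ) * cs.klCoeff x y z ∈
      Set.range (Polynomial.toLaurent : ℤ[X] → ℤ[T;T⁻¹])} with hS
  -- An infimum over the empty set would be `⊤`, not `1`; so the set is nonempty and the bound `n =
  -- 1` is attained.
  have hne : S.Nonempty := by
    by_contra hne
    rw [Set.not_nonempty_iff_eq_empty] at hne
    rw [hne, sInf_empty] at h
    exact absurd h (by simp)
  have hmem := csInf_mem hne
  rw [h] at hmem
  obtain ⟨n, hn, hxy⟩ := hmem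
  obtain rfl : n = 1 := by exact_mod_cast hn.symm
  obtain ⟨x, y, m, hm, hc⟩ := cs.exists_klCoeff_coeff_ne_zero hz
  have h1 := hxy x y
  rw [← LaurentPolynomial.mem_orderGE_zero_iff] at h1
  have h2 := h1 (1 - m) (by omega)
  rw [LaurentPolynomial.coeff_T_mul] at h2
  apply hc
  rw [← h2]
  congr 1
  push_cast
  ring

/-- `W₁` is finite iff there are finitely many elements with a unique reduced expression. -/
theorem finite_aFunction_eq_one_iff : {x : W | cs.aFunction x = 1}.Finite ↔
    {z : W | cs.HasUniqueReducedWord z}.Finite := by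
  constructor
  · intro h
    -- The identity also has a unique reduced expression, the empty one, and is set aside.
    refine (h.insert 1).subset fun z hz => ?_
    by_cases h1 : z = 1
    · exact Or.inl h1
    · exact Or.inr (cs.aFunction_eq_one_of_hasUniqueReducedWord hz h1)
  · exact fun h => h.subset fun z hz => cs.hasUniqueReducedWord_of_aFunction_eq_one hz

end Parabolic

end CoxeterSystem

/-! ### Infinite families of braid-free words -/

section BraidFreeSequences

variable {B : Type*}

theorem getElem?_altWord (s t : B) (k j : ℕ) (h : j < k) :
    (altWord s t k)[j]? = some (if Even j then s else t) := by
  induction k generalizing s t j with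
  | zero => omega
  | succ k ih =>
    cases j with
    | zero => simp [altWord]
    | succ j =>
      rw [altWord, List.getElem?_cons_succ, ih _ _ _ (by omega)]
      by_cases hj : Even j <;> simp [hj, Nat.even_add_one]

theorem altWord_isInfix_map_range_iff (s t : B) (k n : ℕ) (f : ℕ → B) :
    altWord s t k <:+: (List.range n).map f ↔
      ∃ i, i + k ≤ n ∧ ∀ j < k, f (i + j) = if Even j then s else t := by
  rw [List.infix_iff_getElem?]
  simp only [length_altWord, List.length_map, List.length_range]
  constructor
  · rintro ⟨i, hi, h⟩
    refine ⟨i, by omega, fun j hj => ?_⟩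
    have := h j hj
    have h2 := getElem?_altWord s t k j hj
    rw [List.getElem?_eq_getElem (by simpa using hj)] at h2
    rw [Option.some.inj h2, List.getElem?_eq_getElem (by simp; omega)] at this
    simpa [add_comm] using this
  · rintro ⟨i, hi, h⟩
    refine ⟨i, by omega, fun j hj => ?_⟩
    have h2 := getElem?_altWord s t k j hj
    rw [List.getElem?_eq_getElem (by simpa using hj)] at h2
    rw [Option.some.inj h2, List.getElem?_eq_getElem (by simp; omega)]
    simpa [add_comm] using h j hj

open CoxeterSystem

variable {M : CoxeterMatrix B}

theorem isBraidFree_map_range_iff (n : ℕ) (f : ℕ → B) :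
    IsBraidFree M ((List.range n).map f) ↔ (∀ i, i + 1 < n → f i ≠ f (i + 1)) ∧
      ∀ s t, s ≠ t → M s t ≠ 0 → ∀ i, i + M s t ≤ n →
        ¬ ∀ j < M s t, f (i + j) = if Even j then s else t := by
  simp only [IsBraidFree, altWord_isInfix_map_range_iff, not_exists, not_and,
    List.isChain_iff_getElem, List.length_map, List.length_range, List.getElem_map,
    List.getElem_range]

theorem exists_map_range_eq {ω : List B} (h : ω ≠ []) :
    ∃ f : ℕ → B, (List.range ω.length).map f = ω := by
  refine ⟨fun i => ω.getD i (ω.head h), List.ext_getElem (by simp) fun i h1 h2 => ?_⟩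
  simp [h2]

/-- A sequence in the Dynkin diagram that backtracks only on edges with `m = ∞`, or with `m > 3`
but then not twice in a row, yields infinitely many braid-free words. -/
theorem infinite_isBraidFree_of_sequence (f : ℕ → B) (h1 : ∀ i, M.dynkinDiagram.Adj (f i) (f (i + 1)))
    (h2 : ∀ i, f i = f (i + 2) → M (f i) (f (i + 1)) = 0 ∨
      3 < M (f i) (f (i + 1)) ∧ f (i + 1) ≠ f (i + 3)) :
    {ω : List B | IsBraidFree M ω}.Infinite := by
  refine Set.infinite_of_injective_forall_mem (f := fun n : ℕ => (List.range n).map f)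
    (fun m n h => by simpa using congrArg List.length h) fun n => ?_
  rw [Set.mem_ofPred_eq, isBraidFree_map_range_iff]
  refine ⟨fun i _ => (h1 i).1, fun s t hst hM i _ h => ?_⟩
  -- A braid word in the sequence has `m ≥ 3`, because neighbours are adjacent in the diagram. It
  -- therefore backtracks once, and twice in a row if `m > 3`.
  have hm := two_le_of_ne hst hM
  have e0 : f i = s := by simpa using h 0 (by omega)
  have e1 : f (i + 1) = t := by simpa using h 1 (by omega)
  have hm2 : M s t ≠ 2 := e0 ▸ e1 ▸ (h1 i).2
  have e2 : f (i + 2) = s := by simpa using h 2 (by omega)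
  have e3 : 3 < M s t → f (i + 3) = t := fun h3 => by
    rw [h 3 h3, if_neg (by decide)]
  rcases h2 i (e0.trans e2.symm) with h' | ⟨h', h''⟩
  · rw [e0, e1] at h'; exact hM h'
  · rw [e0, e1] at h'
    exact h'' (e1.trans (e3 h').symm)

/-- The residues modulo `n`, as a sequence. -/
theorem exists_cyclic_sequence {n : ℕ} (hn : 0 < n) :
    ∃ r : ℕ → ℕ, ∀ i, r i < n ∧ r (i + 1) = if r i + 1 = n then 0 else r i + 1 := by
  refine ⟨fun i => i % n, fun i => ⟨Nat.mod_lt _ hn, ?_⟩⟩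
  have := Nat.mod_lt i hn
  have h : (i + 1) % n = (i % n + 1) % n := by simp
  simp only [h]
  split_ifs with h'
  · rw [h', Nat.mod_self]
  · exact Nat.mod_eq_of_lt (by omega)

/-- Running round a cycle for ever never backtracks, because its at least three vertices are
distinct. -/
theorem isAcyclic_of_finite_isBraidFree (h : {ω : List B | IsBraidFree M ω}.Finite) :
    M.dynkinDiagram.IsAcyclic := by
  intro u c hc
  have h3 := hc.three_le_length
  obtain ⟨r, hr⟩ := exists_cyclic_sequence (show 0 < c.length by omega)
  refine infinite_isBraidFree_of_sequence (fun i => c.getVert (r i)) (fun i => ?_)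
    (fun i hi => ?_) h
  · have ha := c.adj_getVert_succ (hr i).1
    rw [(hr i).2]
    split_ifs with h'
    · rw [h', c.getVert_length] at ha
      simpa using ha
    · exact ha
  · exfalso
    have h0 := hr i
    have h1 := hr (i + 1)
    have h2 := (hr (i + 2)).1
    have := hc.getVert_injOn' (x₁ := r i) (x₂ := r (i + 2)) (by simp; omega) (by simp; omega) hi
    rw [show i + 1 + 1 = i + 2 from rfl] at h1
    split_ifs at h0 h1 <;> omega

/-- Alternating for ever on an edge with `m = ∞` never completes a braid word. -/
theorem ne_zero_of_finite_isBraidFree (h : {ω : List B | IsBraidFree M ω}.Finite) (s t : B) :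
    M s t ≠ 0 := by
  intro h0
  have hst : s ≠ t := by rintro rfl; simp at h0
  have h0' : M t s = 0 := by rw [M.symmetric, h0]
  refine infinite_isBraidFree_of_sequence (fun i => if Even i then s else t) (fun i => ?_)
    (fun i _ => ?_) h
  · by_cases hi : Even i
    · simp [hi, Nat.even_add_one, CoxeterMatrix.dynkinDiagram, hst, h0]
    · simp [hi, Nat.even_add_one, CoxeterMatrix.dynkinDiagram, hst.symm, h0']
  · by_cases hi : Even i <;> simp [hi, Nat.even_add_one, h0, h0']

theorem finite_of_finite_isBraidFree (h : {ω : List B | IsBraidFree M ω}.Finite) : Finite B := by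
  refine Set.finite_univ_iff.1 (Set.Finite.subset (h.preimage (f := fun b => [b])
    fun a _ b _ hab => List.singleton_inj.1 hab) fun b _ => ⟨List.isChain_singleton b, ?_⟩)
  intro s t hst h0 hi
  have := hi.length_le
  have := two_le_of_ne hst h0
  simp at *
  omega

/-- Zigzagging along a path between two edges with `m > 3`. -/
theorem infinite_isBraidFree_of_zigzag (q : ℕ → B) (n : ℕ) (hn : 2 ≤ n)
    (hadj : ∀ i < n, M.dynkinDiagram.Adj (q i) (q (i + 1)))
    (hq : ∀ i, i + 2 ≤ n → q i ≠ q (i + 2)) (h0 : 3 < M (q 0) (q 1))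
    (h1 : 3 < M (q (n - 1)) (q n)) : {ω : List B | IsBraidFree M ω}.Infinite := by
  obtain ⟨r, hr⟩ := exists_cyclic_sequence (show 0 < 2 * n by omega)
  -- A triangle wave of period `2 n`, reflecting the index at `0` and at `n`.
  let f : ℕ → B := fun i => q (if r i ≤ n then r i else 2 * n - r i)
  have hf : ∀ i k, k = (if r i ≤ n then r i else 2 * n - r i) → f i = q k := by
    rintro i _ rfl; rfl
  refine infinite_isBraidFree_of_sequence f (fun i => ?_) (fun i hi => ?_)
  · obtain ⟨ha, hb⟩ := hr i
    by_cases h : r i < n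
    · rw [hf i (r i) (by split_ifs <;> omega), hf (i + 1) (r i + 1) (by split_ifs at * <;> omega)]
      exact hadj _ h
    · rw [hf (i + 1) (2 * n - r i - 1) (by split_ifs at * <;> omega),
        hf i (2 * n - r i - 1 + 1) (by split_ifs <;> omega)]
      exact (hadj _ (by omega)).symm
  · right
    obtain ⟨ha, hb⟩ := hr i
    have hb1 := (hr (i + 1)).2
    have hb2 := (hr (i + 2)).2
    rw [show i + 1 + 1 = i + 2 from rfl] at hb1
    rw [show i + 2 + 1 = i + 3 from rfl] at hb2
    -- Backtracking occurs only at the turning points `n` and `0`, on the heavy end edges. The next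
    -- step then moves on to `q (n - 2)` or `q 2`, so there is no second backtrack.
    rcases lt_trichotomy (r i + 1) n with h | h | h
    · rw [hf i (r i) (by split_ifs at * <;> omega),
        hf (i + 2) (r i + 2) (by split_ifs at * <;> omega)] at hi
      exact absurd hi (hq _ (by omega))
    · rw [hf i (n - 1) (by split_ifs at * <;> omega), hf (i + 1) n (by split_ifs at * <;> omega),
        hf (i + 3) (n - 2) (by split_ifs at * <;> omega)]
      refine ⟨h1, fun h => hq (n - 2) (by omega) ?_⟩
      rw [← h]; congr 1; omega
    · rcases (show r i + 1 < 2 * n ∨ r i + 1 = 2 * n by omega) with h' | h'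
      · rw [hf (i + 2) (2 * n - r i - 2) (by split_ifs at * <;> omega),
          hf i (2 * n - r i - 2 + 2) (by split_ifs at * <;> omega)] at hi
        exact absurd hi.symm (hq _ (by omega))
      · rw [hf i 1 (by split_ifs at * <;> omega), hf (i + 1) 0 (by split_ifs at * <;> omega),
          hf (i + 3) 2 (by split_ifs at * <;> omega)]
        exact ⟨by rwa [M.symmetric], hq 0 hn⟩

theorem dynkinDiagram_adj_of_lt {s t : B} (h : 3 < M s t) : M.dynkinDiagram.Adj s t :=
  ⟨by rintro rfl; simp at h, by omega⟩

theorem eq_of_finite_isBraidFree (h : {ω : List B | IsBraidFree M ω}.Finite) {s t s' t' : B}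
    (hr : M.dynkinDiagram.Reachable s s') (hst : 3 < M s t) (hst' : 3 < M s' t') :
    s(s, t) = s(s', t') := by
  classical
  by_contra hne
  -- Among all choices of an end of either heavy edge, take a shortest walk between the chosen ends.
  have hex : ∃ n, ∃ x y x' y', s(x, y) = s(s, t) ∧ s(x', y') = s(s', t') ∧
      ∃ p : M.dynkinDiagram.Walk x x', p.length = n :=
    ⟨_, s, t, s', t', rfl, rfl, hr.some, rfl⟩
  obtain ⟨x, y, x', y', hxy, hxy', p, hp⟩ := Nat.find_spec hex
  have hmin : ∀ a b a' b', s(a, b) = s(s, t) → s(a', b') = s(s', t') →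
      ∀ p' : M.dynkinDiagram.Walk a a', p.length ≤ p'.length := fun a b a' b' h1 h2 p' =>
    hp.trans_le (Nat.find_min' hex ⟨a, b, a', b', h1, h2, p', rfl⟩)
  have hpath : p.IsPath := p.isPath_of_length_eq_dist <| by
    obtain ⟨p', hp'⟩ := p.reachable.exists_walk_length_eq_dist
    exact le_antisymm (hp' ▸ hmin x y x' y' hxy hxy' p') (SimpleGraph.dist_le p)
  have hM : ∀ {a b c d : B}, s(a, b) = s(c, d) → 3 < M c d → 3 < M a b := by
    intro a b c d h h'
    rcases Sym2.eq_iff.1 h with ⟨rfl, rfl⟩ | ⟨rfl, rfl⟩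
    · exact h'
    · rwa [M.symmetric]
  have h1 := hM hxy hst
  have h1' := hM hxy' hst'
  set n := p.length with hn
  -- The shortest path, extended at both ends by the heavy edges: `y`, then the path from `x` to
  -- `x'`, then `y'`.
  let q : ℕ → B := fun i => if i = 0 then y else if i ≤ n + 1 then p.getVert (i - 1) else y'
  have q0 : q 0 = y := rfl
  have qs : ∀ i ≤ n, q (i + 1) = p.getVert i := fun i hi => by simp [q, hi]
  have qe : q (n + 2) = y' := by simp [q]
  have q1 : q 1 = x := by rw [qs 0 (by omega), p.getVert_zero]
  have qn : q (n + 1) = x' := by rw [qs n le_rfl, hn, p.getVert_length]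
  refine infinite_isBraidFree_of_zigzag q (n + 2) (by omega) (fun i hi => ?_) (fun i hi => ?_)
    (by rwa [q0, q1, M.symmetric]) (by rwa [show n + 2 - 1 = n + 1 from rfl, qn, qe]) h
  · rcases Nat.eq_zero_or_pos i with rfl | hpos
    · rw [q0, q1]; exact (dynkinDiagram_adj_of_lt h1).symm
    · obtain ⟨i, rfl⟩ := Nat.exists_eq_add_of_le' hpos
      rcases (show i < n ∨ i = n by omega) with h | rfl
      · rw [qs i h.le, qs (i + 1) h]; exact p.adj_getVert_succ h
      · rw [qn, qe]; exact dynkinDiagram_adj_of_lt h1'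
  · rcases Nat.eq_zero_or_pos n with h0 | hpos
    -- The path is trivial, so `x = x'`; if also `y = y'`, the two heavy edges would coincide.
    · obtain rfl : i = 0 := by omega
      have : x = x' := by rw [← q1, ← qn, h0]
      rw [q0, show q (0 + 2) = y' by rw [← qe, h0]]
      rintro rfl
      exact hne (by rw [← hxy, ← hxy', this])
    -- If the path began or ended along a heavy edge, replacing the chosen end by the other one
    -- would shorten it; in the interior it is injective.
    rcases Nat.eq_zero_or_pos i with rfl | hi0
    · rw [q0, qs 1 hpos]
      intro h
      have := hmin y x x' y' (by rw [Sym2.eq_swap, hxy]) hxy' ((p.drop 1).copy h.symm rfl)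
      simp at this
      omega
    · obtain ⟨i, rfl⟩ := Nat.exists_eq_add_of_le' hi0
      rcases (show i + 2 ≤ n ∨ i + 1 = n by omega) with h | h
      · rw [qs i (by omega), qs (i + 2) h]
        intro h'
        have := hpath.getVert_injOn (by simp; omega) (by simp; omega) h'
        omega
      · rw [qs i (by omega), show i + 1 + 2 = n + 2 by omega, qe]
        intro h'
        have := hmin x y y' x' hxy (by rw [Sym2.eq_swap, hxy']) ((p.take i).copy rfl h')
        simp [SimpleGraph.Walk.take_length] at this
        omega

end BraidFreeSequences

/-! ### Walks in a forest that backtrack along a single edge -/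

section BoundedWalks

variable {V : Type*} {G : SimpleGraph V}

theorem exists_walk_of_sequence (f : ℕ → V) (N : ℕ) (h : ∀ i < N, G.Adj (f i) (f (i + 1))) :
    ∃ p : G.Walk (f 0) (f N), p.edges = (List.range N).map fun i => s(f i, f (i + 1)) := by
  induction N with
  | zero => exact ⟨.nil, rfl⟩
  | succ N ih =>
    obtain ⟨p, hp⟩ := ih fun i hi => h i (by omega)
    exact ⟨p.concat (h N (by omega)), by
      rw [SimpleGraph.Walk.edges_concat, hp, List.range_succ, List.map_append]; simp⟩

theorem sym2_eq_succ_iff {a b c : V} : s(a, b) = s(b, c) ↔ a = c := by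
  constructor
  · intro h
    rcases Sym2.eq_iff.1 h with ⟨rfl, rfl⟩ | ⟨h, -⟩
    · rfl
    · exact h
  · rintro rfl
    exact Sym2.eq_swap

/-- A walk in a forest that does not backtrack traverses each edge at most once. -/
theorem SimpleGraph.IsAcyclic.edge_ne_of_sequence (hG : G.IsAcyclic) (f : ℕ → V) {i j : ℕ}
    (hij : i < j) (h : ∀ k, i ≤ k → k ≤ j → G.Adj (f k) (f (k + 1)))
    (hb : ∀ k, i ≤ k → k < j → f k ≠ f (k + 2)) : s(f i, f (i + 1)) ≠ s(f j, f (j + 1)) := by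
  obtain ⟨p, hp⟩ := exists_walk_of_sequence (fun k => f (i + k)) (j - i + 1) fun k hk =>
    h (i + k) (by omega) (by omega)
  have hpath : p.IsPath := by
    rw [hG.isPath_iff_isChain, hp, List.isChain_iff_getElem]
    intro k hk
    simp only [List.length_map, List.length_range] at hk
    simp only [List.getElem_map, List.getElem_range]
    intro h'
    exact hb (i + k) (by omega) (by omega) (sym2_eq_succ_iff.1 h')
  have hnd := hpath.isTrail.edges_nodup
  rw [hp] at hnd
  intro h'
  have := List.inj_on_of_nodup_map hnd (x := 0) (by simp) (y := j - i) (by simp) (by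
    simpa only [← Nat.add_assoc, Nat.add_sub_cancel' hij.le, Nat.add_zero] using h')
  omega

variable (hG : G.IsAcyclic) (f : ℕ → V) {N : ℕ} (h : ∀ i < N, G.Adj (f i) (f (i + 1)))
  (e : Sym2 V) (he : ∀ i, i + 2 ≤ N → f i = f (i + 2) → s(f i, f (i + 1)) = e)

include hG h he in
-- Traversing an edge twice in a forest forces a backtrack in between, and a backtrack traverses
-- `e`.
theorem exists_edge_eq_of_edge_eq {i j : ℕ} (hij : i < j) (hj : j < N)
    (hE : s(f i, f (i + 1)) = s(f j, f (j + 1))) : ∃ k, i ≤ k ∧ k ≤ j ∧ s(f k, f (k + 1)) = e := by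
  by_contra! hc
  exact hG.edge_ne_of_sequence f hij (fun k _ hk => h k (by omega))
    (fun k hk hkj hf => hc k hk hkj.le (he k (by omega) hf)) hE

include hG h he in
-- Between two successive traversals of `e` there is no room to backtrack, so acyclicity makes these
-- traversals immediate neighbours in time.
theorem edge_eq_of_between {i j : ℕ} (hj : j < N) (hi : s(f i, f (i + 1)) = e)
    (hE : s(f j, f (j + 1)) = e) {k : ℕ} (hik : i ≤ k) (hkj : k ≤ j) : s(f k, f (k + 1)) = e := by
  induction hd : j - i using Nat.strong_induction_on generalizing i j with
  | _ d ih =>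
  by_cases hex : ∃ l, i < l ∧ l < j ∧ s(f l, f (l + 1)) = e
  · obtain ⟨l, h1, h2, hl⟩ := hex
    rcases le_total k l with hkl | hkl
    · exact ih (l - i) (by omega) (by omega) hi hl hik hkl rfl
    · exact ih (j - l) (by omega) hj hl hE hkl hkj rfl
  · rcases (show k = i ∨ k = j ∨ i + 1 < j by omega) with rfl | rfl | hij
    · exact hi
    · exact hE
    · exfalso
      refine hG.edge_ne_of_sequence f (show i < j by omega) (fun k _ hk => h k (by omega))
        (fun l hl hlj hf => hex ?_) (hi.trans hE.symm)
      have h1 := he l (by omega) hf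
      -- Backtracking right at time `i` repeats edge `e` at time `i + 1`, still strictly before `j`.
      rcases hl.eq_or_lt with rfl | hl
      · exact ⟨i + 1, by omega, hij, (sym2_eq_succ_iff.2 hf).symm.trans h1⟩
      · exact ⟨l, hl, hlj, h1⟩

include hG h he in
/-- A long walk in a finite forest that backtracks only along `e` alternates along `e` for long. -/
theorem exists_alternating_of_lt [Finite V] (K : ℕ) (hK : 2 ≤ K) (hN : Nat.card (Sym2 V) * K < N) :
    ∃ i, i + K < N ∧ ∀ k, k ≤ K → s(f (i + k), f (i + k + 1)) = e := by
  classical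
  cases nonempty_fintype V
  rw [Nat.card_eq_fintype_card] at hN
  obtain ⟨y, -, hy⟩ := Finset.exists_lt_card_fiber_of_mul_lt_card_of_maps_to
    (s := Finset.range N) (t := Finset.univ) (f := fun i => s(f i, f (i + 1))) (n := K)
    (by simp) (by simpa using hN)
  let g := Finset.orderEmbOfCardLe _ (Nat.succ_le_of_lt hy)
  have hg : ∀ a, g a < N ∧ s(f (g a), f (g a + 1)) = y := fun a => by
    simpa using Finset.orderEmbOfCardLe_mem _ (Nat.succ_le_of_lt hy) a
  -- The pigeonhole principle gives an edge `y` used more than `K ≥ 2` times. The walk uses `e`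
  -- between its first and second use and between its second and third, hence also at the second
  -- use.
  have hye : y = e := by
    have h01 : g ⟨0, by omega⟩ < g ⟨1, by omega⟩ := g.strictMono (Fin.mk_lt_mk.2 (by omega))
    have h12 : g ⟨1, by omega⟩ < g ⟨2, by omega⟩ := g.strictMono (Fin.mk_lt_mk.2 (by omega))
    obtain ⟨k, hk1, hk2, hk⟩ := exists_edge_eq_of_edge_eq hG f h e he h01 (hg _).1
      ((hg _).2.trans (hg _).2.symm)
    obtain ⟨l, hl1, hl2, hl⟩ := exists_edge_eq_of_edge_eq hG f h e he h12 (hg _).1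
      ((hg _).2.trans (hg _).2.symm)
    rw [← (hg ⟨1, by omega⟩).2]
    exact edge_eq_of_between hG f h e he (by have := (hg ⟨2, by omega⟩).1; omega) hk hl hk2 hl1
  subst hye
  -- The `K + 1` distinct times of use span at least `K` steps, and every edge in between is `e`.
  have hmono : ∀ a (ha : a < K + 1), g ⟨0, by omega⟩ + a ≤ g ⟨a, ha⟩ := by
    intro a
    induction a with
    | zero => intro _; rfl
    | succ a ih =>
      intro ha
      have h1 : g ⟨a, by omega⟩ < g ⟨a + 1, ha⟩ := g.strictMono (Fin.mk_lt_mk.2 (by omega))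
      have := ih (by omega)
      omega
  have hl := hmono K (by omega)
  have hlt := (hg ⟨K, by omega⟩).1
  exact ⟨g ⟨0, by omega⟩, by omega, fun k hk =>
    edge_eq_of_between hG f h y he hlt (hg ⟨0, by omega⟩).2 (hg _).2 (by omega) (by omega)⟩

end BoundedWalks

/-! ### Finiteness of the set of braid-free words -/

section BraidFreeFiniteness

open CoxeterSystem

variable {B : Type*} {M : CoxeterMatrix B}

/-- A braid-free word is a walk, since `s t` is a braid word when `m = 2`. It backtracks only where
`m > 3`, since `s t s` is one when `m = 3`. By connectedness of the walk these backtracks share one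
edge `e`, and a long alternation on `e` would contain its braid word. -/
theorem finite_isBraidFree [Finite B] (hG : M.dynkinDiagram.IsAcyclic) (h0 : ∀ s t, M s t ≠ 0)
    (hu : ∀ s t s' t', M.dynkinDiagram.Reachable s s' → 3 < M s t → 3 < M s' t' →
      s(s, t) = s(s', t')) : {ω : List B | IsBraidFree M ω}.Finite := by
  classical
  obtain ⟨K, hK⟩ : ∃ K, ∀ p : B × B, M p.1 p.2 ≤ K := by
    obtain ⟨K, hK⟩ := (Set.finite_range fun p : B × B => M p.1 p.2).bddAbove
    exact ⟨K, fun p => hK ⟨p, rfl⟩⟩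
  -- With `K` bounding all `m_{st}`, a longer word has more than `card (Sym2 B) * (K + 2)` steps,
  -- enough to alternate on `e` beyond the length of its braid word.
  refine (List.finite_length_le B (Nat.card (Sym2 B) * (K + 2) + 1)).subset fun ω hω => ?_
  rw [Set.mem_ofPred_eq] at hω ⊢
  by_contra! hlen
  obtain ⟨f, hf⟩ := exists_map_range_eq (ω := ω) (by rintro rfl; simp at hlen)
  rw [← hf, isBraidFree_map_range_iff] at hω
  obtain ⟨N, hN⟩ := Nat.exists_eq_add_of_le' (show 1 ≤ ω.length by omega)
  rw [hN] at hω hlen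
  obtain ⟨hc, hb⟩ := hω
  have hadj : ∀ i < N, M.dynkinDiagram.Adj (f i) (f (i + 1)) := by
    refine fun i hi => ⟨hc i (by omega), fun h2 => ?_⟩
    refine hb _ _ (hc i (by omega)) (h0 _ _) i (by omega) fun j hj => ?_
    rw [h2] at hj
    interval_cases j <;> simp
  have hreach : ∀ i ≤ N, M.dynkinDiagram.Reachable (f 0) (f i) := fun i hi =>
    (exists_walk_of_sequence f i fun j hj => hadj j (by omega)).choose.reachable
  have hheavy : ∀ i, i + 2 ≤ N → f i = f (i + 2) → 3 < M (f i) (f (i + 1)) := by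
    intro i hi he
    have h2 := two_le_of_ne (hc i (by omega)) (h0 (f i) (f (i + 1)))
    have h2' := (hadj i (by omega)).2
    by_contra h3
    have h3 : M (f i) (f (i + 1)) = 3 := by omega
    refine hb _ _ (hc i (by omega)) (h0 _ _) i (by omega) fun j hj => ?_
    rw [h3] at hj
    interval_cases j
    · simp
    · simp
    · simpa using he.symm
  obtain ⟨e, he⟩ : ∃ e, ∀ i, i + 2 ≤ N → f i = f (i + 2) → s(f i, f (i + 1)) = e := by
    by_cases hex : ∃ i, i + 2 ≤ N ∧ f i = f (i + 2)
    · obtain ⟨i, hi, hfi⟩ := hex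
      exact ⟨s(f i, f (i + 1)), fun j hj hfj => hu _ _ _ _
        ((hreach j (by omega)).symm.trans (hreach i (by omega))) (hheavy j hj hfj)
        (hheavy i hi hfi)⟩
    -- Without any backtracking the choice of `e` is immaterial.
    · exact ⟨s(f 0, f 0), fun i hi hfi => absurd ⟨i, hi, hfi⟩ hex⟩
  obtain ⟨i, hi, halt⟩ := exists_alternating_of_lt hG f hadj e he (K + 2) (by omega) (by omega)
  have hMK : M (f i) (f (i + 1)) ≤ K := hK (f i, f (i + 1))
  refine hb _ _ (hc i (by omega)) (h0 _ _) i (by omega) fun j hj => ?_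
  have hstep : ∀ k, k < K → f (i + k + 2) = f (i + k) := fun k hk =>
    (sym2_eq_succ_iff.1 ((halt k (by omega)).trans (halt (k + 1) (by omega)).symm)).symm
  replace hj : j < K := by omega
  induction j using Nat.twoStepInduction with
  | zero => simp
  | one => simp
  | more j ih _ =>
    have := hstep j (by omega)
    rw [add_assoc] at this
    rw [this, ih (by omega)]
    simp [Nat.even_add]

theorem SimpleGraph.isAcyclic_of_connectedComponent {V : Type*} {G : SimpleGraph V}
    (h : ∀ c : G.ConnectedComponent, c.toSimpleGraph.IsAcyclic) : G.IsAcyclic := by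
  classical
  intro u p hp
  have hs : ∀ x ∈ p.support, x ∈ (G.connectedComponentMk u).supp := fun x hx =>
    SimpleGraph.ConnectedComponent.sound ⟨(p.takeUntil x hx).reverse⟩
  refine h (G.connectedComponentMk u) (p.induce _ hs)
    ((SimpleGraph.Walk.isCycle_map_iff_of_injective
      (f := (SimpleGraph.Embedding.induce (G.connectedComponentMk u).supp).toHom)
      Subtype.val_injective).1 ?_)
  rwa [SimpleGraph.Walk.map_induce]

theorem finite_isBraidFree_iff : {ω : List B | IsBraidFree M ω}.Finite ↔
    Finite B ∧
      ∀ c : M.dynkinDiagram.ConnectedComponent,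
        c.toSimpleGraph.IsTree ∧
        (∀ s ∈ c.supp, ∀ t ∈ c.supp, M s t ≠ 0) ∧
        (∀ s ∈ c.supp, ∀ t ∈ c.supp, ∀ s' ∈ c.supp, ∀ t' ∈ c.supp,
          3 < M s t → 3 < M s' t' → s(s, t) = s(s', t')) := by
  constructor
  · intro h
    refine ⟨finite_of_finite_isBraidFree h, fun c =>
      ⟨(isAcyclic_of_finite_isBraidFree h).isTree_connectedComponent c,
        fun s _ t _ => ne_zero_of_finite_isBraidFree h s t,
        fun s hs t _ s' hs' t' _ => eq_of_finite_isBraidFree h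
          (SimpleGraph.ConnectedComponent.exact (Eq.trans hs (Eq.symm hs')))⟩⟩
  · rintro ⟨hB, h⟩
    have hmem : ∀ {s t}, M.dynkinDiagram.Reachable s t →
        t ∈ (M.dynkinDiagram.connectedComponentMk s).supp := fun hr =>
      SimpleGraph.ConnectedComponent.sound hr.symm
    refine finite_isBraidFree (SimpleGraph.isAcyclic_of_connectedComponent fun c =>
      (h c).1.isAcyclic) (fun s t h0 => ?_) fun s t s' t' hr hst hst' => ?_
    · have hadj : M.dynkinDiagram.Adj s t := ⟨by rintro rfl; simp at h0, by omega⟩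
      exact (h _).2.1 s (hmem (.refl s)) t (hmem hadj.reachable) h0
    · exact (h _).2.2 s (hmem (.refl s)) t (hmem (dynkinDiagram_adj_of_lt hst).reachable) s'
        (hmem hr) t' (hmem (hr.trans (dynkinDiagram_adj_of_lt hst').reachable)) hst hst'

end BraidFreeFiniteness

theorem mainTheorem9 {B W : Type*} [Group W] {M : CoxeterMatrix B} (cs : CoxeterSystem M W) :
    {x : W | cs.aFunction x = 1}.Finite ↔
      Finite B ∧
        ∀ c : M.dynkinDiagram.ConnectedComponent,
          c.toSimpleGraph.IsTree ∧
          (∀ s ∈ c.supp, ∀ t ∈ c.supp, M s t ≠ 0) ∧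
          (∀ s ∈ c.supp, ∀ t ∈ c.supp, ∀ s' ∈ c.supp, ∀ t' ∈ c.supp,
            3 < M s t → 3 < M s' t' → s(s, t) = s(s', t')) :=
  cs.finite_aFunction_eq_one_iff.trans
    (cs.finite_hasUniqueReducedWord_iff.trans finite_isBraidFree_iff)
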